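/- **Setting.** Let $n\ge 2$, and consider type $D_{n+1}$ with simple roots $\alpha_i=\varepsilon_i-\varepsilon_{i+1}$ ($1\le i\le n$), $\alpha_{n+1}=\varepsilon_n+\varepsilon_{n+1}$, simple reflections $s_i$, positive roots $\Phi^+=\{\varepsilon_a\pm\varepsilon_b : a<b\}$ and longest Weyl group element $w_0$; put $w_0(\alpha_i)=-\alpha_{i^*}$. Let $\vee$ be the diagram automorphism exchanging $n$ and $n+1$, and let $\bar i=\min(i,n)\in\{1,\dots,n\}$ denote the $\vee$-orbit of $i$. *Twisted adapted classes.* $[\mathbf i]$ is the class of a reduced word $\mathbf i$ of $w_0$ under commutation relations $s_is_j=s_js_i$. The reflection functors replace $[i_1i_2\cdots i_N]$ by $[i_2\cdots i_Ni_1^*]$ or by $[i_N^*i_1\cdots i_{N-1}]$. The twisted adapted classes $[Q^\leftarrow]$ are the classes obtained by reflection functors from the class of $\prod_{k=0}^{n}(1\,2\cdots n)^{k\vee}$, where $(j_1\cdots j_l)^{k\vee}$ is the word with $\vee^k$ applied to each letter. *Folded coordinates.* Write a twisted adapted class as $\big[\prod_{k=0}^{n}(i_1\cdots i_n)^{k\vee}\big]$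 with one letter $i_k$ from each $\vee$-orbit. Let $Q$ be the orientation of the $A_n$ diagram to which $\bar i_1\cdots\bar i_n$ is adapted (each $\bar i_k$ is a sink after the arrows at $\bar i_1,\dots,\bar i_{k-1}$ have successively been reversed), and let $\xi:\{1,\dots,n\}\to\mathbb Z$ satisfy $\xi(a)=\xi(b)+1$ for every arrow $b\to a$ of $Q$. The root $s_{i_1}\cdots s_{i_{k-1}}(\alpha_{i_k})$ has folded coordinate $(\bar i_k,\xi(\bar i_k))$; the root $s_{i_1}\cdots s_{i_n}s_{i_1^\vee}\cdots s_{i_{k-1}^\vee}(\alpha_{i_k^\vee})$ has folded coordinate $(\bar i_k,\xi(\bar i_k)-2)$; and, with $\psi=s_{i_1}\cdots s_{i_n}s_{i_1^\vee}\cdots s_{i_n^\vee}$, if $\beta$ and $\psi(\beta)$ are positive and $\beta$ has folded coordinate $(a,p)$, then $\psi(\beta)$ has folded coordinate $(a,p-4)$. *Generalized distance.* Fix a class $[\mathbf j]$ of reduced words of $w_0$. A word $\mathbf j'=j_1\cdots j_N$ in it orders $\Phi^+$ by $s_{j_1}\cdots s_{j_{k-1}}(\alpha_{j_k})<_{\mathbf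 j'}s_{j_1}\cdots s_{j_{l-1}}(\alpha_{j_l})$ for $k<l$, and $\alpha\prec_{[\mathbf j]}\beta$ means $\alpha<_{\mathbf j'}\beta$ for all $\mathbf j'\in[\mathbf j]$. For sequences $m,m'\in\mathbb Z_{\ge0}^{\Phi^+}$, write $m\prec^b_{[\mathbf j]}m'$ if $\sum m_\beta\beta=\sum m'_\beta\beta$ and, for every $\mathbf j'\in[\mathbf j]$, $m_\beta<m'_\beta$ both at the $<_{\mathbf j'}$-smallest and at the $<_{\mathbf j'}$-largest root $\beta$ where $m$ and $m'$ differ (and they do differ). A pair $\{\alpha,\beta\}$ of distinct roots, seen as a sequence, is simple if no sequence is $\prec^b_{[\mathbf j]}$-below it; a sequence $m$ is simple if $\sum m_\beta=1$ or all pairs of distinct roots in its support are simple. If $m$ is simple, $\mathrm{gdist}_{[\mathbf j]}(m)=0$; otherwise it is the largest $k$ for which there is a chain $m^{(1)}\prec^b_{[\mathbf j]}\cdots\prec^b_{[\mathbf j]}m^{(k)}=m$ of non-simple sequences. Finally $\mathrm{gdist}_{[\mathbf j]}(\alpha,\beta)$ is the value at the pair $\{\alpha,\beta\}$ if $\alpha,\beta$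 are comparable for $\prec_{[\mathbf j]}$, and $0$ otherwise. **Theorem.** (a) Let $[Q^\leftarrow]$ be a twisted adapted class, let $\alpha,\beta\in\Phi^+$ have folded coordinates $(\bar i,p)$ and $(\bar j,q)$, and put $d=|p-q|$ (the numbers $\bar i,\bar j\in\{1,\dots,n\}$ are written $i,j$). Then $$\mathrm{gdist}_{[Q^\leftarrow]}(\alpha,\beta)=\begin{cases}2 & \text{if } 2n+2-i-j<d\le i+j,\\ 1 & \text{if } |i-j|<d\le i+j \text{ and } d<2n+2-i-j,\\ 1&\text{if } i+j<d,\ 2n+2-i-j<d\le 2n+2-|i-j|,\\ 0&\text{otherwise.}\end{cases}$$ (b) Consequently $\mathrm{gdist}$ depends only on $\bar i$, $\bar j$ and $|p-q|$, and not on the class: if $[Q_1^\leftarrow]$, $[Q_2^\leftarrow]$ are twisted adapted classes, $\alpha,\beta$ have folded coordinates $(\bar i,p),(\bar j,q)$ with respect to $[Q_1^\leftarrow]$, $\alpha',\beta'$ have folded coordinates $(\bar i,p'),(\bar j,q')$ with respect to $[Q_2^\leftarrow]$, and $|p-q|=|p'-q'|$, then $\mathrm{gdist}_{[Q_1^\leftarrow]}(\alpha,\beta)=\mathrm{gdist}_{[Q_2^\leftarrow]}(\alpha',\beta')$.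 -/

import Mathlib

namespace TwistedD

/-! Type `D_{n+1}`, realised in `ℤ^{n+1}` with the standard inner product.  The index set
`I = {1, …, n+1}` of the Dynkin diagram is `Fin (n + 1)`, the element `i` standing for the
vertex `i + 1`. -/

/-- The lattice `ℤε_1 ⊕ ⋯ ⊕ ℤε_{n+1}`. -/
abbrev Lat (n : ℕ) : Type := Fin (n + 1) → ℤ

/-- `ε_i`. -/
def eps {n : ℕ} (i : Fin (n + 1)) : Lat n := Pi.single i 1

/-- Simple roots: `ε_i - ε_{i+1}` for the vertices `1, …, n`, and `ε_n + ε_{n+1}` for the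
vertex `n + 1`. -/
def simpleRoot {n : ℕ} (i : Fin (n + 1)) : Lat n :=
  if h : i.val < n then eps i - eps ⟨i.val + 1, by omega⟩
  else eps ⟨n - 1, by omega⟩ + eps i

/-- Positive roots `ε_a - ε_b` and `ε_a + ε_b`, for `a < b`. -/
def IsPosRoot {n : ℕ} (v : Lat n) : Prop :=
  ∃ a b : Fin (n + 1), a < b ∧ (v = eps a - eps b ∨ v = eps a + eps b)

/-- The set `Φ⁺` as a type. -/
abbrev PosRoot (n : ℕ) : Type := {v : Lat n // IsPosRoot v}

/-- The simple reflection `s_i` (all roots have square length `2`). -/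
def refl {n : ℕ} (i : Fin (n + 1)) : Module.End ℤ (Lat n) where
  toFun v := v - (v ⬝ᵥ simpleRoot i) • simpleRoot i
  map_add' u v := by rw [add_dotProduct, add_smul]; abel
  map_smul' k v := by
    rw [smul_dotProduct, smul_eq_mul, mul_smul, smul_sub, RingHom.id_apply]

/-- The Weyl group element `s_{i_1} ⋯ s_{i_l}` of a word `i_1 ⋯ i_l`. -/
def wordMap {n : ℕ} (w : List (Fin (n + 1))) : Module.End ℤ (Lat n) := (w.map refl).prod

/-- The diagram automorphism `∨`, which exchanges the vertices `n` and `n + 1`. -/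
def vee {n : ℕ} : Equiv.Perm (Fin (n + 1)) := Equiv.swap ⟨n - 1, by omega⟩ (Fin.last n)

/-- The orbit of a vertex under `∨`, as a number in `{1, …, n}`: the vertices `n` and `n + 1`
both have orbit `n`. -/
def bar {n : ℕ} (i : Fin (n + 1)) : ℕ := min (i.val + 1) n

/-! ### Commutation classes and the twisted adapted cluster point -/

/-- One application of a commutation relation `s_i s_j = s_j s_i`. -/
def CommStep {n : ℕ} (w w' : List (Fin (n + 1))) : Prop :=
  ∃ (a b : List (Fin (n + 1))) (i j : Fin (n + 1)), Commute (refl i) (refl j) ∧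
    w = a ++ i :: j :: b ∧ w' = a ++ j :: i :: b

/-- Commutation equivalence; `[w]` is the set of all `w'` with `CommEquiv w w'`. -/
def CommEquiv {n : ℕ} : List (Fin (n + 1)) → List (Fin (n + 1)) → Prop :=
  Relation.EqvGen CommStep

/-- The reflection functor at a sink, on reduced words of `w_0`:
`i_1 i_2 ⋯ i_N ↦ i_2 ⋯ i_N i_1^*`, where `w_0(α_i) = -α_{i^*}`. -/
def RightReflStep {n : ℕ} (w w' : List (Fin (n + 1))) : Prop :=
  ∃ (i j : Fin (n + 1)) (t : List (Fin (n + 1))),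
    w = i :: t ∧ w' = t ++ [j] ∧ wordMap w (simpleRoot i) = -simpleRoot j

/-- The reflection functor at a source, on reduced words of `w_0`:
`i_1 ⋯ i_{N-1} i_N ↦ i_N^* i_1 ⋯ i_{N-1}`. -/
def LeftReflStep {n : ℕ} (w w' : List (Fin (n + 1))) : Prop :=
  ∃ (i j : Fin (n + 1)) (t : List (Fin (n + 1))),
    w = t ++ [i] ∧ w' = j :: t ∧ wordMap w (simpleRoot i) = -simpleRoot j

/-- The word `∏_{k=0}^{n} (i_1 ⋯ i_l)^{k∨}`. -/
def twistedPower {n : ℕ} (c : List (Fin (n + 1))) : List (Fin (n + 1)) :=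
  (List.range (n + 1)).flatMap fun k => c.map (vee ^ k : Equiv.Perm (Fin (n + 1)))

/-- The word `∏_{k=0}^{n} (1 2 ⋯ n)^{k∨}`, a reduced word of the longest element `w_0`. -/
def baseWord (n : ℕ) : List (Fin (n + 1)) :=
  twistedPower ((List.finRange n).map Fin.castSucc)

/-- `[w]` is a twisted adapted class: it is obtained from the class of the base word by
reflection functors. -/
def TwistedAdapted {n : ℕ} (w : List (Fin (n + 1))) : Prop :=
  Relation.ReflTransGen (fun u v => CommEquiv u v ∨ RightReflStep u v ∨ LeftReflStep u v)
    (baseWord n) w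

/-! ### Convex orders, sequences of positive roots and generalized distance -/

/-- `β_k = s_{i_1} ⋯ s_{i_{k-1}}(α_{i_k})`, with `k` counted from `0`. -/
def rootAt {n : ℕ} (w : List (Fin (n + 1))) (k : Fin w.length) : Lat n :=
  wordMap (w.take k) (simpleRoot (w.get k))

/-- The total order `<_w` on `Φ⁺` of a reduced word `w` of `w_0`. -/
def RootLT {n : ℕ} (w : List (Fin (n + 1))) (α β : PosRoot n) : Prop :=
  ∃ k l : Fin w.length, k < l ∧ rootAt w k = α.1 ∧ rootAt w l = β.1

/-- The convex partial order `≺_[w]` on `Φ⁺`. -/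
def RootPrec {n : ℕ} (w : List (Fin (n + 1))) (α β : PosRoot n) : Prop :=
  ∀ w', CommEquiv w w' → RootLT w' α β

/-- A sequence `(m_β)_{β ∈ Φ⁺}` of non-negative integers. -/
abbrev RootSeq (n : ℕ) : Type := PosRoot n →₀ ℕ

/-- The weight `∑ m_β β`. -/
def weight {n : ℕ} (m : RootSeq n) : Lat n := m.sum fun β k => k • β.1

/-- The bi-lexicographical order `m <^b_w m'`: `m` is smaller than `m'` lexicographically, read
from the smallest root upwards as well as from the largest root downwards. -/
def BiLexLT {n : ℕ} (w : List (Fin (n + 1))) (m m' : RootSeq n) : Prop :=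
  (∃ β, m β < m' β ∧ ∀ γ, RootLT w γ β → m γ = m' γ) ∧
  (∃ β, m β < m' β ∧ ∀ γ, RootLT w β γ → m γ = m' γ)

/-- The order `≺^b_[w]`. -/
def SeqPrec {n : ℕ} (w : List (Fin (n + 1))) (m m' : RootSeq n) : Prop :=
  weight m = weight m' ∧ ∀ w', CommEquiv w w' → BiLexLT w' m m'

/-- The pair of two (distinct) positive roots, as a sequence. -/
noncomputable def pairSeq {n : ℕ} (α β : PosRoot n) : RootSeq n :=
  Finsupp.single α 1 + Finsupp.single β 1

/-- A pair is `[w]`-simple if no sequence lies below it. -/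
def SimplePair {n : ℕ} (w : List (Fin (n + 1))) (α β : PosRoot n) : Prop :=
  ¬ ∃ m, SeqPrec w m (pairSeq α β)

/-- A sequence is `[w]`-simple if it is a single root or all pairs in its support are simple. -/
def SimpleSeq {n : ℕ} (w : List (Fin (n + 1))) (m : RootSeq n) : Prop :=
  (m.sum fun _ k => k) = 1 ∨
    ∀ α β, α ≠ β → 0 < m α → 0 < m β → SimplePair w α β

/-- `l` is a chain `m^{(1)} ≺^b ⋯ ≺^b m^{(k)} = m` of non-simple sequences. -/
def IsDistChain {n : ℕ} (w : List (Fin (n + 1))) (m : RootSeq n) (l : List (RootSeq n)) : Prop :=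
  l.IsChain (SeqPrec w) ∧ l.getLast? = some m ∧ ∀ x ∈ l, ¬ SimpleSeq w x

open Classical in
/-- The generalized `[w]`-distance of a sequence: `0` if it is simple, and otherwise the largest
length of a chain of non-simple sequences that ends in it. -/
noncomputable def gdistSeq {n : ℕ} (w : List (Fin (n + 1))) (m : RootSeq n) : ℕ∞ :=
  if SimpleSeq w m then 0
  else ⨆ (l : List (RootSeq n)) (_ : IsDistChain w m l), (l.length : ℕ∞)

open Classical in
/-- The generalized `[w]`-distance of two positive roots; it is `0` for incomparable roots. -/
noncomputable def gdist {n : ℕ} (w : List (Fin (n + 1))) (α β : PosRoot n) : ℕ∞ :=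
  if RootPrec w α β ∨ RootPrec w β α then gdistSeq w (pairSeq α β) else 0

/-! ### Folded coordinates -/

/-- `Q a b` (an arrow from `a` to `b`) is an orientation of the Dynkin diagram of type `A_n`
with vertices `1, …, n`. -/
def IsQuiverA (n : ℕ) (Q : ℕ → ℕ → Prop) : Prop :=
  (∀ a b, Q a b → 1 ≤ a ∧ a ≤ n ∧ 1 ≤ b ∧ b ≤ n ∧ (a + 1 = b ∨ b + 1 = a)) ∧
  ∀ a, 1 ≤ a → a + 1 ≤ n → Xor (Q a (a + 1)) (Q (a + 1) a)

/-- `i` is a sink: no arrow leaves `i`. -/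
def IsSink (Q : ℕ → ℕ → Prop) (i : ℕ) : Prop := ∀ b, ¬ Q i b

/-- Reverse all arrows at `i`. -/
def reverseAt (i : ℕ) (Q : ℕ → ℕ → Prop) : ℕ → ℕ → Prop :=
  fun a b => ((a = i ∨ b = i) ∧ Q b a) ∨ (a ≠ i ∧ b ≠ i ∧ Q a b)

/-- The word `i_1 i_2 ⋯` is adapted to `Q`: each `i_k` is a sink of `i_{k-1} ⋯ i_1 Q`. -/
def Adapted : (ℕ → ℕ → Prop) → List ℕ → Prop
  | _, [] => True
  | Q, i :: t => IsSink Q i ∧ Adapted (reverseAt i Q) t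

/-- The data from which the coordinates on the folded AR-quiver of `[w]` are computed: a word `c`
of a twisted Coxeter element `(s_{i_1} ⋯ s_{i_n})∨` (one vertex from each `∨`-orbit) with
`[w] = [∏_{k=0}^{n} (i_1 ⋯ i_n)^{k∨}]`, the quiver `Q` of type `A_n` to which the word of the
orbits is adapted, and a height function `ξ` of `Q`. -/
structure IsFoldedData {n : ℕ} (w c : List (Fin (n + 1))) (Q : ℕ → ℕ → Prop) (ξ : ℕ → ℤ) :
    Prop where
  coxeter : (c.map bar).Perm (List.range' 1 n)
  mem_class : CommEquiv w (twistedPower c)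
  quiver : IsQuiverA n Q
  adapted : Adapted Q (c.map bar)
  height : ∀ a b, Q b a → ξ a = ξ b + 1

/-- `TwistedCoord c ξ β i p`: the positive root `β` has coordinate `(i, p)` in the twisted
AR-quiver.  With `φ = s_{i_1} ⋯ s_{i_n}` and `ψ = s_{i_1} ⋯ s_{i_n} s_{i_1^∨} ⋯ s_{i_n^∨}`,
the root `s_{i_1} ⋯ s_{i_{k-1}}(α_{i_k})` is at `(i_k, ξ(i_k))`, the root
`φ s_{i_1^∨} ⋯ s_{i_{k-1}^∨}(α_{i_k^∨})` is at `(i_k^∨, ξ(i_k) - 2)`, and `ψ(β)` is at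
`(i, p - 4)` if `β` is at `(i, p)` and both are positive. -/
inductive TwistedCoord {n : ℕ} (c : List (Fin (n + 1))) (ξ : ℕ → ℤ) :
    Lat n → Fin (n + 1) → ℤ → Prop
  | first (k : Fin c.length) : TwistedCoord c ξ (rootAt c k) (c.get k) (ξ (bar (c.get k)))
  | second (k : Fin c.length) :
      TwistedCoord c ξ (wordMap (c ++ (c.take k).map vee) (simpleRoot (vee (c.get k))))
        (vee (c.get k)) (ξ (bar (c.get k)) - 2)
  | step (β : Lat n) (i : Fin (n + 1)) (p : ℤ) : IsPosRoot β →
      IsPosRoot (wordMap (c ++ c.map vee) β) → TwistedCoord c ξ β i p →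
      TwistedCoord c ξ (wordMap (c ++ c.map vee) β) i (p - 4)

/-- The root `β` has folded coordinate `(a, p)`, where `a ∈ {1, …, n}` is a `∨`-orbit. -/
def FoldedCoord {n : ℕ} (c : List (Fin (n + 1))) (ξ : ℕ → ℤ) (β : PosRoot n) (a : ℕ) (p : ℤ) :
    Prop :=
  ∃ i : Fin (n + 1), TwistedCoord c ξ β.1 i p ∧ bar i = a

end TwistedD

namespace TwistedD

/-! Put `N = n + 1`. A slice `l` (the height function `ξ` in other coordinates) and a sign `σ`
define a sequence `f = sliceSeq n l σ` with values `±ε_κ` and `f (x + N) = -f x`. Every positive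
root is `f e - f c` for exactly one segment `[c, e]` of length `k ∈ {1, …, n}` in the window `l k ≤
c < l k + N` (`IsSlice.exists_segment`, `IsSlice.segment_inj`).

Reading a twisted Coxeter word raises the columns of the slice one at a time, and a letter of orbit
`k` produces the root of the segment in column `k` that is passed (`Fits.step`, `Fits.walk`). A
block raises every column by one, so `n + 1` blocks read the whole window. Two blocks shift `f` by
two places; hence the folded coordinate `(k, p)` encodes the segment by `k = e - c` and `p = const -
(c + e)` (`CoxeterSlice.segment_of_twistedCoord`). Letters in neighbouring columns force both ends
to grow weakly, and independent letters may be interchanged, so the convex order of the class is the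
product order on the pairs `(c, e)` (`ReadsWindow.before_of_le`, `ReadsWindow.exists_before`).
`SegModel` collects these facts.

The rest is combinatorics on `ℤ`. Any antiperiodic integer function is `L ∘ f` for an additive `L`,
so equal weight means equal boundary modulo antiperiodicity. Let `α = [a, b]` and `β = [a', b']`
with `a ≤ a'` and `b ≤ b'`. A sequence below the pair consists of segments between the two, and
testing with step and delta functions leaves three candidates (`SegDecomp.list`): `[a, b'] + [a',
b]` if `a' ≤ b` and `b' - a < N`; the wrapped `[b' - N, a + N] + [a', b]` if `a' ≤ b` and `N < b' -
a`; the crossed `[b' - N, b] + [a', a + N]` if `N < b' - a` and neither `b' - b` nor `a' - a`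
exceeds `N`. When `a' ≤ b` and `N < b' - a`, the last two both occur, and the wrapped one is the
union and intersection of the crossed segments: the distance is 2. A single candidate gives 1, none
gives 0. Since `b' - a = (d + i + j) / 2` and `b - a' = (i + j - d) / 2`, these are the inequalities
of (a), which involve only `i`, `j` and `d`; this gives (b). -/

/-! ### Antiperiodic functions on `ℤ` -/

/-- The antiperiodic function with value `1` on `[x, x + N)`. -/
noncomputable def sqWave (N x m : ℤ) : ℤ := if Even ((m - x) / N) then 1 else -1

/-- The antiperiodic function with value `1` at `x` that vanishes outside `x + Nℤ`. -/
noncomputable def comb (N x m : ℤ) : ℤ := if N ∣ m - x then sqWave N x m else 0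

theorem sqWave_add {N : ℤ} (hN : 0 < N) (x m : ℤ) : sqWave N x (m + N) = -sqWave N x m := by
  have : (m + N - x) / N = (m - x) / N + 1 := by
    rw [show m + N - x = (m - x) + 1 * N by ring, Int.add_mul_ediv_right _ _ hN.ne']
  unfold sqWave
  simp only [this, Int.even_add_one]
  split_ifs <;> simp_all

theorem comb_add {N : ℤ} (hN : 0 < N) (x m : ℤ) : comb N x (m + N) = -comb N x m := by
  unfold comb
  have : N ∣ m + N - x ↔ N ∣ m - x := by
    rw [show m + N - x = (m - x) + N by ring]; exact dvd_add_self_right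
  simp only [this, sqWave_add hN]
  split_ifs <;> simp

theorem sqWave_of_mem {N x m : ℤ} (h₁ : x ≤ m) (h₂ : m < x + N) : sqWave N x m = 1 := by
  have : (m - x) / N = 0 := Int.ediv_eq_zero_of_lt (by omega) (by omega)
  simp [sqWave, this]

theorem sqWave_of_lt {N x m : ℤ} (h₁ : x - N ≤ m) (h₂ : m < x) : sqWave N x m = -1 := by
  have h := sqWave_add (N := N) (by omega) x m
  rw [sqWave_of_mem (by omega) (by omega)] at h
  omega

theorem sqWave_of_ge {N x m : ℤ} (h₁ : x + N ≤ m) (h₂ : m < x + 2 * N) : sqWave N x m = -1 := by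
  have h := sqWave_add (N := N) (by omega) x (m - N)
  rw [sqWave_of_mem (m := m - N) (by omega) (by omega), sub_add_cancel] at h
  omega

theorem sqWave_of_lt' {N x m : ℤ} (h₁ : x - 2 * N ≤ m) (h₂ : m < x - N) : sqWave N x m = 1 := by
  have h := sqWave_add (N := N) (by omega) x m
  rw [sqWave_of_lt (by omega) (by omega)] at h
  omega

theorem comb_self (N x : ℤ) : comb N x x = 1 := by
  simp [comb, sqWave]

theorem comb_add_self {N : ℤ} (hN : 0 < N) (x : ℤ) : comb N x (x + N) = -1 := by
  rw [comb_add hN, comb_self]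

theorem comb_sub_self {N : ℤ} (hN : 0 < N) (x : ℤ) : comb N x (x - N) = -1 := by
  have h := comb_add hN x (x - N)
  rw [sub_add_cancel, comb_self] at h
  omega

theorem comb_eq_zero {N x m : ℤ} (h₁ : x - 2 * N < m) (h₂ : m < x + 2 * N) (h₃ : m ≠ x)
    (h₄ : m ≠ x + N) (h₅ : m ≠ x - N) : comb N x m = 0 := by
  unfold comb
  rw [if_neg]
  rintro ⟨k, hk⟩
  have hN : 0 < N := by omega
  have : k < 2 := by nlinarith
  have : -2 < k := by nlinarith
  interval_cases k <;> omega

/-- In this form the value of a delta function and the coincidence of endpoints that causes it can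
be passed to linear arithmetic together. -/
theorem comb_cases {N x m : ℤ} (h₁ : x - 2 * N < m) (h₂ : m < x + 2 * N) :
    (m = x ∧ comb N x m = 1) ∨ ((m = x + N ∨ m = x - N) ∧ comb N x m = -1) ∨
      (m ≠ x ∧ m ≠ x + N ∧ m ≠ x - N ∧ comb N x m = 0) := by
  have hN : 0 < N := by omega
  by_cases h₃ : m = x
  · exact .inl ⟨h₃, h₃ ▸ comb_self N x⟩
  by_cases h₄ : m = x + N
  · exact .inr (.inl ⟨.inl h₄, h₄ ▸ comb_add_self hN x⟩)
  by_cases h₅ : m = x - N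
  · exact .inr (.inl ⟨.inr h₅, h₅ ▸ comb_sub_self hN x⟩)
  exact .inr (.inr ⟨h₃, h₄, h₅, comb_eq_zero h₁ h₂ h₃ h₄ h₅⟩)

theorem comb_of_near {N x m : ℤ} (h₁ : x - N < m) (h₂ : m < x + N) (h : m ≠ x) :
    comb N x m = 0 :=
  comb_eq_zero (by omega) (by omega) h (by omega) (by omega)

/-! ### Decompositions of a sum of two segments -/

/-- The multiset consisting of the segment `[c, e]`, and empty if the segment is degenerate. -/
def segs (c e : ℤ) : Multiset (ℤ × ℤ) := if c < e then {(c, e)} else 0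

theorem segs_of_lt {c e : ℤ} (h : c < e) : segs c e = {(c, e)} := if_pos h

theorem segs_self (c : ℤ) : segs c c = 0 := if_neg (lt_irrefl c)

/-- A family of segments `[c, e]`, with `a ≤ c ≤ a'` and `b ≤ e ≤ b'`, other than `[a, b]` and
`[a', b']`, which has the same boundary, modulo antiperiodicity, as `[a, b]` and `[a', b']`. -/
structure SegDecomp (N a b a' b' : ℤ) (M : Multiset (ℤ × ℤ)) : Prop where
  lt : a < b
  lt_add : b < a + N
  lt' : a' < b'
  lt_add' : b' < a' + N
  le_left : a ≤ a'
  le_right : b ≤ b'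
  near : a' - a < N ∨ b' - b < N
  mem : ∀ c e, (c, e) ∈ M → a ≤ c ∧ c ≤ a' ∧ b ≤ e ∧ e ≤ b' ∧ c < e ∧ e < c + N
  ne : (a, b) ∉ M
  ne' : (a', b') ∉ M
  sum : ∀ G : ℤ → ℤ, (∀ x, G (x + N) = -G x) →
    (M.map fun s => G s.2 - G s.1).sum = G b - G a + (G b' - G a')

/-- The list of possible decompositions. -/
def SegDecompList (N a b a' b' : ℤ) (M : Multiset (ℤ × ℤ)) : Prop :=
  (a' ≤ b ∧ b' - a < N ∧ a < a' ∧ b < b' ∧ M = segs a b' + segs a' b) ∨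
  (a' ≤ b ∧ N < b' - a ∧ M = segs (b' - N) (a + N) + segs a' b) ∨
  (N < b' - a ∧ b' - b ≤ N ∧ a' - a ≤ N ∧ M = segs (b' - N) b + segs a' (a + N))

namespace SegDecomp

variable {N a b a' b' : ℤ} {M : Multiset (ℤ × ℤ)}

/-- A single segment with the boundary of `[a, b']`. -/
theorem single_cases (h : SegDecomp N a b a' b' M) {c e : ℤ}
    (hc : a ≤ c) (hc' : c ≤ a') (he : b ≤ e) (he' : e ≤ b') (hce : c < e) (hce' : e < c + N)
    (hG : ∀ G : ℤ → ℤ, (∀ x, G (x + N) = -G x) → G e - G c = G b' - G a) :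
    (c = a ∧ e = b' ∧ b' - a < N) ∨ (c = b' - N ∧ e = a + N ∧ N < b' - a) := by
  obtain ⟨h1, h2, h3, h4, h5, h6, h7, -⟩ := h
  have hN : 0 < N := by omega
  have hw : b' < a + 2 * N := by omega
  -- The deltas at `a` and `b'` detect which ends of `[c, e]` are congruent to `a` and `b'` modulo
  -- `N`; all points in play are less than `2 * N` apart, so only shifts by `±N` can occur.
  have ka := hG _ (comb_add hN a)
  have kb := hG _ (comb_add hN b')
  rw [comb_self] at ka kb
  have q1 := comb_cases (N := N) (x := a) (m := c) (by omega) (by omega)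
  have q2 := comb_cases (N := N) (x := a) (m := e) (by omega) (by omega)
  have q3 := comb_cases (N := N) (x := a) (m := b') (by omega) (by omega)
  have q4 := comb_cases (N := N) (x := b') (m := c) (by omega) (by omega)
  have q5 := comb_cases (N := N) (x := b') (m := e) (by omega) (by omega)
  have q6 := comb_cases (N := N) (x := b') (m := a) (by omega) (by omega)
  omega

/-- Two segments `[c, b]` and `[a', e]`. -/
theorem two_cases (h : SegDecomp N a b a' b' M) {c e : ℤ}
    (hM : M = {(c, b), (a', e)}) : N < b' - a ∧ c = b' - N ∧ e = a + N := by
  have hG : ∀ G : ℤ → ℤ, (∀ x, G (x + N) = -G x) → G e - G c = G b' - G a := by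
    intro G hG
    have := h.sum G hG
    simp only [hM, Multiset.insert_eq_cons, Multiset.map_cons, Multiset.map_singleton,
      Multiset.sum_cons, Multiset.sum_singleton] at this
    omega
  have m1 := h.mem c b (by simp [hM])
  have m2 := h.mem a' e (by simp [hM])
  have n1 : c ≠ a := by
    rintro rfl; exact h.ne (by simp [hM])
  have n2 : e ≠ b' := by
    rintro rfl; exact h.ne' (by simp [hM])
  obtain ⟨h1, h2, h3, h4, h5, h6, h7, -⟩ := h
  have hN : 0 < N := by omega
  have hw : b' < a + 2 * N := by omega
  have ka := hG _ (comb_add hN a)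
  have kb := hG _ (comb_add hN b')
  rw [comb_self] at ka kb
  have q1 := comb_cases (N := N) (x := a) (m := c) (by omega) (by omega)
  have q2 := comb_cases (N := N) (x := a) (m := e) (by omega) (by omega)
  have q3 := comb_cases (N := N) (x := a) (m := b') (by omega) (by omega)
  have q4 := comb_cases (N := N) (x := b') (m := c) (by omega) (by omega)
  have q5 := comb_cases (N := N) (x := b') (m := e) (by omega) (by omega)
  have q6 := comb_cases (N := N) (x := b') (m := a) (by omega) (by omega)
  omega

/-! ### Counting segments with antiperiodic test functions. -/

theorem sum_map_const_eq_card {α : Type*} (s : Multiset α) (g : α → ℤ) (k : ℤ)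
    (h : ∀ x ∈ s, g x = k) : (s.map g).sum = k * s.card := by
  rw [Multiset.map_congr rfl h]
  simp [mul_comm]

/-- A test function whose jump is `k` over the segments of one kind and `0` over all others turns
the boundary identity into a count of that kind. -/
theorem card_filter_of_sum {s : Multiset (ℤ × ℤ)} {g : ℤ × ℤ → ℤ} {p : ℤ × ℤ → Prop}
    [DecidablePred p] {k : ℤ} (h : ∀ x ∈ s, p x → g x = k) (h' : ∀ x ∈ s, ¬ p x → g x = 0) :
    (s.map g).sum = k * (s.filter p).card := by
  conv_lhs => rw [← Multiset.filter_add_not p s]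
  rw [Multiset.map_add, Multiset.sum_add,
    sum_map_const_eq_card _ g k fun x hx => h x (Multiset.mem_filter.1 hx).1
      (Multiset.mem_filter.1 hx).2,
    sum_map_const_eq_card _ g 0 fun x hx => h' x (Multiset.mem_filter.1 hx).1
      (Multiset.mem_filter.1 hx).2]
  simp

/-- Every member contains `[a', b]`, so the step at `b` jumps by 2 over each, and there are exactly
two. The deltas at `b` and `a'` show that some member ends at `b` and some member starts at `a'`. If
one member does both, the other has the boundary of `[a, b']`; otherwise the family is crossed. -/
theorem list_of_overlap (h : SegDecomp N a b a' b' M) (hlt : a' < b) :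
    SegDecompList N a b a' b' M := by
  have hmem := h.mem
  have hN : 0 < N := by have := h.lt; have := h.lt_add; omega
  have hcard : M.card = 2 := by
    have h0 := h.sum _ (sqWave_add hN b)
    rw [sum_map_const_eq_card M _ 2] at h0
    · obtain ⟨h1, h2, h3, h4, h5, h6, h7, -⟩ := h
      rw [sqWave_of_mem (m := b) (by omega) (by omega),
        sqWave_of_mem (m := b') (by omega) (by omega), sqWave_of_lt (m := a) (by omega) (by omega),
        sqWave_of_lt (m := a') (by omega) (by omega)] at h0
      omega
    · rintro ⟨c, e⟩ hs
      have := hmem c e hs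
      obtain ⟨h1, h2, h3, h4, h5, h6, h7, -⟩ := h
      dsimp only
      rw [sqWave_of_mem (m := e) (by omega) (by omega), sqWave_of_lt (m := c) (by omega) (by omega)]
      rfl
  obtain ⟨s₁, s₂, hM⟩ := Multiset.card_eq_two.1 hcard
  -- one of the segments ends at `b`
  wlog h₁ : s₁.2 = b generalizing s₁ s₂
  · refine this s₂ s₁ (hM.trans (Multiset.pair_comm _ _)) ?_
    have h0 := h.sum _ (comb_add hN b)
    simp only [hM, Multiset.insert_eq_cons, Multiset.map_cons, Multiset.map_singleton,
      Multiset.sum_cons, Multiset.sum_singleton] at h0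
    have m1 := hmem s₁.1 s₁.2 (by simp [hM])
    have m2 := hmem s₂.1 s₂.2 (by simp [hM])
    obtain ⟨h1, h2, h3, h4, h5, h6, h7, -⟩ := h
    by_contra h₂
    rw [comb_self, comb_of_near (m := s₁.2) (by omega) (by omega) h₁,
      comb_of_near (m := s₂.2) (by omega) (by omega) h₂,
      comb_of_near (m := s₁.1) (by omega) (by omega) (by omega),
      comb_of_near (m := s₂.1) (by omega) (by omega) (by omega),
      comb_of_near (m := a) (by omega) (by omega) (by omega),
      comb_of_near (m := a') (by omega) (by omega) (by omega)] at h0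
    have := comb_cases (N := N) (x := b) (m := b') (by omega) (by omega)
    omega
  obtain ⟨c₁, e₁⟩ := s₁
  obtain ⟨c₂, e₂⟩ := s₂
  obtain rfl : e₁ = b := h₁
  have m1 := hmem c₁ e₁ (by simp [hM])
  have m2 := hmem c₂ e₂ (by simp [hM])
  have hsum := h.sum
  simp only [hM, Multiset.insert_eq_cons, Multiset.map_cons, Multiset.map_singleton,
    Multiset.sum_cons, Multiset.sum_singleton] at hsum
  by_cases h₂ : c₂ = a'
  · subst h₂
    obtain ⟨k1, k2, k3⟩ := h.two_cases hM
    obtain ⟨h1, h2, h3, h4, h5, h6, h7, -⟩ := h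
    refine .inr (.inr ⟨k1, by omega, by omega, ?_⟩)
    rw [segs_of_lt (by omega), segs_of_lt (by omega), hM, k2, k3]
    rfl
  have h₁ : c₁ = a' := by
    by_contra h₁
    have h0 := hsum _ (comb_add hN a')
    obtain ⟨h1, h2, h3, h4, h5, h6, h7, -⟩ := h
    rw [comb_self, comb_of_near (m := c₁) (by omega) (by omega) h₁,
      comb_of_near (m := c₂) (by omega) (by omega) h₂,
      comb_of_near (m := e₁) (by omega) (by omega) (by omega),
      comb_of_near (m := e₂) (by omega) (by omega) (by omega),
      comb_of_near (m := b') (by omega) (by omega) (by omega)] at h0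
    have := comb_cases (N := N) (x := a') (m := a) (by omega) (by omega)
    omega
  subst h₁
  have key := h.single_cases m2.1 m2.2.1 m2.2.2.1 m2.2.2.2.1 m2.2.2.2.2.1 m2.2.2.2.2.2
    fun G hG => by have := hsum G hG; omega
  rcases key with ⟨rfl, rfl, hlt'⟩ | ⟨rfl, rfl, hlt'⟩
  · have n1 : e₁ ≠ e₂ := by rintro rfl; exact h.ne (by simp [hM])
    have := h.le_left
    refine .inl ⟨hlt.le, hlt', by omega, by omega, ?_⟩
    rw [segs_of_lt (by omega), segs_of_lt hlt, hM, Multiset.pair_comm]; rfl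
  · refine .inr (.inl ⟨hlt.le, hlt', ?_⟩)
    rw [segs_of_lt (by omega), segs_of_lt hlt, hM, Multiset.pair_comm]; rfl

/-- Now `[a', b]` is degenerate. Exactly one member starts left of `a'` and exactly one ends right
of it; the cases are whether these are the same member. -/
theorem list_of_touch (h : SegDecomp N a b a' b' M) (heq : a' = b) :
    SegDecompList N a b a' b' M := by
  subst heq
  have hmem := h.mem
  have hN : 0 < N := by have := h.lt; have := h.lt_add; omega
  have card₁ : (M.filter fun s => s.1 < a').card = 1 := by
    have h0 := h.sum _ (sqWave_add hN a')
    obtain ⟨h1, h2, h3, h4, h5, h6, h7, -⟩ := h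
    rw [card_filter_of_sum (p := fun s => s.1 < a') (k := 2)] at h0
    · rw [sqWave_of_mem (m := a') (by omega) (by omega),
        sqWave_of_mem (m := b') (by omega) (by omega),
        sqWave_of_lt (m := a) (by omega) (by omega)] at h0
      omega
    · rintro ⟨c, e⟩ hs hlt
      have := hmem c e hs
      dsimp only at hlt ⊢
      rw [sqWave_of_mem (m := e) (by omega) (by omega), sqWave_of_lt (m := c) (by omega) (by omega)]
      rfl
    · rintro ⟨c, e⟩ hs hlt
      have := hmem c e hs
      dsimp only at hlt ⊢
      rw [sqWave_of_mem (m := e) (by omega) (by omega),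
        sqWave_of_mem (m := c) (by omega) (by omega)]
      rfl
  have card₂ : (M.filter fun s => a' < s.2).card = 1 := by
    -- The step is closed on the left, so placing it at `a' + 1` counts the ends beyond `a'` instead
    -- of the starts before `a'`.
    have h0 := h.sum _ (sqWave_add hN (a' + 1))
    obtain ⟨h1, h2, h3, h4, h5, h6, h7, -⟩ := h
    rw [card_filter_of_sum (p := fun s => a' < s.2) (k := 2)] at h0
    · rw [sqWave_of_lt (m := a') (by omega) (by omega),
        sqWave_of_mem (m := b') (by omega) (by omega),
        sqWave_of_lt (m := a) (by omega) (by omega)] at h0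
      omega
    · rintro ⟨c, e⟩ hs hlt
      have := hmem c e hs
      dsimp only at hlt ⊢
      rw [sqWave_of_mem (m := e) (by omega) (by omega), sqWave_of_lt (m := c) (by omega) (by omega)]
      rfl
    · rintro ⟨c, e⟩ hs hlt
      have := hmem c e hs
      dsimp only at hlt ⊢
      rw [sqWave_of_lt (m := e) (by omega) (by omega),
        sqWave_of_lt (m := c) (by omega) (by omega)]
      rfl
  obtain ⟨⟨c₁, e₁⟩, hF⟩ := Multiset.card_eq_one.1 card₁
  have hs₁ : (c₁, e₁) ∈ M.filter fun s => s.1 < a' := by simp [hF]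
  have m1 := hmem c₁ e₁ (Multiset.mem_of_mem_filter hs₁)
  have l1 : c₁ < a' := (Multiset.mem_filter.1 hs₁).2
  have hM := Multiset.filter_add_not (fun s => s.1 < a') M
  rw [hF] at hM
  have hF' : ∀ s ∈ M.filter (fun s => ¬ s.1 < a'), s.1 = a' ∧ a' < s.2 := by
    rintro ⟨c, e⟩ hs
    have := hmem c e (Multiset.mem_of_mem_filter hs)
    have : ¬ c < a' := (Multiset.mem_filter.1 hs).2
    constructor <;> dsimp only <;> omega
  generalize M.filter (fun s => ¬ s.1 < a') = F at hM hF'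
  rw [← hM, Multiset.filter_add, Multiset.card_add,
    Multiset.filter_eq_self.2 fun s hs => (hF' s hs).2] at card₂
  by_cases h₁ : a' < e₁
  · have : F = 0 := by
      rw [← Multiset.card_eq_zero]
      simp [Multiset.filter_singleton, h₁] at card₂
      simp [card₂]
    subst this
    rw [add_zero] at hM
    have key := h.single_cases m1.1 m1.2.1 m1.2.2.1 m1.2.2.2.1 m1.2.2.2.2.1 m1.2.2.2.2.2
      fun G hG => by
        have := h.sum G hG
        simp only [← hM, Multiset.map_singleton, Multiset.sum_singleton] at this
        omega
    have := h.lt'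
    rcases key with ⟨rfl, rfl, hlt'⟩ | ⟨rfl, rfl, hlt'⟩
    · refine .inl ⟨le_rfl, hlt', l1, h₁, ?_⟩
      rw [segs_of_lt (by omega), segs_self, ← hM, add_zero]
    · refine .inr (.inl ⟨le_rfl, hlt', ?_⟩)
      rw [segs_of_lt (by omega), segs_self, ← hM, add_zero]
  · obtain rfl : e₁ = a' := by omega
    simp only [Multiset.filter_singleton, h₁, if_false, Multiset.card_zero,
      Multiset.empty_eq_zero, zero_add] at card₂
    obtain ⟨⟨c₂, e₂⟩, rfl⟩ := Multiset.card_eq_one.1 card₂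
    obtain ⟨rfl, -⟩ : c₂ = e₁ ∧ e₁ < e₂ := hF' (c₂, e₂) (by simp)
    obtain ⟨k1, rfl, rfl⟩ := h.two_cases (c := c₁) (e := e₂) hM.symm
    obtain ⟨h1, h2, h3, h4, h5, h6, h7, -⟩ := h
    refine .inr (.inr ⟨k1, by omega, by omega, ?_⟩)
    rw [segs_of_lt (by omega), segs_of_lt (by omega), ← hM]

/-- The step at `x` is `-1` at `a`, `b` and `1` at `a'`, `b'`, so the total jump is zero. Each
member jumps by 0 or 2, hence none crosses `x`. -/
theorem split_of_gap (h : SegDecomp N a b a' b' M) {x : ℤ} (h₁ : b < x) (h₂ : x ≤ a')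
    (h₃ : b' - N < x) (h₄ : x ≤ a + N) : ∀ c e, (c, e) ∈ M → e < x ∨ x ≤ c := by
  have hmem := h.mem
  have hN : 0 < N := by have := h.lt; have := h.lt_add; omega
  have h0 := h.sum _ (sqWave_add hN x)
  obtain ⟨h1, -, h3, -, h5, h6, -⟩ := h
  rw [card_filter_of_sum (p := fun s => s.1 < x ∧ x ≤ s.2) (k := 2)] at h0
  · rw [sqWave_of_lt (m := a) (by omega) (by omega), sqWave_of_lt (m := b) (by omega) (by omega),
      sqWave_of_mem (m := a') (by omega) (by omega),
      sqWave_of_mem (m := b') (by omega) (by omega)] at h0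
    have h0' : (M.filter fun s => s.1 < x ∧ x ≤ s.2) = 0 := by
      rw [← Multiset.card_eq_zero]; omega
    intro c e hs
    have := Multiset.filter_eq_nil.1 h0' _ hs
    dsimp only at this
    omega
  · rintro ⟨c, e⟩ hs ⟨hlt, hlt'⟩
    have := hmem c e hs
    dsimp only at hlt hlt' ⊢
    rw [sqWave_of_mem (m := e) (by omega) (by omega), sqWave_of_lt (m := c) (by omega) (by omega)]
    rfl
  · rintro ⟨c, e⟩ hs hlt
    have := hmem c e hs
    dsimp only at hlt ⊢
    rcases lt_or_ge e x with h' | h'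
    · rw [sqWave_of_lt (m := e) (by omega) (by omega),
        sqWave_of_lt (m := c) (by omega) (by omega)]
      rfl
    · rw [sqWave_of_mem (m := e) (by omega) (by omega),
        sqWave_of_mem (m := c) (by omega) (by omega)]
      rfl

/-- If `[a, b]` and `[a', b']` are disjoint and `a' < a + N`, exactly one segment starts at
`a'`, provided that all other segments end before `a'`. -/
theorem card_right (h : SegDecomp N a b a' b' M) (hlt : b < a') (hN' : a' < a + N)
    (hsplit : ∀ c e, (c, e) ∈ M → c ≠ a' → e < a') :
    (M.filter fun s => s.1 = a').card = 1 := by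
  have hmem := h.mem
  have hN : 0 < N := by have := h.lt; have := h.lt_add; omega
  have h0 := h.sum _ (comb_add hN a')
  obtain ⟨h1, h2, h3, h4, h5, h6, -⟩ := h
  rw [card_filter_of_sum (p := fun s => s.1 = a') (k := -1), comb_self,
    comb_of_near (m := a) (by omega) (by omega) (by omega),
    comb_of_near (m := b) (by omega) (by omega) (by omega),
    comb_of_near (m := b') (by omega) (by omega) (by omega)] at h0
  · omega
  · rintro ⟨c, e⟩ hs rfl
    have := hmem c e hs
    dsimp only
    rw [comb_self, comb_of_near (m := e) (by omega) (by omega) (by omega)]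
    rfl
  · rintro ⟨c, e⟩ hs hne
    have := hmem c e hs
    have := hsplit c e hs hne
    dsimp only at hne ⊢
    rw [comb_of_near (m := c) (by omega) (by omega) (by omega),
      comb_of_near (m := e) (by omega) (by omega) (by omega)]
    rfl

theorem card_left (h : SegDecomp N a b a' b' M) (hlt : b < a') (hN' : b' < b + N)
    (hsplit : ∀ c e, (c, e) ∈ M → e ≠ b → b < c) :
    (M.filter fun s => s.2 = b).card = 1 := by
  have hmem := h.mem
  have hN : 0 < N := by have := h.lt; have := h.lt_add; omega
  have h0 := h.sum _ (comb_add hN b)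
  obtain ⟨h1, h2, h3, h4, h5, h6, -⟩ := h
  rw [card_filter_of_sum (p := fun s => s.2 = b) (k := 1), comb_self,
    comb_of_near (m := a) (by omega) (by omega) (by omega),
    comb_of_near (m := a') (by omega) (by omega) (by omega),
    comb_of_near (m := b') (by omega) (by omega) (by omega)] at h0
  · omega
  · rintro ⟨c, e⟩ hs rfl
    have := hmem c e hs
    dsimp only
    rw [comb_self, comb_of_near (m := c) (by omega) (by omega) (by omega)]
    rfl
  · rintro ⟨c, e⟩ hs hne
    have := hmem c e hs
    have := hsplit c e hs hne
    dsimp only at hne ⊢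
    rw [comb_of_near (m := c) (by omega) (by omega) (by omega),
      comb_of_near (m := e) (by omega) (by omega) (by omega)]
    rfl

/-- If `b' - b > N`, the step at `b' - N` has total jump `-2`. But no member jumps downwards: one
that starts at `a'` ends before `b'`, since `[a', b']` itself is excluded, and any other ends before
`a'` and cannot lie inside the gap. -/
theorem le_of_disjoint (h : SegDecomp N a b a' b' M) (hlt : b < a') : b' - b ≤ N := by
  by_contra hA
  have hmem := h.mem
  have hN : 0 < N := by have := h.lt; have := h.lt_add; omega
  have hgap := @h.split_of_gap
  have hne' := h.ne'
  have hr := h.card_right hlt (by have := h.near; omega) fun c e hs hne => by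
    have := hmem c e hs
    have := h.near
    have := h.lt'
    have := @hgap a' hlt le_rfl (by have := h.lt_add'; omega) (by omega) c e hs
    omega
  have h0 := h.sum _ (sqWave_add hN (b' - N))
  obtain ⟨h1, h2, h3, h4, h5, h6, h7, -⟩ := h
  rw [sqWave_of_lt (m := a) (by omega) (by omega), sqWave_of_lt (m := b) (by omega) (by omega),
    sqWave_of_mem (m := a') (by omega) (by omega),
    sqWave_of_ge (m := b') (by omega) (by omega)] at h0
  have : 0 ≤ (M.map fun s => sqWave N (b' - N) s.2 - sqWave N (b' - N) s.1).sum := by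
    refine Multiset.sum_nonneg fun y hy => ?_
    obtain ⟨⟨c, e⟩, hs, rfl⟩ := Multiset.mem_map.1 hy
    have := hmem c e hs
    have hx := @hgap a' hlt le_rfl (by omega) (by omega) c e hs
    dsimp only
    by_cases hc : c = a'
    · subst hc
      have : e ≠ b' := by rintro rfl; exact hne' hs
      rw [sqWave_of_mem (m := e) (by omega) (by omega),
        sqWave_of_mem (m := c) (by omega) (by omega)]
      simp
    · rcases lt_or_ge c (b' - N) with hl | hl
      · rw [sqWave_of_lt (m := c) (by omega) (by omega)]
        unfold sqWave; split_ifs <;> simp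
      · have := @hgap e (by omega) (by omega) (by omega) (by omega) c e hs
        omega
  omega

/-- The mirror image of `le_of_disjoint`. Reflection exchanges the closed and the open end of the
step, whence `a + N + 1` in place of `a + N`. -/
theorem le_of_disjoint' (h : SegDecomp N a b a' b' M) (hlt : b < a') : a' - a ≤ N := by
  by_contra hB
  have hmem := h.mem
  have hN : 0 < N := by have := h.lt; have := h.lt_add; omega
  have hgap := @h.split_of_gap
  have hne := h.ne
  have h0 := h.sum _ (sqWave_add hN (a + N + 1))
  obtain ⟨h1, h2, h3, h4, h5, h6, h7, -⟩ := h
  rw [sqWave_of_lt' (m := a) (by omega) (by omega), sqWave_of_lt (m := b) (by omega) (by omega),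
    sqWave_of_mem (m := a') (by omega) (by omega),
    sqWave_of_mem (m := b') (by omega) (by omega)] at h0
  have : 0 ≤ (M.map fun s => sqWave N (a + N + 1) s.2 - sqWave N (a + N + 1) s.1).sum := by
    refine Multiset.sum_nonneg fun y hy => ?_
    obtain ⟨⟨c, e⟩, hs, rfl⟩ := Multiset.mem_map.1 hy
    have := hmem c e hs
    have hx := @hgap (b + 1) (by omega) (by omega) (by omega) (by omega) c e hs
    dsimp only
    by_cases he : e = b
    · subst he
      have : c ≠ a := by rintro rfl; exact hne hs
      rw [sqWave_of_lt (m := e) (by omega) (by omega),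
        sqWave_of_lt (m := c) (by omega) (by omega)]
      simp
    · rcases lt_or_ge (a + N) e with hl | hl
      · rw [sqWave_of_mem (m := e) (by omega) (by omega)]
        unfold sqWave; split_ifs <;> simp
      · have := @hgap e (by omega) (by omega) (by omega) (by omega) c e hs
        omega
  omega

/-- No member crosses or lies in the gap, so each ends at `b` or starts at `a'`. Generically there
is one of each kind, which is the crossed family. If `b' = b + N`, the ends `b` and `b'` cancel and
`[b' - N, b]` degenerates; if `a' = a + N`, the same happens to `[a', a + N]`. -/
theorem list_of_disjoint (h : SegDecomp N a b a' b' M) (hlt : b < a') :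
    SegDecompList N a b a' b' M := by
  have hA := h.le_of_disjoint hlt
  have hB := h.le_of_disjoint' hlt
  have hmem := h.mem
  have hN : 0 < N := by have := h.lt; have := h.lt_add; omega
  have hlr : ∀ c e, (c, e) ∈ M → (e = b ∧ c < b) ∨ (c = a' ∧ a' < e) := by
    intro c e hs
    have := hmem c e hs
    have := h.lt_add
    have := h.lt_add'
    have := h.split_of_gap (x := b + 1) (by omega) (by omega) (by omega) (by omega) c e hs
    have := h.split_of_gap (x := a') (by omega) (by omega) (by omega) (by omega) c e hs
    rcases le_or_gt e a' with he | he
    · by_cases heb : e = b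
      · omega
      · have := h.split_of_gap (x := e) (by omega) (by omega) (by omega) (by omega) c e hs
        omega
    · omega
  have hM := Multiset.filter_add_not (fun s => s.2 = b) M
  have hfil : M.filter (fun s => ¬ s.2 = b) = M.filter fun s => s.1 = a' := by
    refine Multiset.filter_congr fun s hs => ?_
    have := hlr s.1 s.2 hs
    omega
  rw [hfil] at hM
  have hL : b' < b + N → ∃ c, M.filter (fun s => s.2 = b) = {(c, b)} := by
    intro hA'
    obtain ⟨⟨c, e⟩, hce⟩ := Multiset.card_eq_one.1 (h.card_left hlt hA' fun c e hs hne => by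
      have := hlr c e hs; omega)
    have : e = b := (Multiset.mem_filter.1 (hce ▸ Multiset.mem_singleton_self (c, e) :
      (c, e) ∈ M.filter fun s => s.2 = b)).2
    exact ⟨c, this ▸ hce⟩
  have hR : a' < a + N → ∃ e, M.filter (fun s => s.1 = a') = {(a', e)} := by
    intro hB'
    obtain ⟨⟨c, e⟩, hce⟩ := Multiset.card_eq_one.1 (h.card_right hlt hB' fun c e hs hne => by
      have := hlr c e hs; omega)
    have : c = a' := (Multiset.mem_filter.1 (hce ▸ Multiset.mem_singleton_self (c, e) :
      (c, e) ∈ M.filter fun s => s.1 = a')).2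
    exact ⟨e, this ▸ hce⟩
  rcases hA.lt_or_eq with hA' | hA' <;> rcases hB.lt_or_eq with hB' | hB'
  · obtain ⟨c, hc⟩ := hL (by omega)
    obtain ⟨e, he⟩ := hR (by omega)
    rw [hc, he] at hM
    obtain ⟨k1, rfl, rfl⟩ := h.two_cases hM.symm
    refine .inr (.inr ⟨k1, hA, hB, ?_⟩)
    rw [segs_of_lt (by omega), segs_of_lt (by omega), ← hM]
  · obtain ⟨c, hc⟩ := hL (by omega)
    have hca : c ≠ a := by
      rintro rfl
      exact h.ne (Multiset.mem_of_mem_filter (p := fun s => s.2 = b) (by simp [hc]))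
    have hr : M.filter (fun s => s.1 = a') = 0 := by
      have h0 := h.sum _ (comb_add hN a)
      rw [← hM, hc, Multiset.map_add, Multiset.sum_add, Multiset.map_singleton,
        Multiset.sum_singleton, sum_map_const_eq_card (M.filter fun s => s.1 = a') _ 1] at h0
      · have mc := hmem c b (Multiset.mem_of_mem_filter (p := fun s => s.2 = b) (by simp [hc]))
        obtain ⟨h1, h2, h3, h4, h5, h6, h7, -⟩ := h
        rw [comb_self, comb_of_near (m := b) (by omega) (by omega) (by omega),
          comb_of_near (m := c) (by omega) (by omega) (by omega),
          show a' = a + N by omega, comb_add_self hN,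
          comb_eq_zero (m := b') (by omega) (by omega) (by omega) (by omega) (by omega)] at h0
        rw [← Multiset.card_eq_zero, show a' = a + N by omega]
        omega
      · rintro ⟨c', e'⟩ hs
        have := hmem c' e' (Multiset.mem_of_mem_filter hs)
        obtain rfl : c' = a' := (Multiset.mem_filter.1 hs).2
        obtain ⟨h1, h2, h3, h4, h5, h6, h7, -⟩ := h
        dsimp only
        rw [show c' = a + N by omega, comb_add_self hN,
          comb_eq_zero (m := e') (by omega) (by omega) (by omega) (by omega) (by omega)]
        rfl
    rw [hc, hr, add_zero] at hM
    have hcA : c = b' - N := by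
      have h0 := h.sum _ (comb_add hN b')
      have mc := hmem c b (by simp [← hM])
      rw [← hM, Multiset.map_singleton, Multiset.sum_singleton] at h0
      obtain ⟨h1, h2, h3, h4, h5, h6, h7, -⟩ := h
      have e1 := comb_add hN b' a
      rw [← show a' = a + N by omega] at e1
      have q5 := comb_cases (N := N) (x := b') (m := c) (by omega) (by omega)
      rw [comb_self] at h0
      dsimp only at h0
      omega
    obtain ⟨h1, h2, h3, h4, h5, h6, h7, -⟩ := h
    refine .inr (.inr ⟨by omega, hA, hB, ?_⟩)
    rw [segs_of_lt (by omega), show a' = a + N by omega, segs_self, ← hM, hcA, add_zero]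
  · obtain ⟨e, he⟩ := hR (by omega)
    have heb : e ≠ b' := by
      rintro rfl
      exact h.ne' (Multiset.mem_of_mem_filter (p := fun s => s.1 = a') (by simp [he]))
    have hl : M.filter (fun s => s.2 = b) = 0 := by
      have h0 := h.sum _ (comb_add hN b')
      rw [← hM, he, Multiset.map_add, Multiset.sum_add, Multiset.map_singleton,
        Multiset.sum_singleton, sum_map_const_eq_card (M.filter fun s => s.2 = b) _ (-1)] at h0
      · have mc := hmem a' e (Multiset.mem_of_mem_filter (p := fun s => s.1 = a') (by simp [he]))
        obtain ⟨h1, h2, h3, h4, h5, h6, h7, -⟩ := h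
        rw [comb_self, show b = b' - N by omega, comb_sub_self hN,
          comb_of_near (m := a') (by omega) (by omega) (by omega),
          comb_of_near (m := e) (by omega) (by omega) (by omega),
          comb_eq_zero (m := a) (by omega) (by omega) (by omega) (by omega) (by omega)] at h0
        rw [← Multiset.card_eq_zero, show b = b' - N by omega]
        omega
      · rintro ⟨c', e'⟩ hs
        have := hmem c' e' (Multiset.mem_of_mem_filter hs)
        obtain rfl : e' = b := (Multiset.mem_filter.1 hs).2
        obtain ⟨h1, h2, h3, h4, h5, h6, h7, -⟩ := h
        dsimp only
        rw [show e' = b' - N by omega, comb_sub_self hN,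
          comb_eq_zero (m := c') (by omega) (by omega) (by omega) (by omega) (by omega)]
        rfl
    rw [he, hl, zero_add] at hM
    have heB : e = a + N := by
      have h0 := h.sum _ (comb_add hN a)
      have mc := hmem a' e (by simp [← hM])
      rw [← hM, Multiset.map_singleton, Multiset.sum_singleton] at h0
      obtain ⟨h1, h2, h3, h4, h5, h6, h7, -⟩ := h
      have e1 := comb_add hN a b
      rw [← show b' = b + N by omega] at e1
      have q5 := comb_cases (N := N) (x := a) (m := e) (by omega) (by omega)
      rw [comb_self] at h0
      dsimp only at h0
      omega
    obtain ⟨h1, h2, h3, h4, h5, h6, h7, -⟩ := h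
    refine .inr (.inr ⟨by omega, hA, hB, ?_⟩)
    rw [segs_of_lt (c := a') (by omega), show b' - N = b by omega, segs_self, ← hM, heB, zero_add]
  -- With both equalities the two boundaries would cancel completely; two segments of one window
  -- cannot be in this position.
  · have := h.near
    omega

theorem list (h : SegDecomp N a b a' b' M) : SegDecompList N a b a' b' M := by
  rcases lt_trichotomy a' b with h' | h' | h'
  exacts [h.list_of_overlap h', h.list_of_touch h', h.list_of_disjoint h']

end SegDecomp
/-! ### Generalized distance from segment coordinates -/

section Seq

variable {n : ℕ} {w : List (Fin (n + 1))}

theorem CommEquiv.refl (w : List (Fin (n + 1))) : CommEquiv w w := Relation.EqvGen.refl w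

theorem pairSeq_comm (α β : PosRoot n) : pairSeq α β = pairSeq β α := add_comm _ _

theorem pairSeq_apply (α β γ : PosRoot n) [DecidableEq (PosRoot n)] :
    pairSeq α β γ = (if α = γ then 1 else 0) + if β = γ then 1 else 0 := by
  simp [pairSeq, Finsupp.single_apply]

theorem weight_add (m m' : RootSeq n) : weight (m + m') = weight m + weight m' :=
  Finsupp.sum_add_index' (fun _ => zero_smul _ _) fun _ _ _ => add_smul _ _ _

theorem weight_single (γ : PosRoot n) : weight (Finsupp.single γ 1) = γ.1 := by
  simp [weight]

theorem weight_zero : weight (0 : RootSeq n) = 0 := rfl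

theorem weight_pairSeq (α β : PosRoot n) : weight (pairSeq α β) = α.1 + β.1 := by
  rw [pairSeq, weight_add, weight_single, weight_single]

/-- Evaluating additive functionals root by root is how an equality of weights becomes the boundary
identity of `SegDecomp`. -/
theorem sum_map_toMultiset (L : Lat n →+ ℤ) (m : RootSeq n) :
    ((Finsupp.toMultiset m).map fun γ => L γ.1).sum = L (weight m) := by
  induction m using Finsupp.induction_linear with
  | zero => simp [weight_zero]
  | add m m' h h' => simp [weight_add, h, h']
  | single γ k =>
    have hw : weight (Finsupp.single γ k) = k • γ.1 := Finsupp.sum_single_index (zero_smul _ _)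
    rw [hw, Finsupp.toMultiset_single,
      Multiset.map_nsmul, Multiset.sum_nsmul, Multiset.map_singleton, Multiset.sum_singleton,
      map_nsmul]

theorem SeqPrec.irrefl (m : RootSeq n) : ¬ SeqPrec w m m := fun h => by
  obtain ⟨⟨β, hβ, -⟩, -⟩ := h.2 w (.refl w)
  exact lt_irrefl _ hβ

/-- The second hypothesis is vacuous when the support has at most one root, so sequences with a
degenerate segment are covered too. -/
theorem simpleSeq_of_forall_not {m : RootSeq n} (h : ∀ m', ¬ SeqPrec w m' m)
    (hm : ∀ α β, α ≠ β → 0 < m α → 0 < m β → m = pairSeq α β) : SimpleSeq w m :=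
  .inr fun α β hne hα hβ ⟨m', hm'⟩ => h m' (hm α β hne hα hβ ▸ hm')

theorem pairSeq_eq_of_pos {α β γ δ : PosRoot n} (hne : γ ≠ δ) (hγ : 0 < pairSeq α β γ)
    (hδ : 0 < pairSeq α β δ) : pairSeq α β = pairSeq γ δ := by
  classical
  rw [pairSeq_apply] at hγ hδ
  split_ifs at hγ hδ <;> simp_all [pairSeq_comm]

theorem not_simpleSeq_pairSeq {α β : PosRoot n} (hne : α ≠ β) {m : RootSeq n}
    (h : SeqPrec w m (pairSeq α β)) : ¬ SimpleSeq w (pairSeq α β) := by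
  classical
  rintro (h' | h')
  · rw [pairSeq, Finsupp.sum_add_index' (fun _ => rfl) fun _ _ _ => rfl] at h'
    simp at h'
  · exact h' α β hne (by simp [pairSeq_apply]) (by simp [pairSeq_apply]) ⟨m, h⟩

theorem gdistSeq_eq_zero {m : RootSeq n} (h : SimpleSeq w m) : gdistSeq w m = 0 := if_pos h

theorem isDistChain_concat {m : RootSeq n} {l : List (RootSeq n)} (h : IsDistChain w m l) :
    ∃ l', l = l' ++ [m] := by
  obtain ⟨-, h, -⟩ := h
  exact ⟨_, (List.dropLast_append_getLast? m (by simp [h])).symm⟩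

theorem gdistSeq_eq_one {m : RootSeq n} (hm : ¬ SimpleSeq w m)
    (h : ∀ m', SeqPrec w m' m → SimpleSeq w m') : gdistSeq w m = 1 := by
  rw [gdistSeq, if_neg hm]
  apply le_antisymm
  · refine iSup₂_le fun l hl => ?_
    obtain ⟨l', rfl⟩ := isDistChain_concat hl
    rcases List.eq_nil_or_concat l' with rfl | ⟨l'', x, rfl⟩
    · simp
    · refine absurd (h x ?_) (hl.2.2 x (by simp))
      have := hl.1
      simp only [List.append_assoc, List.concat_eq_append] at this
      have := (List.isChain_append.1 this).2.1
      simpa using this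
  · refine le_iSup₂_of_le [m] ⟨by simp, by simp, by simpa using hm⟩ (by simp)

/-- By transitivity, every non-simple member of a chain before the last equals `m₀`; irreflexivity
then allows only one of them. -/
theorem gdistSeq_eq_two {m m₀ : RootSeq n} (hm : ¬ SimpleSeq w m)
    (htrans : ∀ m₁ m₂ m₃, SeqPrec w m₁ m₂ → SeqPrec w m₂ m₃ → SeqPrec w m₁ m₃)
    (h₀ : SeqPrec w m₀ m) (hm₀ : ¬ SimpleSeq w m₀)
    (h : ∀ m', SeqPrec w m' m → ¬ SimpleSeq w m' → m' = m₀) : gdistSeq w m = 2 := by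
  rw [gdistSeq, if_neg hm]
  apply le_antisymm
  · refine iSup₂_le fun l hl => ?_
    obtain ⟨l', rfl⟩ := isDistChain_concat hl
    rcases List.eq_nil_or_concat l' with rfl | ⟨l'', x, rfl⟩
    · simp
    rcases List.eq_nil_or_concat l'' with rfl | ⟨l₃, y, rfl⟩
    · norm_num
    · exfalso
      have := hl.1
      simp only [List.append_assoc, List.concat_eq_append] at this
      have hc := (List.isChain_append.1 this).2.1
      simp only [List.cons_append, List.nil_append, List.isChain_cons_cons] at hc
      have hx := h x hc.2.1 (hl.2.2 x (by simp))
      have hy := h y (htrans _ _ _ hc.1 hc.2.1) (hl.2.2 y (by simp))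
      exact SeqPrec.irrefl _ (hx ▸ hy ▸ hc.1)
  · refine le_iSup₂_of_le [m₀, m] ⟨by simpa using h₀, by simp, by simpa using ⟨hm₀, hm⟩⟩
      (by norm_num)

end Seq

/-- Coordinates on `Φ⁺` by segments `[lo γ, hi γ]`, for which the convex partial order `≺_[w]` is
the product order. -/
structure SegModel {n : ℕ} (w : List (Fin (n + 1))) (N : ℤ) (f : ℤ → Lat n)
    (lo hi : PosRoot n → ℤ) : Prop where
  anti : ∀ x, f (x + N) = -f x
  dual : ∀ G : ℤ → ℤ, (∀ x, G (x + N) = -G x) → ∃ L : Lat n →+ ℤ, ∀ x, L (f x) = G x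
  root : ∀ γ, γ.1 = f (hi γ) - f (lo γ)
  lt : ∀ γ, lo γ < hi γ
  lt_add : ∀ γ, hi γ < lo γ + N
  exists_root : ∀ α β c e, lo α ≤ c → c ≤ lo β → hi α ≤ e → e ≤ hi β → c < e → e < c + N →
    ∃ γ, lo γ = c ∧ hi γ = e
  near : ∀ α β, lo β - lo α < N ∨ hi β - hi α < N
  irrefl : ∀ w', CommEquiv w w' → ∀ α, ¬ RootLT w' α α
  trans : ∀ w', CommEquiv w w' → ∀ α β γ, RootLT w' α β → RootLT w' β γ → RootLT w' α γ
  total : ∀ w', CommEquiv w w' → ∀ α β, α ≠ β → RootLT w' α β ∨ RootLT w' β α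
  prec : ∀ α β, α ≠ β → lo α ≤ lo β → hi α ≤ hi β → RootPrec w α β
  sep : ∀ α β, ¬ (lo α ≤ lo β ∧ hi α ≤ hi β) → ∃ w', CommEquiv w w' ∧ RootLT w' β α

open Classical in
/-- The root with segment `[c, e]` as a sequence, and `0` if there is no such root. -/
noncomputable def segSeq {n : ℕ} (lo hi : PosRoot n → ℤ) (c e : ℤ) : RootSeq n :=
  if h : ∃ γ, lo γ = c ∧ hi γ = e then Finsupp.single h.choose 1 else 0

namespace SegModel

variable {n : ℕ} {w : List (Fin (n + 1))} {N : ℤ} {f : ℤ → Lat n} {lo hi : PosRoot n → ℤ}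

theorem ext (S : SegModel w N f lo hi) {γ δ : PosRoot n} (h₁ : lo γ = lo δ) (h₂ : hi γ = hi δ) :
    γ = δ :=
  Subtype.ext (by rw [S.root, S.root, h₁, h₂])

/-- If the product order fails, `sep` provides a word of the class that reads the two roots in the
opposite order. -/
theorem rootPrec_iff (S : SegModel w N f lo hi) {α β : PosRoot n} :
    RootPrec w α β ↔ α ≠ β ∧ lo α ≤ lo β ∧ hi α ≤ hi β := by
  refine ⟨fun h => ⟨?_, ?_⟩, fun h => S.prec α β h.1 h.2.1 h.2.2⟩
  · rintro rfl
    exact S.irrefl w (.refl w) α (h w (.refl w))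
  · by_contra hn
    obtain ⟨w', hw', h'⟩ := S.sep α β hn
    exact S.irrefl w' hw' α (S.trans w' hw' _ _ _ (h w' hw') h')

/-- The earlier of the two first differences is the first difference of the composite, and the later
of the two last ones is its last. -/
theorem biLexLT_trans (S : SegModel w N f lo hi) {w' : List (Fin (n + 1))} (hw' : CommEquiv w w')
    {m₁ m₂ m₃ : RootSeq n} (h₁ : BiLexLT w' m₁ m₂) (h₂ : BiLexLT w' m₂ m₃) :
    BiLexLT w' m₁ m₃ := by
  obtain ⟨⟨β, hβ, hβ'⟩, γ, hγ, hγ'⟩ := h₁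
  obtain ⟨⟨δ, hδ, hδ'⟩, ε, hε, hε'⟩ := h₂
  have tr := S.trans w' hw'
  constructor
  · by_cases hne : β = δ
    · subst hne
      exact ⟨β, hβ.trans hδ, fun x hx => (hβ' x hx).trans (hδ' x hx)⟩
    rcases S.total w' hw' β δ hne with h | h
    · exact ⟨β, hδ' β h ▸ hβ, fun x hx => (hβ' x hx).trans (hδ' x (tr _ _ _ hx h))⟩
    · exact ⟨δ, hβ' δ h ▸ hδ, fun x hx => (hβ' x (tr _ _ _ hx h)).trans (hδ' x hx)⟩
  · by_cases hne : γ = ε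
    · subst hne
      exact ⟨γ, hγ.trans hε, fun x hx => (hγ' x hx).trans (hε' x hx)⟩
    rcases S.total w' hw' γ ε hne with h | h
    · exact ⟨ε, hγ' ε h ▸ hε, fun x hx => (hγ' x (tr _ _ _ h hx)).trans (hε' x hx)⟩
    · exact ⟨γ, hε' γ h ▸ hγ, fun x hx => (hγ' x hx).trans (hε' x (tr _ _ _ h hx))⟩

theorem seqPrec_trans (S : SegModel w N f lo hi) (m₁ m₂ m₃ : RootSeq n)
    (h₁ : SeqPrec w m₁ m₂) (h₂ : SeqPrec w m₂ m₃) : SeqPrec w m₁ m₃ :=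
  ⟨h₁.1.trans h₂.1, fun w' hw' => S.biLexLT_trans hw' (h₁.2 w' hw') (h₂.2 w' hw')⟩

theorem val_ne_zero (S : SegModel w N f lo hi) (γ : PosRoot n) : γ.1 ≠ 0 := by
  intro h
  have h₁ := S.lt γ
  have h₂ := S.lt_add γ
  obtain ⟨L, hL⟩ := S.dual _ (comb_add (N := N) (by omega) (lo γ))
  have := congrArg L ((S.root γ).symm.trans h)
  rw [map_sub, hL, hL, map_zero, comb_self, comb_of_near (by omega) (by omega) (by omega)] at this
  omega

/-- A sequence that is smaller than a pair with respect to one order is supported strictly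
between the two roots. -/
theorem between_of_biLexLT (S : SegModel w N f lo hi) {α β : PosRoot n}
    {m : RootSeq n} (hwt : weight m = weight (pairSeq α β)) {w' : List (Fin (n + 1))}
    (hw' : CommEquiv w w') (hαβ : RootLT w' α β) (hm : BiLexLT w' m (pairSeq α β))
    {γ : PosRoot n} (hγ : m γ ≠ 0) : RootLT w' α γ ∧ RootLT w' γ β := by
  classical
  have irr := S.irrefl w' hw'
  have tr := S.trans w' hw'
  have hne : α ≠ β := by rintro rfl; exact irr α hαβ
  obtain ⟨⟨δ, hδ, hδ'⟩, ε, hε, hε'⟩ := hm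
  have hδ₁ : δ = α ∨ δ = β := by
    by_contra! h
    rw [pairSeq_apply, if_neg h.1.symm, if_neg h.2.symm] at hδ
    omega
  have hε₁ : ε = α ∨ ε = β := by
    by_contra! h
    rw [pairSeq_apply, if_neg h.1.symm, if_neg h.2.symm] at hε
    omega
  have hA : pairSeq α β α = 1 := by simp [pairSeq_apply, hne.symm]
  have hB : pairSeq α β β = 1 := by simp [pairSeq_apply, hne]
  have hO : ∀ x, x ≠ α → x ≠ β → pairSeq α β x = 0 := fun x h₁ h₂ => by
    simp [pairSeq_apply, h₁.symm, h₂.symm]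
  -- neither end can be the only one at which the sequences differ
  have hδα : δ = α := by
    refine hδ₁.resolve_right fun h => ?_
    subst h
    have hmα : m α = 1 := by rw [hδ' α hαβ, hA]
    have hε₂ : ε = δ := by
      refine hε₁.resolve_left fun h => ?_
      rw [h, hA, hmα] at hε
      omega
    subst hε₂
    -- The two sequences then differ at one root only, so `m` is `α` alone, and comparing weights
    -- makes the other root zero.
    have : m = Finsupp.single α 1 := by
      ext x
      by_cases hx : x = α
      · subst hx; simp [hmα]
      rw [Finsupp.single_eq_of_ne hx]
      by_cases hx' : x = ε
      · subst hx'; omega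
      rw [← hO x hx hx']
      exact (S.total w' hw' x ε hx').elim (hδ' x) (hε' x)
    rw [this, weight_single, weight_pairSeq] at hwt
    exact S.val_ne_zero ε (by simpa using hwt.symm)
  subst hδα
  have hmα : m δ = 0 := by omega
  have hεβ : ε = β := by
    refine hε₁.resolve_left fun h => ?_
    subst h
    have hmβ : m β = 1 := by rw [hε' β hαβ, hB]
    have : m = Finsupp.single β 1 := by
      ext x
      by_cases hx : x = β
      · subst hx; simp [hmβ]
      rw [Finsupp.single_eq_of_ne hx]
      by_cases hx' : x = ε
      · subst hx'; omega
      rw [← hO x hx' hx]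
      exact (S.total w' hw' x ε hx').elim (hδ' x) (hε' x)
    rw [this, weight_single, weight_pairSeq] at hwt
    exact S.val_ne_zero ε (by simpa using hwt.symm)
  subst hεβ
  have hγδ : γ ≠ δ := by rintro rfl; exact hγ hmα
  have hγε : γ ≠ ε := by rintro rfl; omega
  constructor
  · refine (S.total w' hw' δ γ hγδ.symm).resolve_right fun h => hγ ?_
    rw [hδ' γ h, hO γ hγδ hγε]
  · refine (S.total w' hw' γ ε hγε).resolve_right fun h => hγ ?_
    rw [hε' γ h, hO γ hγδ hγε]

/-- The sequences below a pair of comparable roots. -/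
theorem seqPrec_pairSeq_iff (S : SegModel w N f lo hi) {α β : PosRoot n} (hne : α ≠ β)
    (h₁ : lo α ≤ lo β) (h₂ : hi α ≤ hi β) {m : RootSeq n} :
    SeqPrec w m (pairSeq α β) ↔ weight m = weight (pairSeq α β) ∧ ∀ γ, m γ ≠ 0 →
      γ ≠ α ∧ γ ≠ β ∧ (lo α ≤ lo γ ∧ hi α ≤ hi γ) ∧ lo γ ≤ lo β ∧ hi γ ≤ hi β := by
  classical
  constructor
  · rintro ⟨hwt, h⟩
    refine ⟨hwt, fun γ hγ => ?_⟩
    have key := fun w' hw' =>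
      S.between_of_biLexLT hwt hw' (S.prec α β hne h₁ h₂ w' hw') (h w' hw') hγ
    have hα : RootPrec w α γ := fun w' hw' => (key w' hw').1
    have hβ : RootPrec w γ β := fun w' hw' => (key w' hw').2
    rw [S.rootPrec_iff] at hα hβ
    exact ⟨hα.1.symm, hβ.1, hα.2, hβ.2⟩
  · rintro ⟨hwt, h⟩
    refine ⟨hwt, fun w' hw' => ⟨⟨α, ?_, fun γ hγ => ?_⟩, β, ?_, fun γ hγ => ?_⟩⟩
    · have : m α = 0 := by by_contra h'; exact (h α h').1 rfl
      simp [this, pairSeq_apply]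
    · have hαβ := S.prec α β hne h₁ h₂ w' hw'
      have hmγ : m γ = 0 := by
        by_contra h'
        obtain ⟨k1, k2, k3, k4⟩ := h γ h'
        exact S.irrefl w' hw' γ (S.trans w' hw' _ _ _ hγ (S.prec α γ k1.symm k3.1 k3.2 w' hw'))
      have n1 : α ≠ γ := by rintro rfl; exact S.irrefl w' hw' _ hγ
      have n2 : β ≠ γ := by
        rintro rfl; exact S.irrefl w' hw' _ (S.trans w' hw' _ _ _ hγ hαβ)
      simp [hmγ, pairSeq_apply, n1, n2]
    · have : m β = 0 := by by_contra h'; exact (h β h').2.1 rfl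
      simp [this, pairSeq_apply]
    · have hαβ := S.prec α β hne h₁ h₂ w' hw'
      have hmγ : m γ = 0 := by
        by_contra h'
        obtain ⟨k1, k2, k3, k4⟩ := h γ h'
        exact S.irrefl w' hw' γ (S.trans w' hw' _ _ _ (S.prec γ β k2 k4.1 k4.2 w' hw') hγ)
      have n1 : β ≠ γ := by rintro rfl; exact S.irrefl w' hw' _ hγ
      have n2 : α ≠ γ := by
        rintro rfl; exact S.irrefl w' hw' _ (S.trans w' hw' _ _ _ hγ hαβ)
      simp [hmγ, pairSeq_apply, n1, n2]

/-! ### Sequences given by two segments. -/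

theorem segSeq_root (S : SegModel w N f lo hi) (γ : PosRoot n) :
    segSeq lo hi (lo γ) (hi γ) = Finsupp.single γ 1 := by
  have h : ∃ δ, lo δ = lo γ ∧ hi δ = hi γ := ⟨γ, rfl, rfl⟩
  rw [segSeq, dif_pos h, S.ext h.choose_spec.1 h.choose_spec.2]

theorem segSeq_of_le (S : SegModel w N f lo hi) {c e : ℤ} (h : e ≤ c) :
    segSeq lo hi c e = 0 := by
  rw [segSeq, dif_neg]
  rintro ⟨γ, rfl, rfl⟩
  exact absurd (S.lt γ) (by omega)

theorem segSeq_cases (S : SegModel w N f lo hi) (c e : ℤ) :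
    segSeq lo hi c e = 0 ∨ ∃ γ, lo γ = c ∧ hi γ = e ∧ segSeq lo hi c e = Finsupp.single γ 1 := by
  by_cases h : ∃ γ, lo γ = c ∧ hi γ = e
  · obtain ⟨γ, rfl, rfl⟩ := h
    exact .inr ⟨γ, rfl, rfl, S.segSeq_root γ⟩
  · exact .inl (by rw [segSeq, dif_neg h])

theorem eq_of_segSeq_ne_zero (S : SegModel w N f lo hi) {c e : ℤ} {γ : PosRoot n}
    (h : segSeq lo hi c e γ ≠ 0) : lo γ = c ∧ hi γ = e := by
  classical
  rcases S.segSeq_cases c e with h' | ⟨δ, h₁, h₂, h'⟩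
  · simp [h'] at h
  · rw [h', Finsupp.single_apply] at h
    split_ifs at h with hδ
    · exact hδ ▸ ⟨h₁, h₂⟩
    · exact absurd rfl h

theorem map_segSeq (S : SegModel w N f lo hi) {c e : ℤ}
    (h : c < e → ∃ γ, lo γ = c ∧ hi γ = e) :
    (Finsupp.toMultiset (segSeq lo hi c e)).map (fun γ => (lo γ, hi γ)) = segs c e := by
  by_cases hce : c < e
  · obtain ⟨γ, rfl, rfl⟩ := h hce
    rw [S.segSeq_root, segs_of_lt hce, Finsupp.toMultiset_single]
    simp
  · rw [S.segSeq_of_le (by omega), segs, if_neg hce]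
    simp

theorem weight_segSeq (S : SegModel w N f lo hi) {c e : ℤ} (hce : c ≤ e)
    (h : c < e → ∃ γ, lo γ = c ∧ hi γ = e) : weight (segSeq lo hi c e) = f e - f c := by
  rcases hce.lt_or_eq with hce | rfl
  · obtain ⟨γ, rfl, rfl⟩ := h hce
    rw [S.segSeq_root, weight_single, S.root]
  · rw [S.segSeq_of_le le_rfl, weight_zero, sub_self]

/-- The support has at most two roots, and if there are two the sequence is their pair; for such a
sequence minimality implies simplicity. -/
theorem simpleSeq_segSeq_add (S : SegModel w N f lo hi) {c e c' e' : ℤ}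
    (h : ∀ m, ¬ SeqPrec w m (segSeq lo hi c e + segSeq lo hi c' e')) :
    SimpleSeq w (segSeq lo hi c e + segSeq lo hi c' e') := by
  classical
  refine simpleSeq_of_forall_not h fun γ δ hne hγ hδ => ?_
  rcases S.segSeq_cases c e with h₁ | ⟨x, -, -, h₁⟩ <;>
    rcases S.segSeq_cases c' e' with h₂ | ⟨y, -, -, h₂⟩ <;> rw [h₁, h₂] at hγ hδ ⊢
  · simp at hγ
  · rw [zero_add, Finsupp.single_apply] at hγ hδ
    split_ifs at hγ hδ <;> simp_all
  · rw [add_zero, Finsupp.single_apply] at hγ hδ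
    split_ifs at hγ hδ <;> simp_all
  · exact pairSeq_eq_of_pos hne hγ hδ

/-- The list of sequences that may lie below a pair of roots. -/
theorem cases_of_seqPrec (S : SegModel w N f lo hi) {α β : PosRoot n} (hne : α ≠ β)
    (h₁ : lo α ≤ lo β) (h₂ : hi α ≤ hi β) {m : RootSeq n} (hm : SeqPrec w m (pairSeq α β)) :
    (lo β ≤ hi α ∧ hi β - lo α < N ∧ lo α < lo β ∧ hi α < hi β ∧
      m = segSeq lo hi (lo α) (hi β) + segSeq lo hi (lo β) (hi α)) ∨
    (lo β ≤ hi α ∧ N < hi β - lo α ∧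
      m = segSeq lo hi (hi β - N) (lo α + N) + segSeq lo hi (lo β) (hi α)) ∨
    (N < hi β - lo α ∧ hi β - hi α ≤ N ∧ lo β - lo α ≤ N ∧
      m = segSeq lo hi (hi β - N) (hi α) + segSeq lo hi (lo β) (lo α + N)) := by
  obtain ⟨hwt, hm⟩ := (S.seqPrec_pairSeq_iff hne h₁ h₂).1 hm
  set M := (Finsupp.toMultiset m).map fun γ => (lo γ, hi γ) with hM
  have hmem : ∀ c e, (c, e) ∈ M → ∃ γ, m γ ≠ 0 ∧ lo γ = c ∧ hi γ = e := by
    intro c e hce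
    obtain ⟨γ, hγ, h⟩ := Multiset.mem_map.1 hce
    rw [Finsupp.mem_toMultiset, Finsupp.mem_support_iff] at hγ
    rw [Prod.mk.injEq] at h
    exact ⟨γ, hγ, h⟩
  have D : SegDecomp N (lo α) (hi α) (lo β) (hi β) M :=
    { lt := S.lt α
      lt_add := S.lt_add α
      lt' := S.lt β
      lt_add' := S.lt_add β
      le_left := h₁
      le_right := h₂
      near := S.near α β
      mem := by
        intro c e hce
        obtain ⟨γ, hγ, rfl, rfl⟩ := hmem c e hce
        obtain ⟨-, -, h₃, h₄⟩ := hm γ hγ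
        exact ⟨h₃.1, h₄.1, h₃.2, h₄.2, S.lt γ, S.lt_add γ⟩
      ne := fun h => by
        obtain ⟨γ, hγ, h₃, h₄⟩ := hmem _ _ h
        exact (hm γ hγ).1 (S.ext h₃ h₄)
      ne' := fun h => by
        obtain ⟨γ, hγ, h₃, h₄⟩ := hmem _ _ h
        exact (hm γ hγ).2.1 (S.ext h₃ h₄)
      sum := by
        intro G hG
        obtain ⟨L, hL⟩ := S.dual G hG
        have h := sum_map_toMultiset L m
        rw [hwt, weight_pairSeq, map_add, S.root α, S.root β] at h
        simp only [map_sub, hL] at h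
        rw [← h, hM, Multiset.map_map]
        congr 1
        refine Multiset.map_congr rfl fun γ _ => ?_
        rw [Function.comp_apply, S.root γ, map_sub, hL, hL] }
  have inj : Function.Injective fun γ => (lo γ, hi γ) := fun γ δ h =>
    S.ext (Prod.mk.inj h).1 (Prod.mk.inj h).2
  -- Roots are determined by their segments, so an identity of multisets of segments lifts to an
  -- identity of sequences.
  have back : ∀ c e c' e', M = segs c e + segs c' e' →
      m = segSeq lo hi c e + segSeq lo hi c' e' := by
    intro c e c' e' h
    have ex : ∀ c e, (c, e) ∈ M → ∃ γ, lo γ = c ∧ hi γ = e := fun c e h => by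
      obtain ⟨γ, -, h⟩ := hmem c e h
      exact ⟨γ, h⟩
    apply (Multiset.toFinsupp (α := PosRoot n)).symm.injective
    apply Multiset.map_injective inj
    change (Finsupp.toMultiset _).map _ = (Finsupp.toMultiset _).map _
    rw [← hM, h, map_add, Multiset.map_add, S.map_segSeq, S.map_segSeq]
    · exact fun hlt => ex _ _ (by simp [h, segs_of_lt hlt])
    · exact fun hlt => ex _ _ (by simp [h, segs_of_lt hlt])
  rcases D.list with ⟨k1, k2, k3, k4, k5⟩ | ⟨k1, k2, k3⟩ | ⟨k1, k2, k3, k4⟩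
  · exact .inl ⟨k1, k2, k3, k4, back _ _ _ _ k5⟩
  · exact .inr (.inl ⟨k1, k2, back _ _ _ _ k3⟩)
  · exact .inr (.inr ⟨k1, k2, k3, back _ _ _ _ k4⟩)

/-- For a comparable pair, lying below is a matter of weight and of support strictly between the two
roots. Degenerate segments `c = e` are admitted: they have no root and contribute weight 0. -/
theorem seqPrec_of_segs (S : SegModel w N f lo hi) {α β : PosRoot n} (hne : α ≠ β)
    (h₁ : lo α ≤ lo β) (h₂ : hi α ≤ hi β) {c e c' e' : ℤ}
    (hc : c ≤ e ∧ e < c + N ∧ lo α ≤ c ∧ c ≤ lo β ∧ hi α ≤ e ∧ e ≤ hi β)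
    (hc' : c' ≤ e' ∧ e' < c' + N ∧ lo α ≤ c' ∧ c' ≤ lo β ∧ hi α ≤ e' ∧ e' ≤ hi β)
    (n₁ : c ≠ lo α ∨ e ≠ hi α) (n₂ : c ≠ lo β ∨ e ≠ hi β)
    (n₁' : c' ≠ lo α ∨ e' ≠ hi α) (n₂' : c' ≠ lo β ∨ e' ≠ hi β)
    (hwt : f e - f c + (f e' - f c') = f (hi α) - f (lo α) + (f (hi β) - f (lo β))) :
    SeqPrec w (segSeq lo hi c e + segSeq lo hi c' e') (pairSeq α β) := by
  rw [S.seqPrec_pairSeq_iff hne h₁ h₂]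
  refine ⟨?_, fun γ hγ => ?_⟩
  · rw [weight_add, weight_pairSeq, S.weight_segSeq hc.1 fun h =>
      S.exists_root α β c e (by omega) (by omega) (by omega) (by omega) h (by omega),
      S.weight_segSeq hc'.1 fun h =>
      S.exists_root α β c' e' (by omega) (by omega) (by omega) (by omega) h (by omega),
      hwt, S.root α, S.root β]
  · rw [Finsupp.add_apply] at hγ
    have : (lo γ = c ∧ hi γ = e) ∨ (lo γ = c' ∧ hi γ = e') := by
      by_cases h : segSeq lo hi c e γ = 0
      · exact .inr (S.eq_of_segSeq_ne_zero (by omega))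
      · exact .inl (S.eq_of_segSeq_ne_zero h)
    refine ⟨?_, ?_, ?_⟩
    · rintro rfl; omega
    · rintro rfl; omega
    · omega

theorem f_sub (S : SegModel w N f lo hi) (x : ℤ) : f (x - N) = -f x := by
  have := S.anti (x - N)
  rw [sub_add_cancel] at this
  rw [this, neg_neg]

/-- Intersection and union of two overlapping segments. -/
theorem seqPrec_overlap (S : SegModel w N f lo hi) {α β : PosRoot n} (h : lo β ≤ hi α)
    (hN : hi β - lo α < N) (h₁ : lo α < lo β) (h₂ : hi α < hi β) :
    SeqPrec w (segSeq lo hi (lo α) (hi β) + segSeq lo hi (lo β) (hi α)) (pairSeq α β) := by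
  have := S.lt α
  have := S.lt β
  have := S.lt_add α
  have := S.lt_add β
  refine S.seqPrec_of_segs ?_ h₁.le h₂.le ?_ ?_ ?_ ?_ ?_ ?_ (by abel)
  · rintro rfl; omega
  all_goals omega

/-- Here `[lo α, hi β]` is too long to be a root. Moving both of its ends by the antiperiod changes
both signs and yields a segment `[hi β - N, lo α + N]` with the same boundary. -/
theorem seqPrec_wrap (S : SegModel w N f lo hi) {α β : PosRoot n} (h : lo β ≤ hi α)
    (hN : N < hi β - lo α) (h₁ : lo α ≤ lo β) (h₂ : hi α ≤ hi β) :
    SeqPrec w (segSeq lo hi (hi β - N) (lo α + N) + segSeq lo hi (lo β) (hi α))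
      (pairSeq α β) := by
  have := S.lt α
  have := S.lt β
  have := S.lt_add α
  have := S.lt_add β
  refine S.seqPrec_of_segs ?_ h₁ h₂ ?_ ?_ ?_ ?_ ?_ ?_ (by rw [S.anti, S.f_sub]; abel)
  · rintro rfl; omega
  all_goals omega

/-- The same shifted ends `hi β - N` and `lo α + N`, now joined to `hi α` and `lo β` instead of to
each other. -/
theorem seqPrec_cross (S : SegModel w N f lo hi) {α β : PosRoot n} (hN : N < hi β - lo α)
    (hb : hi β - hi α ≤ N) (ha : lo β - lo α ≤ N) (h₁ : lo α ≤ lo β) (h₂ : hi α ≤ hi β) :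
    SeqPrec w (segSeq lo hi (hi β - N) (hi α) + segSeq lo hi (lo β) (lo α + N))
      (pairSeq α β) := by
  have := S.lt α
  have := S.lt β
  have := S.lt_add α
  have := S.lt_add β
  refine S.seqPrec_of_segs ?_ h₁ h₂ ?_ ?_ ?_ ?_ ?_ ?_ (by rw [S.anti, S.f_sub]; abel)
  · rintro rfl; omega
  all_goals omega

/-- By transitivity, anything below the unique smaller sequence would be that sequence itself; so it
is minimal, hence simple. -/
theorem gdistSeq_eq_one_of_unique (S : SegModel w N f lo hi) {α β : PosRoot n} (hne : α ≠ β)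
    {c e c' e' : ℤ} (h : SeqPrec w (segSeq lo hi c e + segSeq lo hi c' e') (pairSeq α β))
    (h' : ∀ m, SeqPrec w m (pairSeq α β) → m = segSeq lo hi c e + segSeq lo hi c' e') :
    gdistSeq w (pairSeq α β) = 1 := by
  refine gdistSeq_eq_one (not_simpleSeq_pairSeq hne h) fun m hm => ?_
  obtain rfl := h' m hm
  refine S.simpleSeq_segSeq_add fun m' hm' => ?_
  obtain rfl := h' m' (S.seqPrec_trans _ _ _ hm' h)
  exact SeqPrec.irrefl _ hm'

/-- The crossed segments `γ`, `δ` overlap, and their union and intersection form the wrapped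
sequence. Thus the crossed pair is not simple, while the wrapped sequence is minimal, and the
longest non-simple chain is the crossed pair followed by the given pair. -/
theorem gdistSeq_eq_two_of_wrap (S : SegModel w N f lo hi) {α β : PosRoot n} (hne : α ≠ β)
    (h₁ : lo α ≤ lo β) (h₂ : hi α ≤ hi β) (h : lo β ≤ hi α) (hN : N < hi β - lo α) :
    gdistSeq w (pairSeq α β) = 2 := by
  have := S.lt α
  have := S.lt β
  have := S.lt_add α
  have := S.lt_add β
  obtain ⟨γ, hγ₁, hγ₂⟩ := S.exists_root α β (hi β - N) (hi α)
    (by omega) (by omega) (by omega) (by omega) (by omega) (by omega)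
  obtain ⟨δ, hδ₁, hδ₂⟩ := S.exists_root α β (lo β) (lo α + N)
    (by omega) (by omega) (by omega) (by omega) (by omega) (by omega)
  have hwrap := S.seqPrec_wrap h hN h₁ h₂
  have hcross := S.seqPrec_cross hN (by omega) (by omega) h₁ h₂
  have hpair : segSeq lo hi (hi β - N) (hi α) + segSeq lo hi (lo β) (lo α + N) = pairSeq γ δ := by
    rw [← hγ₁, ← hγ₂, ← hδ₁, ← hδ₂, S.segSeq_root, S.segSeq_root, pairSeq]
  have hlt : SeqPrec w (segSeq lo hi (hi β - N) (lo α + N) + segSeq lo hi (lo β) (hi α))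
      (pairSeq γ δ) := by
    have := S.seqPrec_overlap (α := γ) (β := δ) (by omega) (by omega) (by omega) (by omega)
    rwa [hγ₁, hγ₂, hδ₁, hδ₂] at this
  have hγδ : γ ≠ δ := by rintro rfl; omega
  rw [hpair] at hcross
  have hcases : ∀ m, SeqPrec w m (pairSeq α β) →
      m = segSeq lo hi (hi β - N) (lo α + N) + segSeq lo hi (lo β) (hi α) ∨ m = pairSeq γ δ := by
    intro m hm
    rcases S.cases_of_seqPrec hne h₁ h₂ hm with ⟨-, k, -⟩ | ⟨-, -, k⟩ | ⟨-, -, -, k⟩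
    · omega
    · exact .inl k
    · exact .inr (k.trans hpair)
  refine gdistSeq_eq_two (not_simpleSeq_pairSeq hne hcross) S.seqPrec_trans hcross
    (not_simpleSeq_pairSeq hγδ hlt) fun m hm hns => (hcases m hm).resolve_left ?_
  rintro rfl
  refine hns (S.simpleSeq_segSeq_add fun m' hm' => ?_)
  rcases hcases m' (S.seqPrec_trans _ _ _ hm' hwrap) with rfl | rfl
  · exact SeqPrec.irrefl _ hm'
  · exact SeqPrec.irrefl _ (S.seqPrec_trans _ _ _ hm' hlt)

theorem gdist_comm (α β : PosRoot n) : gdist w α β = gdist w β α := by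
  rw [gdist, gdist, pairSeq_comm β α]
  by_cases h : RootPrec w α β <;> by_cases h' : RootPrec w β α <;> simp [h, h']

/-- The generalized distance of two roots in terms of their segments. -/
theorem gdist_of_le (S : SegModel w N f lo hi) {α β : PosRoot n}
    (h₁ : lo α ≤ lo β) (h₂ : hi α ≤ hi β) :
    gdist w α β =
      if lo β ≤ hi α ∧ N < hi β - lo α then 2
      else if (lo α < lo β ∧ hi α < hi β ∧ lo β ≤ hi α ∧ hi β - lo α < N) ∨
        (hi α < lo β ∧ N < hi β - lo α ∧ hi β - hi α ≤ N ∧ lo β - lo α ≤ N) then 1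
      else 0 := by
  have := S.lt α
  have := S.lt_add α
  by_cases hne : α = β
  · subst hne
    rw [gdist, if_neg, if_neg (by omega), if_neg (by omega)]
    rintro (h | h) <;> exact (S.rootPrec_iff.1 h).1 rfl
  rw [gdist, if_pos (.inl (S.prec α β hne h₁ h₂))]
  split_ifs with k₁ k₂
  · exact S.gdistSeq_eq_two_of_wrap hne h₁ h₂ k₁.1 k₁.2
  · rcases k₂ with ⟨k1, k2, k3, k4⟩ | ⟨k1, k2, k3, k4⟩
    · refine S.gdistSeq_eq_one_of_unique hne (S.seqPrec_overlap k3 k4 k1 k2) fun m hm => ?_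
      rcases S.cases_of_seqPrec hne h₁ h₂ hm with ⟨-, -, -, -, k⟩ | ⟨-, k, -⟩ | ⟨k, -⟩
      · exact k
      · omega
      · omega
    · refine S.gdistSeq_eq_one_of_unique hne (S.seqPrec_cross k2 k3 k4 h₁ h₂) fun m hm => ?_
      rcases S.cases_of_seqPrec hne h₁ h₂ hm with ⟨k, -⟩ | ⟨k, -⟩ | ⟨-, -, -, k⟩
      · omega
      · omega
      · exact k
  · refine gdistSeq_eq_zero (simpleSeq_of_forall_not (fun m hm => ?_) fun γ δ hγδ hγ hδ =>
      pairSeq_eq_of_pos hγδ hγ hδ)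
    rcases S.cases_of_seqPrec hne h₁ h₂ hm with ⟨k3, k4, k5, k6, -⟩ | ⟨k3, k4, -⟩ |
      ⟨k3, k4, k5, -⟩ <;> omega

/-- Let `α` precede `β` and let `d` be the difference of their end sums. Then `hi β - lo α = (d + i
+ j) / 2`, `hi α - lo β = (i + j - d) / 2`, and the left and right ends differ by `(d + i - j) / 2`
and `(d - i + j) / 2`. -/
theorem gdist_eq (S : SegModel w N f lo hi) (α β : PosRoot n) {i j p q : ℤ}
    (hi₁ : i = hi α - lo α) (hj : j = hi β - lo β) (hpq : |p - q| = |lo α + hi α - (lo β + hi β)|) :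
    gdist w α β =
      if 2 * N - i - j < |p - q| ∧ |p - q| ≤ i + j then 2
      else if (|i - j| < |p - q| ∧ |p - q| ≤ i + j ∧ |p - q| < 2 * N - i - j) ∨
        (i + j < |p - q| ∧ 2 * N - i - j < |p - q| ∧ |p - q| ≤ 2 * N - |i - j|) then 1
      else 0 := by
  have := S.lt α
  have := S.lt_add α
  have := S.lt β
  have := S.lt_add β
  have hd := abs_cases (lo α + hi α - (lo β + hi β))
  have hij := abs_cases (i - j)
  rw [hpq]
  generalize |lo α + hi α - (lo β + hi β)| = d at hd ⊢
  generalize |i - j| = r at hij ⊢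
  by_cases h : lo α ≤ lo β ∧ hi α ≤ hi β
  · rw [S.gdist_of_le h.1 h.2]
    refine if_congr ?_ rfl (if_congr ?_ rfl rfl) <;> omega
  by_cases h' : lo β ≤ lo α ∧ hi β ≤ hi α
  · rw [gdist_comm, S.gdist_of_le h'.1 h'.2]
    refine if_congr ?_ rfl (if_congr ?_ rfl rfl) <;> omega
  -- Incomparable segments are nested with distinct ends: `d < |i - j| < 2 * N - i - j`, so every
  -- condition fails.
  · rw [gdist, if_neg, if_neg (by omega), if_neg (by omega)]
    rintro (k | k)
    · exact h (S.rootPrec_iff.1 k).2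
    · exact h' (S.rootPrec_iff.1 k).2

end SegModel
/-! ### The antiperiodic sequence of a slice -/

/-- `l k` is the left end of the segment in column `k` of a slice: from each column to the next,
the segment `[l k, l k + k]` is extended by one step, to the right or to the left. -/
def IsSlice (n : ℕ) (l : ℕ → ℤ) : Prop :=
  ∀ k, 1 ≤ k → k < n → l (k + 1) = l k ∨ l (k + 1) = l k - 1

/-- The point attached to the column `k`. -/
def slicePt (l : ℕ → ℤ) (k : ℕ) : ℤ := if l k < l (k - 1) then l k else l k + k - 1

theorem slicePt_one (l : ℕ → ℤ) : slicePt l 1 = l 1 := by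
  unfold slicePt; split_ifs <;> simp

theorem slicePt_left {l : ℕ → ℤ} {k : ℕ} (h : l (k + 1) = l k - 1) :
    slicePt l (k + 1) = l (k + 1) := by
  rw [slicePt, if_pos (by rw [Nat.add_sub_cancel]; omega)]

theorem slicePt_right {l : ℕ → ℤ} {k : ℕ} (h : l (k + 1) = l k) :
    slicePt l (k + 1) = l (k + 1) + k := by
  rw [slicePt, if_neg (by rw [Nat.add_sub_cancel]; omega)]
  push_cast
  ring

theorem slicePt_mem (l : ℕ → ℤ) {k : ℕ} (hk : 1 ≤ k) :
    l k ≤ slicePt l k ∧ slicePt l k < l k + k := by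
  unfold slicePt
  split_ifs <;> omega

namespace IsSlice

variable {n : ℕ} {l : ℕ → ℤ}

/-- Each step of a slice adds one point at one end, so the intervals `[l k, l k + k)` are nested. -/
theorem lipschitz (hl : IsSlice n l) {j k : ℕ} (hj : 1 ≤ j) (hjk : j ≤ k) (hk : k ≤ n) :
    l k ≤ l j ∧ l j + j ≤ l k + k := by
  induction k, hjk using Nat.le_induction with
  | base => exact ⟨le_rfl, le_rfl⟩
  | succ k hjk ih =>
    have := ih (by omega)
    have := hl k (by omega) (by omega)
    push_cast
    omega

theorem slicePt_mem_of_le (hl : IsSlice n l) {j k : ℕ} (hj : 1 ≤ j) (hjk : j ≤ k) (hk : k ≤ n) :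
    l k ≤ slicePt l j ∧ slicePt l j < l k + k := by
  have := hl.lipschitz hj hjk hk
  have := slicePt_mem l hj
  omega

theorem slicePt_notMem (hl : IsSlice n l) {k : ℕ} (hk₁ : 1 ≤ k) (hk : k < n) :
    slicePt l (k + 1) < l k ∨ l k + k ≤ slicePt l (k + 1) := by
  rcases hl k hk₁ hk with h | h
  · rw [slicePt_right h]; omega
  · rw [slicePt_left h]; omega

/-- Each interval is the preceding one with its own `slicePt` added, so the first `k` points exhaust
the `k`-th interval. -/
theorem exists_slicePt (hl : IsSlice n l) {k : ℕ} (hk₁ : 1 ≤ k) (hk : k ≤ n) {x : ℤ}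
    (h₁ : l k ≤ x) (h₂ : x < l k + k) : ∃ j, 1 ≤ j ∧ j ≤ k ∧ slicePt l j = x := by
  induction k, hk₁ using Nat.le_induction with
  | base => exact ⟨1, le_rfl, le_rfl, by rw [slicePt_one]; push_cast at h₂; omega⟩
  | succ k hk₁ ih =>
    by_cases hx : l k ≤ x ∧ x < l k + k
    · obtain ⟨j, hj, hjk, h⟩ := ih (by omega) hx.1 hx.2
      exact ⟨j, hj, by omega, h⟩
    · refine ⟨k + 1, by omega, le_rfl, ?_⟩
      push_cast at h₂
      rcases hl k hk₁ (by omega) with h | h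
      · rw [slicePt_right h]; omega
      · rw [slicePt_left h]; omega

theorem slicePt_inj (hl : IsSlice n l) {j k : ℕ} (hj : 1 ≤ j) (hjk : j < k) (hk : k ≤ n) :
    slicePt l j ≠ slicePt l k := by
  obtain ⟨k, rfl⟩ : ∃ k', k = k' + 1 := ⟨k - 1, by omega⟩
  have := hl.slicePt_mem_of_le hj (Nat.lt_succ_iff.1 hjk) (by omega)
  have := hl.slicePt_notMem (k := k) (by omega) (by omega)
  omega

end IsSlice

/-- The point attached to a coordinate. -/
def coordPt (n : ℕ) (l : ℕ → ℤ) (κ : Fin (n + 1)) : ℤ :=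
  if κ.val < n then slicePt l (κ.val + 1) else l n + n

/-- The antiperiodic sequence of a slice, with values `± ε_κ`. -/
noncomputable def sliceSeq (n : ℕ) (l : ℕ → ℤ) (σ : ℤ) (x : ℤ) : Lat n := fun κ =>
  -(if κ.val < n then 1 else σ) * comb (n + 1) (coordPt n l κ) x

theorem sliceSeq_add {n : ℕ} (l : ℕ → ℤ) (σ x : ℤ) :
    sliceSeq n l σ (x + (n + 1)) = -sliceSeq n l σ x := by
  ext κ
  simp only [sliceSeq, Pi.neg_apply]
  rw [comb_add (by omega)]
  ring

theorem antiperiodic_mul {A : Type*} [AddGroup A] {N : ℤ} {f : ℤ → A}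
    (hf : ∀ x, f (x + N) = -f x) (r : ℤ) :
    (∀ x, f (x + r * N) = f x) ∨ ∀ x, f (x + r * N) = -f x := by
  have hf' : ∀ x, f (x - N) = -f x := fun x => by
    rw [eq_neg_iff_add_eq_zero, ← neg_eq_iff_add_eq_zero, ← hf, sub_add_cancel]
  induction r using Int.induction_on with
  | zero => simp
  | succ r ih =>
    refine ih.symm.imp (fun h x => ?_) fun h x => ?_ <;>
      rw [add_mul, one_mul, ← add_assoc, hf, h]
    rw [neg_neg]
  | pred r ih =>
    refine ih.symm.imp (fun h x => ?_) fun h x => ?_ <;>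
      rw [sub_mul, one_mul, ← add_sub_assoc, hf', h]
    rw [neg_neg]

namespace IsSlice

variable {n : ℕ} {l : ℕ → ℤ} {σ : ℤ}

theorem coordPt_mem (hl : IsSlice n l) (hn : 1 ≤ n) (κ : Fin (n + 1)) :
    l n ≤ coordPt n l κ ∧ coordPt n l κ ≤ l n + n := by
  unfold coordPt
  split_ifs with h
  · have := hl.slicePt_mem_of_le (j := κ + 1) (by omega) h le_rfl
    omega
  · omega

theorem coordPt_lt (hl : IsSlice n l) {κ : Fin (n + 1)} {k : ℕ} (hk₁ : κ.val < k)
    (hk : k ≤ n) : l k ≤ coordPt n l κ ∧ coordPt n l κ < l k + k := by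
  rw [coordPt, if_pos (by omega)]
  exact hl.slicePt_mem_of_le (by omega) hk₁ hk

theorem coordPt_ne (hl : IsSlice n l) {κ κ' : Fin (n + 1)} (h : κ < κ') :
    coordPt n l κ ≠ coordPt n l κ' := by
  rw [Fin.lt_def] at h
  have := κ'.2
  unfold coordPt
  rw [if_pos (by omega)]
  split_ifs with h'
  · exact hl.slicePt_inj (by omega) (by omega) (by omega)
  · have := hl.slicePt_mem_of_le (j := κ + 1) (by omega) (by omega) le_rfl
    omega

theorem exists_coordPt (hl : IsSlice n l) (hn : 1 ≤ n) {x : ℤ} (h₁ : l n ≤ x)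
    (h₂ : x ≤ l n + n) : ∃ κ, coordPt n l κ = x := by
  by_cases h : x = l n + n
  · exact ⟨Fin.last n, by simp [coordPt, h]⟩
  · obtain ⟨j, hj, hjn, rfl⟩ := hl.exists_slicePt hn le_rfl h₁ (by omega)
    refine ⟨⟨j - 1, by omega⟩, ?_⟩
    rw [coordPt, if_pos (by dsimp only; omega)]
    congr 1
    dsimp only
    omega

theorem sliceSeq_coordPt (hl : IsSlice n l) (hn : 1 ≤ n) (κ : Fin (n + 1)) :
    sliceSeq n l σ (coordPt n l κ) = -((if κ.val < n then 1 else σ) • eps κ) := by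
  ext κ'
  simp only [sliceSeq, eps, Pi.neg_apply, Pi.smul_apply, smul_eq_mul]
  by_cases h : κ' = κ
  · subst h
    rw [comb_self, Pi.single_eq_same]; ring
  · have := hl.coordPt_mem hn κ
    have := hl.coordPt_mem hn κ'
    have : coordPt n l κ ≠ coordPt n l κ' := by
      rcases lt_or_gt_of_ne h with h | h
      · exact (hl.coordPt_ne h).symm
      · exact hl.coordPt_ne h
    rw [comb_of_near (by omega) (by omega) this, Pi.single_eq_of_ne h]
    ring

/-- The `n + 1` coordinate points fill `[l n, l n + n]`, which is a full antiperiod. -/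
theorem exists_coordPt_add (hl : IsSlice n l) (hn : 1 ≤ n) (x : ℤ) :
    ∃ κ r, x = coordPt n l κ + r * (n + 1) := by
  have h₁ := Int.emod_nonneg (x - l n) (b := n + 1) (by omega)
  have h₂ := Int.emod_lt_of_pos (x - l n) (b := n + 1) (by omega)
  have h₃ := Int.emod_add_mul_ediv (x - l n) (n + 1)
  obtain ⟨κ, hκ⟩ := hl.exists_coordPt hn (x := l n + (x - l n) % (n + 1)) (by omega) (by omega)
  exact ⟨κ, (x - l n) / (n + 1), by rw [hκ]; linarith⟩

/-- An antiperiodic function is determined by its values at the points of the coordinates. -/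
theorem antiperiodic_ext (hl : IsSlice n l) (hn : 1 ≤ n) {A : Type*} [AddGroup A] {G H : ℤ → A}
    (hG : ∀ x, G (x + (n + 1)) = -G x) (hH : ∀ x, H (x + (n + 1)) = -H x)
    (h : ∀ κ, G (coordPt n l κ) = H (coordPt n l κ)) (x : ℤ) : G x = H x := by
  obtain ⟨κ, r, rfl⟩ := hl.exists_coordPt_add hn x
  have key : ∀ r : ℤ, ∀ x, G x = H x → G (x + r * (n + 1)) = H (x + r * (n + 1)) := by
    have sub : ∀ (F : ℤ → A), (∀ x, F (x + (n + 1)) = -F x) → ∀ x, F (x - (n + 1)) = -F x := by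
      intro F hF x
      rw [eq_neg_iff_add_eq_zero, ← neg_eq_iff_add_eq_zero, ← hF, sub_add_cancel]
    intro r x hx
    induction r using Int.induction_on with
    | zero => simpa using hx
    | succ r ih => rw [add_mul, one_mul, ← add_assoc, hG, hH, ih]
    | pred r ih => rw [sub_mul, one_mul, ← add_sub_assoc, sub G hG, sub H hH, ih]
  exact key r _ (h κ)

/-- At the coordinate points the sequence runs through a basis up to sign, so a functional can be
prescribed freely there; antiperiodicity settles all other points. -/
theorem exists_dual (hl : IsSlice n l) (hn : 1 ≤ n) (hσ : σ = 1 ∨ σ = -1) {G : ℤ → ℤ}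
    (hG : ∀ x, G (x + (n + 1)) = -G x) :
    ∃ L : Lat n →+ ℤ, ∀ x, L (sliceSeq n l σ x) = G x := by
  let L : Lat n →+ ℤ :=
    { toFun := fun v => ∑ κ : Fin (n + 1),
        v κ * (-(if κ.val < n then 1 else σ) * G (coordPt n l κ))
      map_zero' := by simp
      map_add' := fun u v => by simp only [Pi.add_apply, add_mul, Finset.sum_add_distrib] }
  refine ⟨L, hl.antiperiodic_ext hn (fun x => by rw [sliceSeq_add, map_neg]) hG fun κ => ?_⟩
  rw [hl.sliceSeq_coordPt hn]
  change ∑ κ' : Fin (n + 1), _ = _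
  rw [Finset.sum_eq_single κ]
  · simp only [eps, Pi.neg_apply, Pi.smul_apply, Pi.single_eq_same, smul_eq_mul, mul_one]
    split_ifs
    · ring
    · rcases hσ with rfl | rfl <;> ring
  · intro κ' _ h
    rw [Pi.neg_apply, Pi.smul_apply, eps, Pi.single_eq_of_ne h, smul_zero, neg_zero, zero_mul]
  · simp

end IsSlice

/-! ### Positivity -/

theorem isPosRoot_add {n : ℕ} {a b : Fin (n + 1)} (h : a ≠ b) : IsPosRoot (eps a + eps b) := by
  rcases lt_or_gt_of_ne h with h | h
  · exact ⟨a, b, h, .inr rfl⟩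
  · exact ⟨b, a, h, .inr (add_comm _ _)⟩

theorem isPosRoot_of_lt {n : ℕ} {a b : Fin (n + 1)} (h : a < b) {v : Lat n}
    (hv : v = eps b ∨ v = -eps b) : IsPosRoot (eps a + v) := by
  rcases hv with rfl | rfl
  · exact ⟨a, b, h, .inr rfl⟩
  · exact ⟨a, b, h, .inl (sub_eq_add_neg _ _).symm⟩

/-- Pairing with `(n, n - 1, …, 0)` is strictly positive on positive roots. -/
theorem IsPosRoot.not_neg {n : ℕ} {v : Lat n} (hv : IsPosRoot v) : ¬ IsPosRoot (-v) := by
  let ρ : Lat n →+ ℤ :=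
    { toFun := fun v => ∑ κ : Fin (n + 1), v κ * (n - κ)
      map_zero' := by simp
      map_add' := fun u v => by simp only [Pi.add_apply, add_mul, Finset.sum_add_distrib] }
  have hε : ∀ κ, ρ (eps κ) = n - κ := by
    intro κ
    change ∑ κ' : Fin (n + 1), _ = _
    rw [Finset.sum_eq_single κ (by intro κ' _ h; simp [eps, h]) (by simp)]
    simp [eps]
  have pos : ∀ v, IsPosRoot v → 0 < ρ v := by
    rintro v ⟨a, b, hab, rfl | rfl⟩ <;> rw [Fin.lt_def] at hab <;> have := b.2
    · rw [map_sub, hε, hε]; omega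
    · rw [map_add, hε, hε]; omega
  intro h
  have h₁ := pos _ hv
  have h₂ := pos _ h
  rw [map_neg] at h₂
  omega

namespace IsSlice

variable {n : ℕ} {l : ℕ → ℤ} {σ : ℤ}

theorem sliceSeq_inner (hl : IsSlice n l) (hn : 1 ≤ n) {k : ℕ} (hk₁ : 1 ≤ k) (hk : k ≤ n) {x : ℤ}
    (h₁ : l k ≤ x) (h₂ : x < l k + k) :
    ∃ κ : Fin (n + 1), κ.val < k ∧ sliceSeq n l σ x = -eps κ := by
  obtain ⟨j, hj, hjk, rfl⟩ := hl.exists_slicePt hk₁ hk h₁ h₂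
  have h := hl.sliceSeq_coordPt (σ := σ) hn ⟨j - 1, by omega⟩
  rw [coordPt, if_pos (by dsimp only; omega), if_pos (by dsimp only; omega), one_smul] at h
  refine ⟨⟨j - 1, by omega⟩, by dsimp only; omega, ?_⟩
  rw [← h]
  congr 2
  dsimp only
  omega

/-- The points of a period outside `[l k, l k + k)` carry the coordinates of index at least `k`.
Their signs are not controlled, but the inner coordinates dominate them. -/
theorem sliceSeq_outer (hl : IsSlice n l) (hn : 1 ≤ n) (hσ : σ = 1 ∨ σ = -1) {k : ℕ}
    (hk₁ : 1 ≤ k) (hk : k ≤ n) {x : ℤ} (h₁ : l k + k ≤ x) (h₂ : x ≤ l k + n) :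
    ∃ κ : Fin (n + 1), k ≤ κ.val ∧
      (sliceSeq n l σ x = eps κ ∨ sliceSeq n l σ x = -eps κ) := by
  have hlip := hl.lipschitz hk₁ hk le_rfl
  have hval : ∀ κ : Fin (n + 1), sliceSeq n l σ (coordPt n l κ) = eps κ ∨
      sliceSeq n l σ (coordPt n l κ) = -eps κ := by
    intro κ
    rw [hl.sliceSeq_coordPt hn]
    split_ifs
    · simp
    · rcases hσ with rfl | rfl <;> simp
  by_cases hx : x ≤ l n + n
  · obtain ⟨κ, rfl⟩ := hl.exists_coordPt hn (x := x) (by omega) hx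
    refine ⟨κ, ?_, hval κ⟩
    by_contra! h
    have := hl.coordPt_lt h hk
    omega
  · obtain ⟨κ, hκ⟩ := hl.exists_coordPt hn (x := x - (n + 1)) (by omega) (by omega)
    refine ⟨κ, ?_, ?_⟩
    · by_contra! h
      have := hl.coordPt_lt h hk
      omega
    · have h := sliceSeq_add (n := n) l σ (x - (n + 1))
      rw [sub_add_cancel, ← hκ] at h
      rw [h, neg_inj, neg_eq_iff_eq_neg]
      exact (hval κ).symm

/-- Going from column `k` to `k + 1` removes one extreme point of the outer interval. If the segment
ends there, that end contributes `+ε` with a smaller index than the other end; if not, the segment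
is still outer for `k + 1`. -/
theorem isPosRoot_outer (hl : IsSlice n l) (hn : 1 ≤ n) (hσ : σ = 1 ∨ σ = -1) {k : ℕ}
    (hk₁ : 1 ≤ k) (hk : k ≤ n) {c e : ℤ} (h₁ : l k + k ≤ c) (h₂ : c < e) (h₃ : e ≤ l k + n) :
    IsPosRoot (sliceSeq n l σ e - sliceSeq n l σ c) := by
  induction hk using Nat.decreasingInduction with
  | self => omega
  | of_succ k hk ih =>
    have ih := ih (by omega)
    push_cast at ih
    rcases hl k hk₁ hk with h | h
    · by_cases hc : c = l k + k
      · obtain ⟨κ, hκ, hκ'⟩ := hl.sliceSeq_outer hn hσ (k := k + 1) (x := e) (by omega) hk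
          (by push_cast; omega) (by omega)
        have hcv := hl.sliceSeq_coordPt (σ := σ) hn ⟨k, by omega⟩
        rw [coordPt, if_pos hk, if_pos hk, one_smul, slicePt_right h, h, ← hc] at hcv
        rw [hcv, sub_neg_eq_add, add_comm]
        exact isPosRoot_of_lt (Fin.lt_def.2 (by dsimp only; omega)) hκ'
      · exact ih (by omega) (by omega)
    · by_cases he : e = l k + n
      · obtain ⟨κ, hκ, hκ'⟩ := hl.sliceSeq_outer hn hσ (k := k + 1) (x := c) (by omega) hk
          (by push_cast; omega) (by omega)
        have hcv := hl.sliceSeq_coordPt (σ := σ) hn ⟨k, by omega⟩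
        have hev := sliceSeq_add (n := n) l σ (l (k + 1))
        rw [coordPt, if_pos hk, if_pos hk, one_smul, slicePt_left h] at hcv
        rw [hcv, neg_neg, show l (k + 1) + (n + 1) = e by omega] at hev
        rw [hev, sub_eq_add_neg]
        refine isPosRoot_of_lt (b := κ) (Fin.lt_def.2 (by dsimp only; omega)) ?_
        rw [neg_inj, neg_eq_iff_eq_neg]
        exact hκ'.symm
      · exact ih (by omega) (by omega)

/-- The segments in the window above a slice are positive roots. -/
theorem isPosRoot (hl : IsSlice n l) (hn : 1 ≤ n) (hσ : σ = 1 ∨ σ = -1) {k : ℕ}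
    (hk₁ : 1 ≤ k) (hk : k ≤ n) {c : ℤ} (h₁ : l k ≤ c) (h₂ : c < l k + (n + 1)) :
    IsPosRoot (sliceSeq n l σ (c + k) - sliceSeq n l σ c) := by
  have hsub := sliceSeq_add (n := n) l σ (c + k - (n + 1))
  rw [sub_add_cancel] at hsub
  by_cases hc : c < l k + k
  · obtain ⟨κ, hκ, hκ'⟩ := hl.sliceSeq_inner (σ := σ) hn hk₁ hk h₁ hc
    rw [hκ', sub_neg_eq_add, add_comm]
    by_cases he : c + k ≤ l k + n
    · obtain ⟨κ', hκ₁, hκ₁'⟩ := hl.sliceSeq_outer hn hσ hk₁ hk (x := c + k) (by omega) he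
      exact isPosRoot_of_lt (Fin.lt_def.2 (by omega)) hκ₁'
    · obtain ⟨κ', hκ₁, hκ₁'⟩ := hl.sliceSeq_inner (σ := σ) hn hk₁ hk (x := c + k - (n + 1))
        (by omega) (by omega)
      rw [hsub, hκ₁', neg_neg]
      refine isPosRoot_add ?_
      rintro rfl
      -- the two ends would be congruent modulo the antiperiod
      obtain ⟨L, hL⟩ := hl.exists_dual hn hσ (comb_add (N := n + 1) (by omega) c)
      have := congrArg L (hκ'.trans hκ₁'.symm)
      rw [hL, hL, comb_self, comb_of_near (by omega) (by omega) (by omega)] at this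
      omega
  · by_cases he : c + k ≤ l k + n
    · exact hl.isPosRoot_outer hn hσ hk₁ hk (by omega) (by omega) he
    · obtain ⟨κ, hκ, hκ'⟩ := hl.sliceSeq_outer hn hσ hk₁ hk (x := c) (by omega) (by omega)
      obtain ⟨κ', hκ₁, hκ₁'⟩ := hl.sliceSeq_inner (σ := σ) hn hk₁ hk (x := c + k - (n + 1))
        (by omega) (by omega)
      rw [hsub, hκ₁', neg_neg, sub_eq_add_neg]
      refine isPosRoot_of_lt (b := κ) (Fin.lt_def.2 (by omega)) ?_
      rw [neg_inj, neg_eq_iff_eq_neg]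
      exact hκ'.symm

/-- Signs are absorbed by moving an end by the antiperiod, so every combination `±f x ± f y` is the
boundary of a segment. -/
theorem exists_segment_aux {N : ℤ} {A : Type*} [AddCommGroup A] {f : ℤ → A}
    (hf : ∀ x, f (x + N) = -f x) {x y : ℤ} (hxy : x < y) (hN : y < x + N) {v : A}
    (hv : v = f y - f x ∨ v = f x - f y ∨ v = f x + f y ∨ v = -f x - f y) :
    ∃ c k, 0 < k ∧ k < N ∧ v = f (c + k) - f c := by
  have hf' : f (y - N) = -f y := by
    have := hf (y - N)
    rw [sub_add_cancel] at this
    rw [this, neg_neg]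
  rcases hv with rfl | rfl | rfl | rfl
  · exact ⟨x, y - x, by omega, by omega, by rw [add_sub_cancel]⟩
  · refine ⟨x + N, y - x, by omega, by omega, ?_⟩
    rw [show x + N + (y - x) = y + N by ring, hf, hf]; abel
  · refine ⟨y - N, x - (y - N), by omega, by omega, ?_⟩
    rw [add_sub_cancel, hf']; abel
  · refine ⟨y, x + N - y, by omega, by omega, ?_⟩
    rw [add_sub_cancel, hf]

/-- Every positive root is a segment in the window above the slice. -/
theorem exists_segment (hl : IsSlice n l) (hn : 1 ≤ n) (hσ : σ = 1 ∨ σ = -1) {v : Lat n}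
    (hv : IsPosRoot v) : ∃ (k : ℕ) (c : ℤ), 1 ≤ k ∧ k ≤ n ∧ l k ≤ c ∧ c < l k + (n + 1) ∧
      v = sliceSeq n l σ (c + k) - sliceSeq n l σ c := by
  have hε : ∀ κ : Fin (n + 1), eps κ = sliceSeq n l σ (coordPt n l κ) ∨
      eps κ = -sliceSeq n l σ (coordPt n l κ) := by
    intro κ
    rw [hl.sliceSeq_coordPt hn]
    split_ifs
    · simp
    · rcases hσ with rfl | rfl <;> simp
  obtain ⟨c, k, hk₁, hk, hvc⟩ : ∃ c k, 0 < k ∧ k < (n + 1 : ℤ) ∧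
      v = sliceSeq n l σ (c + k) - sliceSeq n l σ c := by
    obtain ⟨a, b, hab, hv⟩ := hv
    have hne := hl.coordPt_ne hab
    have ha := hl.coordPt_mem hn a
    have hb := hl.coordPt_mem hn b
    have hf := sliceSeq_add (n := n) l σ
    rcases lt_or_gt_of_ne hne with h | h
    · refine exists_segment_aux hf h (by omega) ?_
      rcases hε a with h₁ | h₁ <;> rcases hε b with h₂ | h₂ <;> rw [h₁, h₂] at hv <;>
        rcases hv with rfl | rfl
      all_goals first
        | (left; abel1) | (right; left; abel1)
        | (right; right; left; abel1) | (right; right; right; abel1)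
    · refine exists_segment_aux hf h (by omega) ?_
      rcases hε a with h₁ | h₁ <;> rcases hε b with h₂ | h₂ <;> rw [h₁, h₂] at hv <;>
        rcases hv with rfl | rfl
      all_goals first
        | (left; abel1) | (right; left; abel1)
        | (right; right; left; abel1) | (right; right; right; abel1)
  lift k to ℕ using hk₁.le
  -- The multiple of the antiperiod that brings the left end into `[l k, l k + n + 1)`.
  refine ⟨k, c + -((c - l k) / (n + 1)) * (n + 1), by omega, by omega, ?_⟩
  have h₁ := Int.emod_nonneg (c - l k) (b := n + 1) (by omega)
  have h₂ := Int.emod_lt_of_pos (c - l k) (b := n + 1) (by omega)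
  have h₃ := Int.emod_add_mul_ediv (c - l k) (n + 1)
  set r := (c - l k) / (n + 1) with hr
  have h₄ : -r * (n + 1) = -((n + 1) * r) := by ring
  have k₁ : l k ≤ c + -r * (n + 1) := by rw [h₄]; omega
  have k₂ : c + -r * (n + 1) < l k + (n + 1) := by rw [h₄]; omega
  have hpos := hl.isPosRoot hn hσ (by omega) (by omega) k₁ k₂
  refine ⟨k₁, k₂, ?_⟩
  rw [add_right_comm] at hpos ⊢
  -- If the shift changed the sign, both `v` and `-v` would be positive.
  rcases antiperiodic_mul (sliceSeq_add (n := n) l σ) (-r) with h | h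
  · rw [h, h, hvc]
  · rw [h, h, neg_sub_neg, ← neg_sub, ← hvc] at hpos
    exact absurd hpos hv.not_neg

/-- Two segments in the window above the slice that give the same root are equal. -/
theorem segment_inj (hl : IsSlice n l) (hn : 1 ≤ n) (hσ : σ = 1 ∨ σ = -1) {k k' : ℕ} {c c' : ℤ}
    (hk₁ : 1 ≤ k) (hk : k ≤ n) (h₁ : l k ≤ c) (h₂ : c < l k + (n + 1))
    (hk₁' : 1 ≤ k') (hk' : k' ≤ n) (h₁' : l k' ≤ c') (h₂' : c' < l k' + (n + 1))
    (h : sliceSeq n l σ (c + k) - sliceSeq n l σ c =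
      sliceSeq n l σ (c' + k') - sliceSeq n l σ c') : c = c' ∧ k = k' := by
  have hlip : (l k' ≤ l k ∧ l k + k ≤ l k' + k') ∨ (l k ≤ l k' ∧ l k' + k' ≤ l k + k) := by
    rcases le_total k k' with hle | hle
    · exact .inl (hl.lipschitz hk₁ hle hk')
    · exact .inr (hl.lipschitz hk₁' hle hk)
  have hN : (0 : ℤ) < n + 1 := by omega
  have key : ∀ x, comb (n + 1) x (c + k) - comb (n + 1) x c =
      comb (n + 1) x (c' + k') - comb (n + 1) x c' := by
    intro x
    obtain ⟨L, hL⟩ := hl.exists_dual (σ := σ) hn hσ (comb_add hN x)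
    have := congrArg L h
    rwa [map_sub, map_sub, hL, hL, hL, hL] at this
  have k₁ := key c
  have k₂ := key (c + k)
  rw [comb_self, comb_of_near (m := c + k) (by omega) (by omega) (by omega)] at k₁
  rw [comb_self, comb_of_near (m := c) (by omega) (by omega) (by omega)] at k₂
  have q1 := comb_cases (N := n + 1) (x := c) (m := c') (by omega) (by omega)
  have q2 := comb_cases (N := n + 1) (x := c) (m := c' + k') (by omega) (by omega)
  have q3 := comb_cases (N := n + 1) (x := c + k) (m := c') (by omega) (by omega)
  have q4 := comb_cases (N := n + 1) (x := c + k) (m := c' + k') (by omega) (by omega)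
  omega

end IsSlice
/-! ### Simple reflections -/

section Reflections

variable {n : ℕ}

theorem refl_apply (i : Fin (n + 1)) (v : Lat n) :
    refl i v = v - (v ⬝ᵥ simpleRoot i) • simpleRoot i := rfl

theorem simpleRoot_of_lt {i : Fin (n + 1)} (h : i.val < n) :
    simpleRoot i = eps i - eps ⟨i.val + 1, by omega⟩ := dif_pos h

theorem simpleRoot_of_eq {i : Fin (n + 1)} (h : i.val = n) :
    simpleRoot i = eps ⟨n - 1, by omega⟩ + eps i := dif_neg (by omega)

theorem eps_dotProduct (a b : Fin (n + 1)) : eps a ⬝ᵥ eps b = if a = b then 1 else 0 := by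
  rw [eps, eps, single_dotProduct, one_mul, Pi.single_apply]

theorem bar_of_lt {i : Fin (n + 1)} (h : i.val < n) : bar i = i.val + 1 := by
  unfold bar; omega

theorem bar_of_eq {i : Fin (n + 1)} (h : i.val = n) : bar i = n := by
  unfold bar; omega

theorem one_le_bar (hn : 1 ≤ n) (i : Fin (n + 1)) : 1 ≤ bar i := by
  unfold bar; omega

theorem bar_le (i : Fin (n + 1)) : bar i ≤ n := min_le_right _ _

/-- Two vertices are dependent if they are equal or adjacent in the Dynkin diagram. -/
def Dep (i j : Fin (n + 1)) : Prop := i = j ∨ bar i + 1 = bar j ∨ bar j + 1 = bar i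

theorem Dep.symm {i j : Fin (n + 1)} (h : Dep i j) : Dep j i := by
  unfold Dep at *; tauto

theorem simpleRoot_dotProduct (hn : 2 ≤ n) (i j : Fin (n + 1)) :
    simpleRoot i ⬝ᵥ simpleRoot j =
      if i = j then 2 else if bar i + 1 = bar j ∨ bar j + 1 = bar i then -1 else 0 := by
  rcases i with ⟨i, hi⟩
  rcases j with ⟨j, hj⟩
  by_cases h₁ : i < n <;> by_cases h₂ : j < n
  · rw [simpleRoot_of_lt h₁, simpleRoot_of_lt h₂, bar_of_lt h₁, bar_of_lt h₂]
    simp only [sub_dotProduct, dotProduct_sub, eps_dotProduct, Fin.mk.injEq]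
    split_ifs <;> omega
  · rw [simpleRoot_of_lt h₁, simpleRoot_of_eq (by dsimp only; omega), bar_of_lt h₁,
      bar_of_eq (by dsimp only; omega)]
    simp only [sub_dotProduct, dotProduct_add, eps_dotProduct, Fin.mk.injEq]
    split_ifs <;> omega
  · rw [simpleRoot_of_lt (i := ⟨j, hj⟩) h₂, simpleRoot_of_eq (by dsimp only; omega),
      bar_of_lt (i := ⟨j, hj⟩) h₂, bar_of_eq (by dsimp only; omega)]
    simp only [add_dotProduct, dotProduct_sub, eps_dotProduct, Fin.mk.injEq]
    split_ifs <;> omega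
  · rw [simpleRoot_of_eq (by dsimp only; omega), simpleRoot_of_eq (by dsimp only; omega),
      bar_of_eq (by dsimp only; omega), bar_of_eq (by dsimp only; omega)]
    simp only [add_dotProduct, dotProduct_add, eps_dotProduct, Fin.mk.injEq]
    split_ifs <;> omega

theorem dotProduct_of_not_dep (hn : 2 ≤ n) {i j : Fin (n + 1)} (h : ¬ Dep i j) :
    simpleRoot i ⬝ᵥ simpleRoot j = 0 := by
  unfold Dep at h
  rw [simpleRoot_dotProduct hn, if_neg (by tauto), if_neg (by tauto)]

theorem refl_of_not_dep (hn : 2 ≤ n) {i j : Fin (n + 1)} (h : ¬ Dep i j) :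
    refl i (simpleRoot j) = simpleRoot j := by
  rw [refl_apply, dotProduct_of_not_dep hn fun h' => h h'.symm, zero_smul, sub_zero]

theorem commute_of_not_dep (hn : 2 ≤ n) {i j : Fin (n + 1)} (h : ¬ Dep i j) :
    Commute (refl i) (refl j) := by
  have h₁ := dotProduct_of_not_dep hn h
  have h₂ := dotProduct_of_not_dep hn fun h' => h h'.symm
  refine LinearMap.ext fun v => ?_
  simp only [Module.End.mul_apply, refl_apply, sub_dotProduct, smul_dotProduct, h₁, h₂,
    smul_zero, sub_zero]
  abel

/-- For adjacent vertices `s_i s_j (α_j)` and `s_j s_i (α_j)` pair with `α_i` to `-1` and `2`. -/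
theorem not_dep_of_commute (hn : 2 ≤ n) {i j : Fin (n + 1)} (hne : i ≠ j)
    (h : Commute (refl i) (refl j)) : ¬ Dep i j := by
  intro hd
  have hij : simpleRoot i ⬝ᵥ simpleRoot j = -1 := by
    unfold Dep at hd
    rw [simpleRoot_dotProduct hn, if_neg hne, if_pos (by tauto)]
  have hii : simpleRoot i ⬝ᵥ simpleRoot i = 2 := by rw [simpleRoot_dotProduct hn, if_pos rfl]
  have hjj : simpleRoot j ⬝ᵥ simpleRoot j = 2 := by rw [simpleRoot_dotProduct hn, if_pos rfl]
  have hji : simpleRoot j ⬝ᵥ simpleRoot i = -1 := by rw [dotProduct_comm, hij]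
  have := congrArg (fun v : Lat n => v ⬝ᵥ simpleRoot i) (LinearMap.congr_fun h (simpleRoot j))
  simp only [Module.End.mul_apply, refl_apply, sub_dotProduct, smul_dotProduct, hij, hji, hii,
    hjj, smul_eq_mul] at this
  omega

theorem eps_dotProduct_simpleRoot_of_lt {i : Fin (n + 1)} (h : i.val < n) (κ : Fin (n + 1)) :
    eps κ ⬝ᵥ simpleRoot i = (if κ = i then 1 else 0) - if κ.val = i.val + 1 then 1 else 0 := by
  rw [simpleRoot_of_lt h, dotProduct_sub, eps_dotProduct, eps_dotProduct]
  simp only [Fin.ext_iff]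

theorem refl_eps_left {i : Fin (n + 1)} (h : i.val < n) :
    refl i (eps i) = eps ⟨i.val + 1, by omega⟩ := by
  rw [refl_apply, eps_dotProduct_simpleRoot_of_lt h, if_pos rfl, if_neg (by omega), sub_zero,
    one_smul, simpleRoot_of_lt h]
  abel

theorem refl_eps_right {i : Fin (n + 1)} (h : i.val < n) :
    refl i (eps ⟨i.val + 1, by omega⟩) = eps i := by
  rw [refl_apply, eps_dotProduct_simpleRoot_of_lt h, if_neg (by simp [Fin.ext_iff]), if_pos rfl,
    zero_sub, neg_smul, one_smul, simpleRoot_of_lt h]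
  abel

theorem refl_eps_of_ne {i : Fin (n + 1)} (h : i.val < n) {κ : Fin (n + 1)} (h₁ : κ ≠ i)
    (h₂ : κ.val ≠ i.val + 1) : refl i (eps κ) = eps κ := by
  rw [refl_apply, eps_dotProduct_simpleRoot_of_lt h, if_neg h₁, if_neg h₂, sub_zero, zero_smul,
    sub_zero]

theorem eps_dotProduct_simpleRoot_last {i : Fin (n + 1)} (h : i.val = n) (κ : Fin (n + 1)) :
    eps κ ⬝ᵥ simpleRoot i = (if κ.val = n - 1 then 1 else 0) + if κ = i then 1 else 0 := by
  rw [simpleRoot_of_eq h, dotProduct_add, eps_dotProduct, eps_dotProduct]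
  simp only [Fin.ext_iff]

theorem refl_last_eps_left (hn : 1 ≤ n) {i : Fin (n + 1)} (h : i.val = n) :
    refl i (eps ⟨n - 1, by omega⟩) = -eps i := by
  rw [refl_apply, eps_dotProduct_simpleRoot_last h, if_pos rfl,
    if_neg (by rw [Fin.ext_iff]; dsimp only; omega), add_zero, one_smul, simpleRoot_of_eq h]
  abel

theorem refl_last_eps_right (hn : 1 ≤ n) {i : Fin (n + 1)} (h : i.val = n) :
    refl i (eps i) = -eps ⟨n - 1, by omega⟩ := by
  rw [refl_apply, eps_dotProduct_simpleRoot_last h, if_neg (by omega), if_pos rfl, zero_add,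
    one_smul, simpleRoot_of_eq h]
  abel

theorem refl_last_eps_of_lt {i : Fin (n + 1)} (h : i.val = n) {κ : Fin (n + 1)}
    (hκ : κ.val < n - 1) : refl i (eps κ) = eps κ := by
  rw [refl_apply, eps_dotProduct_simpleRoot_last h, if_neg (by omega),
    if_neg (by rw [Fin.ext_iff]; omega), zero_add, zero_smul, sub_zero]

end Reflections

/-! ### Reading a word along slices -/

section Walk

variable {n : ℕ}

/-- The column `k` may be moved up in the slice `l`. -/
def IsSource (n : ℕ) (l : ℕ → ℤ) (k : ℕ) : Prop :=
  (2 ≤ k → l (k - 1) = l k + 1) ∧ (k < n → l (k + 1) = l k)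

/-- Moving up the column `k`. -/
def bump (l : ℕ → ℤ) (k : ℕ) : ℕ → ℤ := Function.update l k (l k + 1)

theorem bump_self (l : ℕ → ℤ) (k : ℕ) : bump l k k = l k + 1 := Function.update_self ..

theorem bump_of_ne (l : ℕ → ℤ) {j k : ℕ} (h : j ≠ k) : bump l k j = l j :=
  Function.update_of_ne h ..

/-- The sign `σ` tells which vertex of the last orbit is next. -/
def SignOK (σ : ℤ) (i : Fin (n + 1)) : Prop :=
  (i.val + 1 = n → σ = 1) ∧ (i.val = n → σ = -1)

/-- The sign after the letter `i`. -/
def nextSign (σ : ℤ) (i : Fin (n + 1)) : ℤ := if bar i = n then -σ else σ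

/-- The word moves up the slice `l`, one source after the other. -/
def Walk : (ℕ → ℤ) → ℤ → List (Fin (n + 1)) → Prop
  | _, _, [] => True
  | l, σ, i :: w => IsSource n l (bar i) ∧ SignOK σ i ∧ Walk (bump l (bar i)) (nextSign σ i) w

/-- The slice at the end of a word. -/
def endSlice (l : ℕ → ℤ) (w : List (Fin (n + 1))) : ℕ → ℤ := w.foldl (fun l i => bump l (bar i)) l

/-- The sign at the end of a word. -/
def endSign (σ : ℤ) (w : List (Fin (n + 1))) : ℤ := w.foldl nextSign σ

/-- The letters of a word with the left ends of the segments that they pass. -/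
def tags : (ℕ → ℤ) → List (Fin (n + 1)) → List (Fin (n + 1) × ℤ)
  | _, [] => []
  | l, i :: w => (i, l (bar i)) :: tags (bump l (bar i)) w

theorem walk_append {l : ℕ → ℤ} {σ : ℤ} {w w' : List (Fin (n + 1))} :
    Walk l σ (w ++ w') ↔ Walk l σ w ∧ Walk (endSlice l w) (endSign σ w) w' := by
  induction w generalizing l σ with
  | nil => simp [Walk, endSlice, endSign]
  | cons i w ih =>
    simp only [List.cons_append, Walk, ih, endSlice, endSign, List.foldl_cons, and_assoc]

theorem endSlice_apply (l : ℕ → ℤ) (w : List (Fin (n + 1))) (k : ℕ) :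
    endSlice l w k = l k + (w.map bar).count k := by
  induction w generalizing l with
  | nil => simp [endSlice]
  | cons i w ih =>
    have := ih (bump l (bar i))
    rw [endSlice] at this ⊢
    rw [List.foldl_cons, this, List.map_cons, List.count_cons]
    by_cases h : bar i = k
    · subst h
      rw [bump_self, beq_self_eq_true, if_pos rfl]
      push_cast
      ring
    · rw [bump_of_ne l (Ne.symm h), if_neg (by simpa using h), add_zero]

theorem le_of_mem_tags {l : ℕ → ℤ} {w : List (Fin (n + 1))} {s : Fin (n + 1) × ℤ}
    (hs : s ∈ tags l w) : l (bar s.1) ≤ s.2 ∧ s.2 < endSlice l w (bar s.1) := by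
  induction w generalizing l with
  | nil => simp [tags] at hs
  | cons i w ih =>
    rw [endSlice_apply, List.map_cons, List.count_cons]
    rw [tags, List.mem_cons] at hs
    rcases hs with rfl | hs
    · simp only [beq_self_eq_true, if_true]
      push_cast
      omega
    · have := ih hs
      rw [endSlice_apply] at this
      by_cases h : bar i = bar s.1
      · rw [← h, bump_self] at this
        rw [← h, beq_self_eq_true, if_pos rfl]
        push_cast
        omega
      · rw [bump_of_ne l (Ne.symm h)] at this
        rw [if_neg (by simpa using h), add_zero]
        exact this

theorem exists_mem_tags {l : ℕ → ℤ} {w : List (Fin (n + 1))} {k : ℕ} {x : ℤ} (h₁ : l k ≤ x)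
    (h₂ : x < endSlice l w k) : ∃ i, bar i = k ∧ (i, x) ∈ tags l w := by
  induction w generalizing l with
  | nil => simp [endSlice] at h₂; omega
  | cons i w ih =>
    have h₂' : x < endSlice (bump l (bar i)) w k := h₂
    by_cases h : bar i = k
    · by_cases hx : x = l k
      · exact ⟨i, h, by rw [tags, h, hx]; exact List.mem_cons_self⟩
      · obtain ⟨j, hj, hj'⟩ := ih (l := bump l (bar i)) (by rw [h, bump_self]; omega) h₂'
        exact ⟨j, hj, List.mem_cons_of_mem _ hj'⟩
    · obtain ⟨j, hj, hj'⟩ := ih (l := bump l (bar i)) (by rwa [bump_of_ne l (Ne.symm h)]) h₂'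
      exact ⟨j, hj, List.mem_cons_of_mem _ hj'⟩

/-- When a source is passed, its neighbours stand exactly one position above on the left and level
on the right, and columns only move up. Hence both ends of the segments grow weakly along dependent
letters. -/
theorem pairwise_tags (hn : 1 ≤ n) {l : ℕ → ℤ} {σ : ℤ} {w : List (Fin (n + 1))}
    (hw : Walk l σ w) :
    (tags l w).Pairwise fun s t => (bar s.1 = bar t.1 → s.2 < t.2) ∧
      (bar s.1 + 1 = bar t.1 → s.2 ≤ t.2) ∧ (bar t.1 + 1 = bar s.1 → s.2 + 1 ≤ t.2) := by
  induction w generalizing l σ with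
  | nil => exact List.Pairwise.nil
  | cons i w ih =>
    obtain ⟨⟨h₁, h₂⟩, -, hw⟩ := hw
    refine List.Pairwise.cons (fun t ht => ?_) (ih hw)
    have h := (le_of_mem_tags ht).1
    have hb := one_le_bar hn t.1
    have hb' := bar_le t.1
    dsimp only
    refine ⟨fun he => ?_, fun he => ?_, fun he => ?_⟩
    · rw [he, bump_self] at h
      rw [he]
      omega
    · rw [← he, bump_of_ne l (by omega), h₂ (by omega)] at h
      exact h
    · rw [← he, bump_of_ne l (by omega)] at h
      have := h₁ (by omega)
      rw [← he, Nat.add_sub_cancel] at this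
      rw [← he]
      omega

/-- The letters of a word with the roots `u s_{i_1} ⋯ s_{i_{k-1}}(α_{i_k})`. -/
def rootList : Module.End ℤ (Lat n) → List (Fin (n + 1)) → List (Fin (n + 1) × Lat n)
  | _, [] => []
  | u, i :: w => (i, u (simpleRoot i)) :: rootList (u * refl i) w

/-- The Weyl group element `u` corresponds to the slice `l` with respect to the sequence `f`. -/
structure Fits (f : ℤ → Lat n) (l : ℕ → ℤ) (σ : ℤ) (u : Module.End ℤ (Lat n)) : Prop where
  eps_of_lt : ∀ κ : Fin (n + 1), κ.val < n → u (eps κ) = -f (slicePt l (κ.val + 1))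
  eps_last : ∀ κ : Fin (n + 1), κ.val = n → u (eps κ) = -(σ • f (l n + n))

theorem slicePt_bump_of_ne (l : ℕ → ℤ) {j k : ℕ} (h₁ : j ≠ k) (h₂ : j ≠ k + 1) (hj : 1 ≤ j) :
    slicePt (bump l k) j = slicePt l j := by
  rw [slicePt, slicePt, bump_of_ne l h₁, bump_of_ne l (by omega)]

theorem slicePt_of_isSource {l : ℕ → ℤ} {k : ℕ} (hk : 1 ≤ k) (h : IsSource n l k) :
    slicePt l k = l k := by
  by_cases h₁ : k = 1
  · rw [h₁, slicePt_one]
  · have := h.1 (by omega)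
    rw [slicePt, if_pos (by omega)]

theorem slicePt_bump_self {l : ℕ → ℤ} {k : ℕ} (hk : 1 ≤ k) (h : IsSource n l k) :
    slicePt (bump l k) k = l k + k := by
  by_cases h₁ : k = 1
  · rw [h₁, slicePt_one, bump_self]; simp
  · have := h.1 (by omega)
    rw [slicePt, bump_self, bump_of_ne l (by omega), if_neg (by omega)]
    ring

theorem slicePt_bump_succ {l : ℕ → ℤ} {k : ℕ} (h : l (k + 1) = l k) :
    slicePt (bump l k) (k + 1) = l k := by
  rw [slicePt, Nat.add_sub_cancel, bump_self, bump_of_ne l (by omega), if_pos (by omega), h]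

/-- At a source the point of column `k` is `l k`, and the other coordinate moved by the reflection
sits at `l k + k`. Up to the signs of the last coordinate, the reflection exchanges the two points,
which is the effect of raising the column. In the last orbit `σ` selects `ε_n - ε_{n+1}` or `ε_n +
ε_{n+1}`, and the new last point is one antiperiod above `l n`, so `σ` flips. -/
theorem Fits.step (hn : 1 ≤ n) {f : ℤ → Lat n} (hf : ∀ x, f (x + (n + 1)) = -f x) {l : ℕ → ℤ}
    {σ : ℤ} {u : Module.End ℤ (Lat n)} (hu : Fits f l σ u) {i : Fin (n + 1)}
    (hi : IsSource n l (bar i)) (hσ : SignOK σ i) :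
    u (simpleRoot i) = f (l (bar i) + bar i) - f (l (bar i)) ∧
      Fits f (bump l (bar i)) (nextSign σ i) (u * refl i) := by
  obtain ⟨h₁, h₂⟩ := hu
  have hpt := slicePt_of_isSource (one_le_bar hn i) hi
  have hpt' := slicePt_bump_self (one_le_bar hn i) hi
  by_cases hin : i.val < n
  · have hb := bar_of_lt hin
    have hui : u (eps i) = -f (l (bar i)) := by rw [h₁ i hin, ← hb, hpt]
    have hui' : u (eps ⟨i.val + 1, by omega⟩) = -f (l (bar i) + bar i) := by
      by_cases hi' : i.val + 1 < n
      · rw [h₁ _ hi']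
        dsimp only
        rw [← hb, slicePt_right (hi.2 (by omega)), hi.2 (by omega)]
      · rw [h₂ _ (by dsimp only; omega), hσ.1 (by omega), one_smul, hb,
          show i.val + 1 = n by omega]
    refine ⟨by rw [simpleRoot_of_lt hin, map_sub, hui, hui']; abel, fun κ hκ => ?_,
      fun κ hκ => ?_⟩
    · rw [Module.End.mul_apply]
      by_cases hκi : κ = i
      · subst hκi
        rw [refl_eps_left hin, hui', ← hb, hpt']
      by_cases hκi' : κ.val = i.val + 1
      · obtain rfl : κ = ⟨i.val + 1, by clear * - hin; omega⟩ := Fin.ext hκi'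
        rw [refl_eps_right hin, hui]
        dsimp only
        rw [← hb, slicePt_bump_succ (hi.2 (by omega))]
      · rw [refl_eps_of_ne hin hκi hκi', h₁ κ hκ, slicePt_bump_of_ne l _ (by omega) (by omega)]
        rw [hb]
        exact fun h => hκi (Fin.ext (by omega))
    · rw [Module.End.mul_apply, nextSign]
      by_cases hκi' : κ.val = i.val + 1
      · obtain rfl : κ = ⟨i.val + 1, by clear * - hin; omega⟩ := Fin.ext hκi'
        have hbn : bar i = n := by rw [hb]; exact hκ
        rw [refl_eps_right hin, hui, if_pos hbn, hbn, bump_self, hσ.1 hκ,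
          show l n + 1 + (n : ℤ) = l n + (n + 1) by ring, hf]
        simp
      · rw [refl_eps_of_ne hin (by rintro rfl; omega) hκi', h₂ κ hκ, if_neg (by omega),
          bump_of_ne l (by omega)]
  · have hin : i.val = n := by omega
    have hb := bar_of_eq hin
    rw [hb] at hpt hpt' hi ⊢
    have hui : u (eps ⟨n - 1, by omega⟩) = -f (l n) := by
      rw [h₁ _ (by dsimp only; omega)]
      dsimp only
      rw [Nat.sub_add_cancel hn, hpt]
    have hui' : u (eps i) = f (l n + n) := by
      rw [h₂ i hin, hσ.2 hin]
      simp
    refine ⟨by rw [simpleRoot_of_eq hin, map_add, hui, hui']; abel, fun κ hκ => ?_,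
      fun κ hκ => ?_⟩
    · rw [Module.End.mul_apply]
      by_cases hκi : κ.val = n - 1
      · obtain rfl : κ = ⟨n - 1, by clear * -; omega⟩ := Fin.ext hκi
        rw [refl_last_eps_left hn hin, map_neg, hui']
        dsimp only
        rw [Nat.sub_add_cancel hn, hpt']
      · rw [refl_last_eps_of_lt hin (by omega), h₁ κ hκ,
          slicePt_bump_of_ne l (by omega) (by omega) (by omega)]
    · obtain rfl : κ = i := Fin.ext (by omega)
      rw [Module.End.mul_apply, refl_last_eps_right hn hin, map_neg, hui, nextSign, if_pos hb,
        bump_self, hσ.2 hin, show l n + 1 + (n : ℤ) = l n + (n + 1) by ring, hf]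
      simp

theorem wordMap_cons (i : Fin (n + 1)) (w : List (Fin (n + 1))) :
    wordMap (i :: w) = refl i * wordMap w := by
  simp [wordMap]

theorem wordMap_append (w w' : List (Fin (n + 1))) :
    wordMap (w ++ w') = wordMap w * wordMap w' := by
  simp [wordMap]

theorem Fits.walk (hn : 1 ≤ n) {f : ℤ → Lat n} (hf : ∀ x, f (x + (n + 1)) = -f x) {l : ℕ → ℤ}
    {σ : ℤ} {u : Module.End ℤ (Lat n)} (hu : Fits f l σ u) {w : List (Fin (n + 1))}
    (hw : Walk l σ w) :
    rootList u w = (tags l w).map (fun s => (s.1, f (s.2 + bar s.1) - f s.2)) ∧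
      Fits f (endSlice l w) (endSign σ w) (u * wordMap w) := by
  induction w generalizing l σ u with
  | nil => exact ⟨rfl, by simpa [wordMap, endSlice, endSign] using hu⟩
  | cons i w ih =>
    obtain ⟨h₁, h₂, hw⟩ := hw
    obtain ⟨k₁, k₂⟩ := hu.step hn hf h₁ h₂
    obtain ⟨k₃, k₄⟩ := ih k₂ hw
    refine ⟨by rw [rootList, tags, List.map_cons, k₁, k₃], ?_⟩
    rw [wordMap_cons, ← mul_assoc]
    exact k₄

theorem rootList_append (u : Module.End ℤ (Lat n)) (w w' : List (Fin (n + 1))) :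
    rootList u (w ++ w') = rootList u w ++ rootList (u * wordMap w) w' := by
  induction w generalizing u with
  | nil => simp [rootList, wordMap]
  | cons i w ih => rw [List.cons_append, rootList, rootList, ih, wordMap_cons, mul_assoc]; rfl

theorem map_fst_rootList (u : Module.End ℤ (Lat n)) (w : List (Fin (n + 1))) :
    (rootList u w).map Prod.fst = w := by
  induction w generalizing u with
  | nil => rfl
  | cons i w ih => rw [rootList, List.map_cons, ih]

theorem length_rootList (u : Module.End ℤ (Lat n)) (w : List (Fin (n + 1))) :
    (rootList u w).length = w.length := by
  rw [← List.length_map (f := Prod.fst), map_fst_rootList]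

theorem rootList_getElem (u : Module.End ℤ (Lat n)) (w : List (Fin (n + 1))) (k : ℕ)
    (hk : k < w.length) :
    (rootList u w)[k]'(by rwa [length_rootList]) =
      (w[k], u (wordMap (w.take k) (simpleRoot w[k]))) := by
  induction w generalizing u k with
  | nil => simp at hk
  | cons i w ih =>
    cases k with
    | zero => simp [rootList, wordMap]
    | succ k =>
      have := ih (u * refl i) k (by simpa using hk)
      simp only [rootList, List.getElem_cons_succ, this, List.take_succ_cons, wordMap_cons,
        Module.End.mul_apply]

theorem rootList_one_getElem (w : List (Fin (n + 1))) (k : Fin w.length) :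
    (rootList 1 w)[k.val]'(by rw [length_rootList]; exact k.2) = (w.get k, rootAt w k) := by
  rw [rootList_getElem _ _ _ k.2]
  rfl

end Walk
/-! ### Commutation classes -/

section Commutation

variable {n : ℕ}

/-- Interchange of two neighbouring independent letters in a list of letters and roots. -/
def SwapStep (T T' : List (Fin (n + 1) × Lat n)) : Prop :=
  ∃ A B x y, ¬ Dep x.1 y.1 ∧ T = A ++ x :: y :: B ∧ T' = A ++ y :: x :: B

theorem rootList_swap (hn : 2 ≤ n) (u : Module.End ℤ (Lat n)) (a b : List (Fin (n + 1)))
    {i j : Fin (n + 1)} (h : ¬ Dep i j) :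
    ∃ v v' R, rootList u (a ++ i :: j :: b) = rootList u a ++ (i, v) :: (j, v') :: R ∧
      rootList u (a ++ j :: i :: b) = rootList u a ++ (j, v') :: (i, v) :: R := by
  refine ⟨(u * wordMap a) (simpleRoot i), (u * wordMap a) (simpleRoot j),
    rootList (u * wordMap a * refl i * refl j) b, ?_, ?_⟩
  · rw [rootList_append, rootList, rootList, Module.End.mul_apply _ (refl i),
      refl_of_not_dep hn h]
  · rw [rootList_append, rootList, rootList, Module.End.mul_apply _ (refl j),
      refl_of_not_dep hn fun h' => h h'.symm, mul_assoc _ (refl j),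
      (commute_of_not_dep hn h).symm, mul_assoc _ (refl i)]

theorem swapStep_of_commStep (hn : 2 ≤ n) {w w' : List (Fin (n + 1))} (h : CommStep w w') :
    w = w' ∨ SwapStep (rootList 1 w) (rootList 1 w') := by
  obtain ⟨a, b, i, j, hij, rfl, rfl⟩ := h
  by_cases hne : i = j
  · exact .inl (by rw [hne])
  · have hd := not_dep_of_commute hn hne hij
    obtain ⟨v, v', R, h₁, h₂⟩ := rootList_swap hn 1 a b hd
    exact .inr ⟨_, _, _, _, hd, h₁, h₂⟩

theorem exists_commStep_of_swapStep (hn : 2 ≤ n) {w : List (Fin (n + 1))}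
    {T : List (Fin (n + 1) × Lat n)} (h : SwapStep (rootList 1 w) T) :
    ∃ w', CommStep w w' ∧ rootList 1 w' = T := by
  obtain ⟨A, B, x, y, hd, h₁, rfl⟩ := h
  have hw := map_fst_rootList 1 w
  rw [h₁, List.map_append, List.map_cons, List.map_cons] at hw
  subst hw
  refine ⟨A.map Prod.fst ++ y.1 :: x.1 :: B.map Prod.fst,
    ⟨_, _, _, _, commute_of_not_dep hn hd, rfl, rfl⟩, ?_⟩
  obtain ⟨v, v', R, h₂, h₃⟩ := rootList_swap hn 1 (A.map Prod.fst) (B.map Prod.fst) hd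
  rw [h₂] at h₁
  obtain ⟨k₁, k₂⟩ := List.append_inj h₁ (by rw [length_rootList, List.length_map])
  obtain ⟨hx, k₂⟩ := List.cons.inj k₂
  obtain ⟨hy, hR⟩ := List.cons.inj k₂
  rw [h₃, k₁, hx, hy, hR]

theorem exists_commEquiv_of_swap (hn : 2 ≤ n) {w : List (Fin (n + 1))}
    {T : List (Fin (n + 1) × Lat n)} (h : Relation.ReflTransGen SwapStep (rootList 1 w) T) :
    ∃ w', CommEquiv w w' ∧ rootList 1 w' = T := by
  induction h with
  | refl => exact ⟨w, .refl w, rfl⟩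
  | tail _ h ih =>
    obtain ⟨w₁, hw₁, rfl⟩ := ih
    obtain ⟨w₂, hw₂, h'⟩ := exists_commStep_of_swapStep hn h
    exact ⟨w₂, hw₁.trans _ _ _ (.rel _ _ hw₂), h'⟩

theorem SwapStep.perm {T T' : List (Fin (n + 1) × Lat n)} (h : SwapStep T T') : T.Perm T' := by
  obtain ⟨A, B, x, y, -, rfl, rfl⟩ := h
  exact (List.Perm.swap _ _ _).append_left _

theorem SwapStep.pairwise {T T' : List (Fin (n + 1) × Lat n)} (h : SwapStep T T')
    {R : Lat n → Lat n → Prop} (hT : T.Pairwise fun x y => Dep x.1 y.1 → R x.2 y.2) :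
    T'.Pairwise fun x y => Dep x.1 y.1 → R x.2 y.2 := by
  obtain ⟨A, B, x, y, hd, rfl, rfl⟩ := h
  simp only [List.pairwise_append, List.pairwise_cons, List.mem_cons, forall_eq_or_imp] at hT ⊢
  obtain ⟨h₁, ⟨⟨-, h₂⟩, h₃, h₄⟩, h₅⟩ := hT
  exact ⟨h₁, ⟨⟨fun h => absurd h.symm hd, h₃⟩, h₂, h₄⟩,
    fun a ha => ⟨(h₅ a ha).2.1, (h₅ a ha).1, (h₅ a ha).2.2⟩⟩

theorem SwapStep.symm {T T' : List (Fin (n + 1) × Lat n)} (h : SwapStep T T') : SwapStep T' T := by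
  obtain ⟨A, B, x, y, hd, rfl, rfl⟩ := h
  exact ⟨A, B, y, x, fun h => hd h.symm, rfl, rfl⟩

/-- A letter moves together with its root, because an independent reflection fixes the neighbouring
simple root. So the letter-root pairs and the relative order of dependent ones are invariants of the
class. -/
theorem CommEquiv.rootList (hn : 2 ≤ n) {w w' : List (Fin (n + 1))} (h : CommEquiv w w') :
    (rootList 1 w).Perm (rootList 1 w') ∧ ∀ R : Lat n → Lat n → Prop,
      (TwistedD.rootList 1 w).Pairwise (fun x y => Dep x.1 y.1 → R x.2 y.2) ↔
        (TwistedD.rootList 1 w').Pairwise fun x y => Dep x.1 y.1 → R x.2 y.2 := by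
  induction h with
  | rel x y h =>
    rcases swapStep_of_commStep hn h with rfl | h
    · exact ⟨.refl _, fun _ => Iff.rfl⟩
    · exact ⟨h.perm, fun _ => ⟨h.pairwise, h.symm.pairwise⟩⟩
  | refl => exact ⟨.refl _, fun _ => Iff.rfl⟩
  | symm _ _ _ ih => exact ⟨ih.1.symm, fun R => (ih.2 R).symm⟩
  | trans _ _ _ _ _ ih₁ ih₂ => exact ⟨ih₁.1.trans ih₂.1, fun R => (ih₁.2 R).trans (ih₂.2 R)⟩

/-! ### Rearranging a word within its commutation class. -/

theorem swap_append_left {T T' : List (Fin (n + 1) × Lat n)} (A : List (Fin (n + 1) × Lat n))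
    (h : Relation.ReflTransGen SwapStep T T') :
    Relation.ReflTransGen SwapStep (A ++ T) (A ++ T') := by
  induction h with
  | refl => exact .refl
  | tail _ h ih =>
    obtain ⟨C, D, x, y, hd, rfl, rfl⟩ := h
    exact ih.tail ⟨A ++ C, D, x, y, hd, by simp, by simp⟩

theorem swap_move_left {U : List (Fin (n + 1) × Lat n)} {y : Fin (n + 1) × Lat n}
    (h : ∀ x ∈ U, ¬ Dep x.1 y.1) (B : List (Fin (n + 1) × Lat n)) :
    Relation.ReflTransGen SwapStep (U ++ y :: B) (y :: U ++ B) := by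
  induction U with
  | nil => exact .refl
  | cons x U ih =>
    have := swap_append_left [x] (ih fun z hz => h z (List.mem_cons_of_mem _ hz))
    refine this.tail ⟨[], U ++ B, x, y, h x List.mem_cons_self, ?_, ?_⟩ <;> simp

theorem swap_perm {T T' : List (Fin (n + 1) × Lat n)} (h : Relation.ReflTransGen SwapStep T T') :
    T.Perm T' := by
  induction h with
  | refl => exact .refl _
  | tail _ h ih => exact ih.trans h.perm

/-- Everything that does not lie above an element of `U` can be moved before `U`. -/
theorem swap_separate {p : Fin (n + 1) × Lat n → Prop} (B : List (Fin (n + 1) × Lat n))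
    (U : List (Fin (n + 1) × Lat n)) (hU : ∀ x ∈ U, p x)
    (h : (U ++ B).Pairwise fun x y => Dep x.1 y.1 → p x → p y) :
    ∃ L U', Relation.ReflTransGen SwapStep (U ++ B) (L ++ U') ∧ U ⊆ U' ∧ ∀ x ∈ U', p x := by
  induction B generalizing U with
  | nil => exact ⟨[], U, by rw [List.append_nil]; exact .refl, fun _ => id, hU⟩
  | cons y B ih =>
    -- If `y` depends on a member of the block it inherits `p` and joins the block; otherwise it
    -- slips past the whole block.
    by_cases hy : ∃ x ∈ U, Dep x.1 y.1
    · obtain ⟨x, hx, hd⟩ := hy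
      have hpy : p y := (List.pairwise_append.1 h).2.2 x hx y List.mem_cons_self hd (hU x hx)
      obtain ⟨L, U', h₁, h₂, h₃⟩ := ih (U ++ [y])
        (fun z hz => by
          rcases List.mem_append.1 hz with hz | hz
          · exact hU z hz
          · exact List.mem_singleton.1 hz ▸ hpy)
        (by rwa [List.append_assoc, List.singleton_append])
      refine ⟨L, U', ?_, fun z hz => h₂ (List.mem_append_left _ hz), h₃⟩
      rwa [List.append_assoc, List.singleton_append] at h₁
    · push Not at hy
      obtain ⟨L, U', h₁, h₂, h₃⟩ := ih U hU
        (h.sublist ((List.sublist_cons_self y B).append_left U))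
      exact ⟨y :: L, U', (swap_move_left hy B).trans (swap_append_left [y] h₁), h₂, h₃⟩

/-- The root `v` stands before the root `v'`. -/
def Before (T : List (Fin (n + 1) × Lat n)) (v v' : Lat n) : Prop :=
  ∃ (k l : ℕ) (_ : k < l) (_ : l < T.length), T[k].2 = v ∧ T[l].2 = v'

theorem rootLT_iff (w : List (Fin (n + 1))) (α β : PosRoot n) :
    RootLT w α β ↔ Before (rootList 1 w) α.1 β.1 := by
  constructor
  · rintro ⟨k, l, hkl, h₁, h₂⟩
    refine ⟨k, l, hkl, by rw [length_rootList]; exact l.2, ?_, ?_⟩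
    · rw [rootList_one_getElem w k, h₁]
    · rw [rootList_one_getElem w l, h₂]
  · rintro ⟨k, l, hkl, hl, h₁, h₂⟩
    rw [length_rootList] at hl
    refine ⟨⟨k, by omega⟩, ⟨l, hl⟩, hkl, ?_, ?_⟩
    · rw [← h₁, rootList_one_getElem w ⟨k, by omega⟩]
    · rw [← h₂, rootList_one_getElem w ⟨l, hl⟩]

theorem before_append {A B : List (Fin (n + 1) × Lat n)} {x y : Fin (n + 1) × Lat n}
    (hx : x ∈ A) (hy : y ∈ B) : Before (A ++ B) x.2 y.2 := by
  obtain ⟨k, hk, rfl⟩ := List.getElem_of_mem hx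
  obtain ⟨l, hl, rfl⟩ := List.getElem_of_mem hy
  refine ⟨k, A.length + l, by omega, by rw [List.length_append]; omega, ?_, ?_⟩
  · rw [List.getElem_append_left hk]
  · rw [List.getElem_append_right (by omega)]
    simp

theorem before_irrefl {T : List (Fin (n + 1) × Lat n)} (hT : (T.map Prod.snd).Nodup) (v : Lat n) :
    ¬ Before T v v := by
  rintro ⟨k, l, hkl, hl, h₁, h₂⟩
  have := (hT.getElem_inj_iff (i := k) (j := l) (hi := by simpa using hkl.trans hl)
    (hj := by simpa using hl)).1 (by simp [h₁, h₂])
  omega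

theorem before_trans {T : List (Fin (n + 1) × Lat n)} (hT : (T.map Prod.snd).Nodup)
    {v v' v'' : Lat n} (h : Before T v v') (h' : Before T v' v'') : Before T v v'' := by
  obtain ⟨k, l, hkl, hl, h₁, h₂⟩ := h
  obtain ⟨k', l', hkl', hl', h₁', h₂'⟩ := h'
  have := (hT.getElem_inj_iff (i := l) (j := k') (hi := by simpa using hl)
    (hj := by simpa using hkl'.trans hl')).1 (by simp [h₂, h₁'])
  exact ⟨k, l', by omega, hl', h₁, h₂'⟩

theorem before_total {T : List (Fin (n + 1) × Lat n)} {x y : Fin (n + 1) × Lat n} (hx : x ∈ T)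
    (hy : y ∈ T) (hne : x.2 ≠ y.2) : Before T x.2 y.2 ∨ Before T y.2 x.2 := by
  obtain ⟨k, hk, rfl⟩ := List.getElem_of_mem hx
  obtain ⟨l, hl, rfl⟩ := List.getElem_of_mem hy
  rcases lt_trichotomy k l with h | rfl | h
  · exact .inl ⟨k, l, h, hl, rfl, rfl⟩
  · exact absurd rfl hne
  · exact .inr ⟨l, k, h, hk, rfl, rfl⟩

theorem rel_of_before {T : List (Fin (n + 1) × Lat n)} (hT : (T.map Prod.snd).Nodup)
    {R : Fin (n + 1) × Lat n → Fin (n + 1) × Lat n → Prop} (hR : T.Pairwise R)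
    {x y : Fin (n + 1) × Lat n} (hx : x ∈ T) (hy : y ∈ T) (h : Before T x.2 y.2) : R x y := by
  obtain ⟨k, l, hkl, hl, h₁, h₂⟩ := h
  have inj : ∀ z ∈ T, ∀ k (hk : k < T.length), T[k].2 = z.2 → T[k] = z := by
    intro z hz k hk h
    obtain ⟨m, hm, rfl⟩ := List.getElem_of_mem hz
    obtain rfl := (hT.getElem_inj_iff (i := k) (j := m) (hi := by simpa using hk)
      (hj := by simpa using hm)).1 (by simpa using h)
    rfl
  rw [← inj x hx k (by omega) h₁, ← inj y hy l hl h₂]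
  exact List.pairwise_iff_getElem.1 hR k l _ hl hkl

end Commutation

/-! ### The segments of a commutation class -/

/-- The segment `[c, c + k]` lies in the window above the slice `l`. -/
structure InWindow (n : ℕ) (l : ℕ → ℤ) (k : ℕ) (c : ℤ) : Prop where
  one_le : 1 ≤ k
  le : k ≤ n
  low : l k ≤ c
  high : c < l k + (n + 1)

/-- The intervals of a slice are nested, so both boundaries of the window respect the product order
and the window is order-convex. -/
theorem InWindow.of_between {n : ℕ} {l : ℕ → ℤ} (hl : IsSlice n l) {k k' k'' : ℕ} {c c' c'' : ℤ}
    (h : InWindow n l k c) (h' : InWindow n l k' c') (hk : 1 ≤ k'') (hk' : k'' ≤ n)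
    (h₁ : c ≤ c'') (h₂ : c'' ≤ c') (h₃ : c + k ≤ c'' + k'') (h₄ : c'' + k'' ≤ c' + k') :
    InWindow n l k'' c'' := by
  obtain ⟨a₁, a₂, a₃, a₄⟩ := h
  obtain ⟨b₁, b₂, b₃, b₄⟩ := h'
  refine ⟨hk, hk', ?_, ?_⟩
  · rcases le_total k k'' with hle | hle
    · have := hl.lipschitz a₁ hle hk'; omega
    · have := hl.lipschitz hk hle a₂; omega
  · rcases le_total k' k'' with hle | hle
    · have := hl.lipschitz b₁ hle hk'; omega
    · have := hl.lipschitz hk hle b₂; omega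

/-- The word reads, beginning with the slice `l`, the whole window above `l`. -/
structure ReadsWindow {n : ℕ} (l : ℕ → ℤ) (σ : ℤ) (w : List (Fin (n + 1))) : Prop where
  slice : IsSlice n l
  sign : σ = 1 ∨ σ = -1
  fits : Fits (sliceSeq n l σ) l σ 1
  walk : Walk l σ w
  endSlice_eq : ∀ k, 1 ≤ k → k ≤ n → endSlice l w k = l k + (n + 1)

/-- The coordinates of the segments of the positive roots. -/
structure IsSegCoord {n : ℕ} (l : ℕ → ℤ) (σ : ℤ) (col : Lat n → ℕ) (lo : Lat n → ℤ) : Prop where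
  inWindow : ∀ v, IsPosRoot v → InWindow n l (col v) (lo v)
  eq : ∀ v, IsPosRoot v → v = sliceSeq n l σ (lo v + col v) - sliceSeq n l σ (lo v)
  unique : ∀ k c, InWindow n l k c →
    col (sliceSeq n l σ (c + k) - sliceSeq n l σ c) = k ∧
      lo (sliceSeq n l σ (c + k) - sliceSeq n l σ c) = c

theorem exists_isSegCoord {n : ℕ} (hn : 1 ≤ n) {l : ℕ → ℤ} {σ : ℤ} (hl : IsSlice n l)
    (hσ : σ = 1 ∨ σ = -1) : ∃ (col : Lat n → ℕ) (lo : Lat n → ℤ), IsSegCoord l σ col lo := by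
  have : ∀ v : Lat n, ∃ (k : ℕ) (c : ℤ), IsPosRoot v → InWindow n l k c ∧
      v = sliceSeq n l σ (c + k) - sliceSeq n l σ c := by
    intro v
    by_cases hv : IsPosRoot v
    · obtain ⟨k, c, h₁, h₂, h₃, h₄, h₅⟩ := hl.exists_segment hn hσ hv
      exact ⟨k, c, fun _ => ⟨⟨h₁, h₂, h₃, h₄⟩, h₅⟩⟩
    · exact ⟨0, 0, fun h => absurd h hv⟩
  choose col lo h using this
  refine ⟨col, lo, fun v hv => (h v hv).1, fun v hv => (h v hv).2, fun k c hkc => ?_⟩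
  obtain ⟨h₁, h₂⟩ := h _ (hl.isPosRoot hn hσ hkc.one_le hkc.le hkc.low hkc.high)
  have := hl.segment_inj hn hσ hkc.one_le hkc.le hkc.low hkc.high h₁.one_le h₁.le h₁.low h₁.high h₂
  exact ⟨this.2.symm, this.1.symm⟩

namespace ReadsWindow

variable {n : ℕ} {l : ℕ → ℤ} {σ : ℤ} {w₀ w : List (Fin (n + 1))} {col : Lat n → ℕ}
  {lo : Lat n → ℤ}

theorem rootList_eq (h : ReadsWindow l σ w₀) (hn : 1 ≤ n) :
    rootList 1 w₀ = (tags l w₀).map fun s =>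
      (s.1, sliceSeq n l σ (s.2 + bar s.1) - sliceSeq n l σ s.2) :=
  (h.fits.walk hn (sliceSeq_add l σ) h.walk).1

theorem inWindow_tags (h : ReadsWindow l σ w₀) (hn : 1 ≤ n) {s : Fin (n + 1) × ℤ}
    (hs : s ∈ tags l w₀) : InWindow n l (bar s.1) s.2 := by
  have := le_of_mem_tags hs
  rw [h.endSlice_eq _ (one_le_bar hn _) (bar_le _)] at this
  exact ⟨one_le_bar hn _, bar_le _, this.1, this.2⟩

theorem mem_rootList (h : ReadsWindow l σ w₀) (hn : 2 ≤ n) (hc : IsSegCoord l σ col lo)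
    (hw : CommEquiv w₀ w) {x : Fin (n + 1) × Lat n} (hx : x ∈ rootList 1 w) :
    IsPosRoot x.2 ∧ bar x.1 = col x.2 := by
  rw [← (hw.rootList hn).1.mem_iff, h.rootList_eq (by omega), List.mem_map] at hx
  obtain ⟨s, hs, rfl⟩ := hx
  have hs := h.inWindow_tags (by omega) hs
  exact ⟨h.slice.isPosRoot (by omega) h.sign hs.one_le hs.le hs.low hs.high,
    (hc.unique _ _ hs).1.symm⟩

theorem exists_mem_rootList (h : ReadsWindow l σ w₀) (hn : 2 ≤ n) (hc : IsSegCoord l σ col lo)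
    (hw : CommEquiv w₀ w) {v : Lat n} (hv : IsPosRoot v) : ∃ i, (i, v) ∈ rootList 1 w := by
  have hW := hc.inWindow v hv
  obtain ⟨i, hi, hmem⟩ := exists_mem_tags (w := w₀) hW.low
    (by rw [h.endSlice_eq _ hW.one_le hW.le]; exact hW.high)
  refine ⟨i, ?_⟩
  rw [← (hw.rootList hn).1.mem_iff, h.rootList_eq (by omega), List.mem_map]
  exact ⟨_, hmem, by rw [hi, ← hc.eq v hv]⟩

theorem pairwise_rootList (h : ReadsWindow l σ w₀) (hn : 2 ≤ n) (hc : IsSegCoord l σ col lo)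
    (hw : CommEquiv w₀ w) :
    (rootList 1 w).Pairwise fun x y => Dep x.1 y.1 →
      lo x.2 ≤ lo y.2 ∧ lo x.2 + col x.2 ≤ lo y.2 + col y.2 := by
  refine ((hw.rootList hn).2 fun v v' => lo v ≤ lo v' ∧ lo v + col v ≤ lo v' + col v').1 ?_
  rw [h.rootList_eq (by omega), List.pairwise_map]
  refine (pairwise_tags (by omega) h.walk).imp_of_mem fun {s t} hs ht hst hd => ?_
  obtain ⟨h₁, h₂⟩ := hc.unique _ _ (h.inWindow_tags (by omega) hs)
  obtain ⟨h₃, h₄⟩ := hc.unique _ _ (h.inWindow_tags (by omega) ht)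
  dsimp only at hd ⊢
  rw [h₁, h₂, h₃, h₄]
  rcases hd with hd | hd | hd
  · have := hst.1 (by rw [hd])
    rw [hd]
    omega
  · have := hst.2.1 hd
    omega
  · have := hst.2.2 hd
    omega

theorem nodup_rootList (h : ReadsWindow l σ w₀) (hn : 2 ≤ n) (hc : IsSegCoord l σ col lo)
    (hw : CommEquiv w₀ w) : ((rootList 1 w).map Prod.snd).Nodup := by
  rw [← ((hw.rootList hn).1.map Prod.snd).nodup_iff, h.rootList_eq (by omega), List.map_map,
    List.Nodup, List.pairwise_map]
  refine (pairwise_tags (by omega) h.walk).imp_of_mem fun {s t} hs ht hst he => ?_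
  obtain ⟨h₁, h₂⟩ := hc.unique _ _ (h.inWindow_tags (by omega) hs)
  obtain ⟨h₃, h₄⟩ := hc.unique _ _ (h.inWindow_tags (by omega) ht)
  rw [Function.comp_apply, Function.comp_apply] at he
  dsimp only at he
  rw [he] at h₁ h₂
  have := hst.1 (h₁.symm.trans h₃)
  omega

/-- Roots in neighbouring columns have dependent letters. The reverse order would force both ends to
coincide, contrary to the different lengths. -/
theorem before_of_dep (h : ReadsWindow l σ w₀) (hn : 2 ≤ n) (hc : IsSegCoord l σ col lo)
    (hw : CommEquiv w₀ w) {v v' : Lat n} (hv : IsPosRoot v) (hv' : IsPosRoot v')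
    (hd : col v + 1 = col v' ∨ col v' + 1 = col v) (h₁ : lo v ≤ lo v')
    (h₂ : lo v + col v ≤ lo v' + col v') : Before (rootList 1 w) v v' := by
  obtain ⟨i, hi⟩ := h.exists_mem_rootList hn hc hw hv
  obtain ⟨j, hj⟩ := h.exists_mem_rootList hn hc hw hv'
  have hi' := (h.mem_rootList hn hc hw hi).2
  have hj' := (h.mem_rootList hn hc hw hj).2
  refine (before_total hi hj (fun he => by
    dsimp only at he; rw [he] at hd; omega)).resolve_right fun hb => ?_
  have := rel_of_before (h.nodup_rootList hn hc hw) (h.pairwise_rootList hn hc hw) hj hi hb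
    (.inr (by dsimp only at hi' hj' ⊢; omega))
  dsimp only at this
  omega

/-- Comparable segments are joined by moving one end by one place at a time. Each move changes the
column by one, so `before_of_dep` applies, and order-convexity keeps the path inside the window. -/
theorem before_of_le (h : ReadsWindow l σ w₀) (hn : 2 ≤ n) (hc : IsSegCoord l σ col lo)
    (hw : CommEquiv w₀ w) {v v' : Lat n} (hv : IsPosRoot v) (hv' : IsPosRoot v') (hne : v ≠ v')
    (h₁ : lo v ≤ lo v') (h₂ : lo v + col v ≤ lo v' + col v') : Before (rootList 1 w) v v' := by
  obtain ⟨m, hm⟩ : ∃ m : ℕ, (m : ℤ) = lo v' - lo v + (lo v' + col v' - (lo v + col v)) :=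
    ⟨_, Int.toNat_of_nonneg (by omega)⟩
  induction m generalizing v with
  | zero =>
    refine absurd ?_ hne
    rw [hc.eq v hv, hc.eq v' hv', show lo v' = lo v by omega, show col v' = col v by omega]
  | succ m ih =>
    have hW := hc.inWindow v hv
    have hW' := hc.inWindow v' hv'
    -- a neighbour of `v` in the direction of `v'`
    obtain ⟨k, c, hk, hkc, ha, hb, hc', hd, hs⟩ : ∃ (k : ℕ) (c : ℤ), (1 ≤ k ∧ k ≤ n) ∧
        (col v + 1 = k ∨ k + 1 = col v) ∧ lo v ≤ c ∧ lo v + col v ≤ c + k ∧ c ≤ lo v' ∧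
        c + k ≤ lo v' + col v' ∧ c + (c + k) = lo v + (lo v + col v) + 1 := by
      have a₁ := hW.one_le
      have a₂ := hW.le
      have b₁ := hW'.one_le
      have b₂ := hW'.le
      -- Advance the left end if possible. Otherwise the left ends agree, or `v` has length one and
      -- ends no later than `v'` starts; in both cases the right end can advance, the second using
      -- that column 2 exists.
      by_cases hlt : lo v < lo v' ∧ 2 ≤ col v
      · exact ⟨col v - 1, lo v + 1, by omega, by omega, by omega, by omega, by omega, by omega,
          by omega⟩
      · push_cast at hm
        exact ⟨col v + 1, lo v, by omega, by omega, by omega, by omega, by omega, by omega,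
          by omega⟩
    have hkW := hW.of_between h.slice hW' hk.1 hk.2 ha hc' hb hd
    have hpos := h.slice.isPosRoot (by omega) h.sign hkW.one_le hkW.le hkW.low hkW.high
    obtain ⟨e₁, e₂⟩ := hc.unique k c hkW
    set u := sliceSeq n l σ (c + k) - sliceSeq n l σ c
    have hvu := h.before_of_dep hn hc hw hv hpos (by rw [e₁]; exact hkc) (by rw [e₂]; exact ha)
      (by rw [e₁, e₂]; exact hb)
    by_cases huv : u = v'
    · rwa [huv] at hvu
    · refine before_trans (h.nodup_rootList hn hc hw) hvu
        (ih hpos huv (by rw [e₂]; exact hc') (by rw [e₁, e₂]; exact hd) ?_)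
      rw [e₁, e₂]
      push_cast at hm
      omega

/-- If `v'` comes after `v` without lying above it, commutations gather `v` with roots above it at
the end of the word and move `v'` in front of them. -/
theorem exists_before (h : ReadsWindow l σ w₀) (hn : 2 ≤ n) (hc : IsSegCoord l σ col lo)
    {v v' : Lat n} (hv : IsPosRoot v) (hv' : IsPosRoot v')
    (hle : ¬ (lo v ≤ lo v' ∧ lo v + col v ≤ lo v' + col v')) :
    ∃ w, CommEquiv w₀ w ∧ Before (rootList 1 w) v' v := by
  have hw := CommEquiv.refl w₀
  obtain ⟨i, hi⟩ := h.exists_mem_rootList hn hc hw hv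
  obtain ⟨j, hj⟩ := h.exists_mem_rootList hn hc hw hv'
  obtain ⟨A, B, hAB⟩ := List.append_of_mem hi
  have hP := h.pairwise_rootList hn hc hw
  rw [hAB] at hj hP
  rcases List.mem_append.1 hj with hj | hj
  · exact ⟨w₀, hw, by rw [hAB]; exact before_append hj List.mem_cons_self⟩
  obtain ⟨L, U, h₁, h₂, h₃⟩ := swap_separate
    (p := fun x => lo v ≤ lo x.2 ∧ lo v + col v ≤ lo x.2 + col x.2) B [(i, v)]
    (by simp) ((List.pairwise_append.1 hP).2.1.imp fun {x y} hxy hd hx => by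
      have := hxy hd; omega)
  have hjLU := (swap_perm h₁).mem_iff.1 hj
  have hjL := (List.mem_append.1 hjLU).resolve_right fun hjU => hle (h₃ _ hjU)
  have h₄ := swap_append_left A h₁
  rw [List.singleton_append, ← hAB] at h₄
  obtain ⟨w, hw', hT⟩ := exists_commEquiv_of_swap hn h₄
  refine ⟨w, hw', ?_⟩
  rw [hT, ← List.append_assoc]
  exact before_append (List.mem_append_right A hjL) (h₂ (List.mem_singleton_self _))

/-- The segments are coordinates of the commutation class. -/
theorem segModel (h : ReadsWindow l σ w₀) (hn : 2 ≤ n) (hc : IsSegCoord l σ col lo)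
    (hw : CommEquiv w w₀) :
    SegModel w (n + 1) (sliceSeq n l σ) (fun γ => lo γ.1) (fun γ => lo γ.1 + col γ.1) where
  anti := sliceSeq_add l σ
  dual G hG := h.slice.exists_dual (by omega) h.sign hG
  root γ := hc.eq γ.1 γ.2
  lt γ := by have := (hc.inWindow γ.1 γ.2).one_le; omega
  lt_add γ := by have := (hc.inWindow γ.1 γ.2).le; omega
  exists_root α β c e h₁ h₂ h₃ h₄ h₅ h₆ := by
    obtain ⟨k, hk⟩ : ∃ k : ℕ, (k : ℤ) = e - c := ⟨_, Int.toNat_of_nonneg (by omega)⟩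
    have hW := (hc.inWindow α.1 α.2).of_between h.slice (hc.inWindow β.1 β.2) (k'' := k)
      (by omega) (by omega) h₁ h₂ (by omega) (by omega)
    refine ⟨⟨_, h.slice.isPosRoot (by omega) h.sign hW.one_le hW.le hW.low hW.high⟩, ?_, ?_⟩
    · exact (hc.unique k c hW).2
    · dsimp only
      rw [(hc.unique k c hW).1, (hc.unique k c hW).2]
      omega
  -- The nesting of the slice bounds the left ends if `α` is the shorter segment, and the right ends
  -- if `β` is.
  near α β := by
    have h₁ := hc.inWindow α.1 α.2
    have h₂ := hc.inWindow β.1 β.2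
    rcases le_total (col α.1) (col β.1) with hle | hle
    · have := h.slice.lipschitz h₁.one_le hle h₂.le
      have := h₁.low
      have := h₂.high
      omega
    · have := h.slice.lipschitz h₂.one_le hle h₁.le
      have := h₁.low
      have := h₂.high
      omega
  irrefl w' hw' α := by
    rw [rootLT_iff]
    exact before_irrefl (h.nodup_rootList hn hc ((hw.symm _ _).trans _ _ _ hw')) _
  trans w' hw' α β γ := by
    simp only [rootLT_iff]
    exact before_trans (h.nodup_rootList hn hc ((hw.symm _ _).trans _ _ _ hw'))
  total w' hw' α β hne := by
    simp only [rootLT_iff]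
    have hw'' := (hw.symm _ _).trans _ _ _ hw'
    obtain ⟨i, hi⟩ := h.exists_mem_rootList hn hc hw'' α.2
    obtain ⟨j, hj⟩ := h.exists_mem_rootList hn hc hw'' β.2
    exact before_total hi hj fun h => hne (Subtype.ext h)
  prec α β hne h₁ h₂ w' hw' := by
    rw [rootLT_iff]
    exact h.before_of_le hn hc ((hw.symm _ _).trans _ _ _ hw') α.2 β.2
      (fun h => hne (Subtype.ext h)) h₁ h₂
  sep α β hle := by
    obtain ⟨w', hw', hb⟩ := h.exists_before hn hc α.2 β.2 hle
    exact ⟨w', hw.trans _ _ _ hw', (rootLT_iff _ _ _).2 hb⟩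

end ReadsWindow
/-! ### Twisted Coxeter words -/

section TwistedCoxeter

variable {n : ℕ}

theorem vee_of_lt {i : Fin (n + 1)} (h : i.val + 1 < n) : vee i = i := by
  refine Equiv.swap_apply_of_ne_of_ne ?_ ?_ <;> rw [Ne, Fin.ext_iff]
  · dsimp only; omega
  · rw [Fin.val_last]; omega

theorem vee_val_of_pred {i : Fin (n + 1)} (h : i.val + 1 = n) : (vee i).val = n := by
  have : i = ⟨n - 1, by omega⟩ := Fin.ext (by dsimp only; omega)
  rw [this, vee, Equiv.swap_apply_left, Fin.val_last]

theorem vee_val_last {i : Fin (n + 1)} (h : i.val = n) : (vee i).val = n - 1 := by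
  have : i = Fin.last n := Fin.ext h
  rw [this, vee, Equiv.swap_apply_right]

theorem bar_vee (i : Fin (n + 1)) : bar (vee i) = bar i := by
  have := i.2
  rcases lt_trichotomy (i.val + 1) n with h | h | h
  · rw [vee_of_lt h]
  · rw [bar_of_eq (vee_val_of_pred h), bar_of_lt (by omega), h]
  · have h' : i.val = n := by omega
    rw [bar_of_eq h', bar, vee_val_last h']
    omega

theorem SignOK.vee (hn : 1 ≤ n) {σ : ℤ} {i : Fin (n + 1)} (h : SignOK σ i) :
    SignOK (-σ) (vee i) := by
  have := i.2
  rcases lt_trichotomy (i.val + 1) n with h' | h' | h'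
  · rw [vee_of_lt h']
    exact ⟨fun h => by omega, fun h => by omega⟩
  · have hv := vee_val_of_pred h'
    exact ⟨fun h => by omega, fun _ => by rw [h.1 h']⟩
  · have h'' : i.val = n := by omega
    have hv := vee_val_last h''
    exact ⟨fun _ => by rw [h.2 h'', neg_neg], fun h => by omega⟩

/-- The orientation `Q` is the one of the slice `l`. -/
def Compatible (n : ℕ) (Q : ℕ → ℕ → Prop) (l : ℕ → ℤ) : Prop :=
  ∀ k, 1 ≤ k → k < n →
    (Q k (k + 1) ∧ l (k + 1) = l k - 1) ∨ (Q (k + 1) k ∧ l (k + 1) = l k)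

theorem Compatible.isSource {Q : ℕ → ℕ → Prop} {l : ℕ → ℤ} (h : Compatible n Q l) {k : ℕ}
    (hk : 1 ≤ k) (hkn : k ≤ n) (hs : IsSink Q k) : IsSource n l k := by
  constructor
  · intro h2
    have := h (k - 1) (by omega) (by omega)
    rw [Nat.sub_add_cancel hk] at this
    rcases this with ⟨-, h'⟩ | ⟨h', -⟩
    · omega
    · exact absurd h' (hs _)
  · intro h2
    rcases h k hk h2 with ⟨h', -⟩ | ⟨-, h'⟩
    · exact absurd h' (hs _)
    · exact h'

/-- Raising a source column switches the slice steps on both of its sides, just as reversal at a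
sink switches the arrows. -/
theorem Compatible.bump {Q : ℕ → ℕ → Prop} {l : ℕ → ℤ} (h : Compatible n Q l) {k : ℕ}
    (hs : IsSink Q k) : Compatible n (reverseAt k Q) (bump l k) := by
  intro j hj hjn
  by_cases h₁ : j = k
  · subst h₁
    rcases h j hj hjn with ⟨h', -⟩ | ⟨h', h''⟩
    · exact absurd h' (hs _)
    · rw [bump_self, bump_of_ne l (by omega)]
      exact .inl ⟨.inl ⟨.inl rfl, h'⟩, by omega⟩
  by_cases h₂ : j + 1 = k
  · subst h₂
    rcases h j hj hjn with ⟨h', h''⟩ | ⟨h', -⟩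
    · rw [bump_self, bump_of_ne l (by omega)]
      exact .inr ⟨.inl ⟨.inl rfl, h'⟩, by omega⟩
    · exact absurd h' (hs _)
  rw [bump_of_ne l h₁, bump_of_ne l h₂]
  exact (h j hj hjn).imp (fun h => ⟨.inr ⟨h₁, h₂, h.1⟩, h.2⟩) fun h => ⟨.inr ⟨h₂, h₁, h.1⟩, h.2⟩

theorem walk_of_adapted (hn : 1 ≤ n) {c : List (Fin (n + 1))} {Q : ℕ → ℕ → Prop} {l : ℕ → ℤ}
    {σ : ℤ} (hnd : (c.map bar).Nodup) (hA : Adapted Q (c.map bar)) (hC : Compatible n Q l)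
    (hs : ∀ i ∈ c, SignOK σ i) : Walk l σ c := by
  induction c generalizing Q l σ with
  | nil => trivial
  | cons i c ih =>
    rw [List.map_cons, List.nodup_cons] at hnd
    rw [List.map_cons] at hA
    refine ⟨hC.isSource (one_le_bar hn i) (bar_le i) hA.1, hs i List.mem_cons_self,
      ih hnd.2 hA.2 (hC.bump hA.1) fun j hj => ?_⟩
    have hne : bar j ≠ bar i := fun h => hnd.1 (h ▸ List.mem_map_of_mem hj)
    -- The sign changes only at the letter of the last orbit; no second letter of that orbit
    -- follows, so the remaining conditions are then vacuous.
    by_cases hi : bar i = n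
    · rw [hi] at hne
      exact ⟨fun h => absurd ((bar_of_lt (by omega)).trans h) hne,
        fun h => absurd (bar_of_eq h) hne⟩
    · rw [nextSign, if_neg hi]
      exact hs j (List.mem_cons_of_mem _ hj)

theorem endSign_eq (σ : ℤ) (w : List (Fin (n + 1))) :
    endSign σ w = (-1) ^ (w.map bar).count n * σ := by
  induction w generalizing σ with
  | nil => simp [endSign]
  | cons i w ih =>
    have := ih (nextSign σ i)
    rw [endSign] at this ⊢
    rw [List.foldl_cons, this, List.map_cons, List.count_cons, nextSign]
    by_cases h : bar i = n
    · rw [if_pos h, h, beq_self_eq_true, if_pos rfl, pow_succ]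
      ring
    · rw [if_neg h, if_neg (by simpa using h), add_zero]

theorem bar_vee_pow (r : ℕ) (i : Fin (n + 1)) :
    bar ((vee ^ r : Equiv.Perm (Fin (n + 1))) i) = bar i := by
  induction r with
  | zero => rfl
  | succ r ih => rw [pow_succ', Equiv.Perm.mul_apply, bar_vee, ih]

theorem SignOK.vee_pow (hn : 1 ≤ n) {σ : ℤ} {i : Fin (n + 1)} (h : SignOK σ i) (r : ℕ) :
    SignOK ((-1) ^ r * σ) ((TwistedD.vee ^ r : Equiv.Perm (Fin (n + 1))) i) := by
  induction r with
  | zero => simpa using h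
  | succ r ih =>
    have := ih.vee hn
    rwa [pow_succ', pow_succ', Equiv.Perm.mul_apply, neg_one_mul, neg_mul]

/-- A twisted Coxeter word with its orientation, slice and sign. -/
structure CoxeterSlice (c : List (Fin (n + 1))) (Q : ℕ → ℕ → Prop) (l : ℕ → ℤ) (σ : ℤ) :
    Prop where
  one_le : 1 ≤ n
  perm : (c.map bar).Perm (List.range' 1 n)
  adapted : Adapted Q (c.map bar)
  compatible : Compatible n Q l
  sign : σ = 1 ∨ σ = -1
  signOK : ∀ i ∈ c, SignOK σ i

namespace CoxeterSlice

variable {c : List (Fin (n + 1))} {Q : ℕ → ℕ → Prop} {l : ℕ → ℤ} {σ : ℤ}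

theorem map_bar_map (r : ℕ) :
    (c.map (vee ^ r : Equiv.Perm (Fin (n + 1)))).map bar = c.map bar := by
  rw [List.map_map]
  exact List.map_congr_left fun i _ => bar_vee_pow r i

theorem nodup (h : CoxeterSlice c Q l σ) : (c.map bar).Nodup :=
  h.perm.nodup_iff.2 List.nodup_range'

theorem count (h : CoxeterSlice c Q l σ) {k : ℕ} (hk : 1 ≤ k) (hkn : k ≤ n) :
    (c.map bar).count k = 1 :=
  List.count_eq_one_of_mem h.nodup (h.perm.mem_iff.2 (List.mem_range'_1.2 (by omega)))

theorem isSlice (h : CoxeterSlice c Q l σ) : IsSlice n l := fun k hk hkn =>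
  (h.compatible k hk hkn).symm.imp And.right And.right

/-- Each earlier block has raised the slice by one and flipped the sign; `∨` exchanges the two
vertices of the last orbit in step with the sign. -/
theorem walk_block (h : CoxeterSlice c Q l σ) (r : ℕ) {l' : ℕ → ℤ}
    (hl : ∀ k, 1 ≤ k → k ≤ n → l' k = l k + r) :
    Walk l' ((-1) ^ r * σ) (c.map (vee ^ r : Equiv.Perm (Fin (n + 1)))) := by
  refine walk_of_adapted (Q := Q) h.one_le ?_ ?_ ?_ ?_
  · rw [map_bar_map]; exact h.nodup
  · rw [map_bar_map]; exact h.adapted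
  · intro k hk hkn
    rw [hl k hk hkn.le, hl (k + 1) (by omega) hkn]
    exact (h.compatible k hk hkn).imp (fun h => ⟨h.1, by omega⟩) fun h => ⟨h.1, by omega⟩
  · intro j hj
    obtain ⟨i, hi, rfl⟩ := List.mem_map.1 hj
    exact (h.signOK i hi).vee_pow h.one_le r

theorem endSlice_block (h : CoxeterSlice c Q l σ) (r : ℕ) (l' : ℕ → ℤ) {k : ℕ} (hk : 1 ≤ k)
    (hkn : k ≤ n) :
    endSlice l' (c.map (vee ^ r : Equiv.Perm (Fin (n + 1)))) k = l' k + 1 := by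
  rw [endSlice_apply, map_bar_map, h.count hk hkn, Nat.cast_one]

theorem endSign_block (h : CoxeterSlice c Q l σ) (r : ℕ) (σ' : ℤ) :
    endSign σ' (c.map (vee ^ r : Equiv.Perm (Fin (n + 1)))) = -σ' := by
  rw [endSign_eq, map_bar_map, h.count h.one_le le_rfl, pow_one, neg_one_mul]

theorem walk_blocks (h : CoxeterSlice c Q l σ) (m : ℕ) :
    let w := (List.range m).flatMap fun k => c.map (vee ^ k : Equiv.Perm (Fin (n + 1)))
    Walk l σ w ∧ (∀ k, 1 ≤ k → k ≤ n → endSlice l w k = l k + m) ∧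
      endSign σ w = (-1) ^ m * σ := by
  induction m with
  | zero => exact ⟨trivial, by simp [endSlice], by simp [endSign]⟩
  | succ m ih =>
    obtain ⟨h₁, h₂, h₃⟩ := ih
    dsimp only at h₁ h₂ h₃ ⊢
    rw [List.range_succ, List.flatMap_append, List.flatMap_singleton]
    set w := (List.range m).flatMap fun k => c.map (vee ^ k : Equiv.Perm (Fin (n + 1)))
    refine ⟨walk_append.2 ⟨h₁, ?_⟩, fun k hk hkn => ?_, ?_⟩
    · rw [h₃]
      exact h.walk_block m h₂
    · have := h.endSlice_block m (endSlice l w) hk hkn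
      rw [h₂ k hk hkn] at this
      rw [endSlice, List.foldl_append]
      push_cast
      rw [← add_assoc]
      exact this
    · rw [endSign, List.foldl_append, pow_succ', neg_one_mul, neg_mul, ← h₃]
      exact h.endSign_block m (endSign σ w)

/-- The signs in `sliceSeq` are normalised so that the identity element corresponds to the initial
slice. -/
theorem fits (h : CoxeterSlice c Q l σ) : Fits (sliceSeq n l σ) l σ 1 := by
  constructor
  · intro κ hκ
    have := h.isSlice.sliceSeq_coordPt (σ := σ) h.one_le κ
    rw [coordPt, if_pos hκ, if_pos hκ, one_smul] at this
    rw [this, neg_neg, Module.End.one_apply]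
  · intro κ hκ
    have := h.isSlice.sliceSeq_coordPt (σ := σ) h.one_le κ
    rw [coordPt, if_neg (by omega), if_neg (by omega)] at this
    rw [this, smul_neg, neg_neg, smul_smul, Module.End.one_apply]
    rcases h.sign with rfl | rfl <;> simp

theorem readsWindow (h : CoxeterSlice c Q l σ) : ReadsWindow l σ (twistedPower c) := by
  obtain ⟨h₁, h₂, -⟩ := h.walk_blocks (n + 1)
  exact ⟨h.isSlice, h.sign, h.fits, h₁, fun k hk hkn => by
    rw [twistedPower, h₂ k hk hkn]; push_cast; rfl⟩

theorem walk_first (h : CoxeterSlice c Q l σ) : Walk l σ c :=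
  walk_of_adapted h.one_le h.nodup h.adapted h.compatible h.signOK

theorem endSlice_first (h : CoxeterSlice c Q l σ) {k : ℕ} (hk : 1 ≤ k) (hkn : k ≤ n) :
    endSlice l c k = l k + 1 := by
  rw [endSlice_apply, h.count hk hkn, Nat.cast_one]

theorem walk_second (h : CoxeterSlice c Q l σ) :
    Walk (endSlice l c) (endSign σ c) (c.map vee) := by
  have := h.walk_block 1 (l' := endSlice l c) fun k hk hkn => by
    rw [h.endSlice_first hk hkn, Nat.cast_one]
  rw [endSign_eq, h.count h.one_le le_rfl]
  exact this

theorem fits_second (h : CoxeterSlice c Q l σ) :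
    Fits (sliceSeq n l σ) (endSlice l c) (endSign σ c) (wordMap c) := by
  have := (h.fits.walk h.one_le (sliceSeq_add l σ) h.walk_first).2
  rwa [one_mul] at this

theorem endSlice_second (h : CoxeterSlice c Q l σ) {k : ℕ} (hk : 1 ≤ k) (hkn : k ≤ n) :
    endSlice (endSlice l c) (c.map vee) k = l k + 2 := by
  have := h.endSlice_block 1 (endSlice l c) hk hkn
  rw [pow_one, h.endSlice_first hk hkn] at this
  rw [this]
  ring

/-- The square of the twisted Coxeter element moves the sequence by two steps. -/
theorem wordMap_sliceSeq (h : CoxeterSlice c Q l σ) (x : ℤ) :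
    wordMap (c ++ c.map vee) (sliceSeq n l σ x) = sliceSeq n l σ (x + 2) := by
  have hfit := (h.fits_second.walk h.one_le (sliceSeq_add l σ) h.walk_second).2
  rw [← wordMap_append] at hfit
  refine h.isSlice.antiperiodic_ext h.one_le (G := fun x => wordMap (c ++ c.map vee)
    (sliceSeq n l σ x)) (H := fun x => sliceSeq n l σ (x + 2)) ?_ ?_ ?_ x
  · intro x
    rw [sliceSeq_add, map_neg]
  · intro x
    rw [add_right_comm, sliceSeq_add]
  · intro κ
    rw [h.isSlice.sliceSeq_coordPt h.one_le, map_neg, map_smul, coordPt]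
    split_ifs with hκ
    · rw [hfit.eps_of_lt κ hκ, one_smul, neg_neg]
      congr 1
      by_cases h0 : κ.val = 0
      · rw [h0, zero_add, slicePt_one, slicePt_one, h.endSlice_second le_rfl h.one_le]
      · rw [slicePt, slicePt, Nat.add_sub_cancel,
          h.endSlice_second (by omega) (show κ.val + 1 ≤ n from hκ),
          h.endSlice_second (by omega) hκ.le]
        split_ifs <;> omega
    · have hκ' : κ.val = n := by have := κ.2; omega
      have hs := h.endSign_block 1 (endSign σ c)
      rw [pow_one, endSign_eq σ c, h.count h.one_le le_rfl] at hs
      rw [hfit.eps_last κ hκ', h.endSlice_second h.one_le le_rfl, endSign_eq σ c,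
        h.count h.one_le le_rfl, hs, smul_neg, neg_neg, smul_smul]
      -- Two blocks flip the sign twice, which leaves `σ ^ 2`.
      have : σ * -((-1) ^ 1 * σ) = 1 := by rcases h.sign with rfl | rfl <;> rfl
      rw [this, one_smul, add_right_comm]

/-- The segment of a root is determined by its folded coordinate. -/
theorem segment_of_twistedCoord (h : CoxeterSlice c Q l σ) {ξ : ℕ → ℤ} {z : ℤ}
    (hξ : ∀ k, 1 ≤ k → k ≤ n → ξ k = z - 2 * l k - k) {v : Lat n} {i : Fin (n + 1)} {p : ℤ}
    (hv : TwistedCoord c ξ v i p) :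
    ∃ x, InWindow n l (bar i) x ∧ v = sliceSeq n l σ (x + bar i) - sliceSeq n l σ x ∧
      p = z - 2 * x - bar i := by
  have hb := one_le_bar (n := n) h.one_le
  have hb' := bar_le (n := n)
  induction hv with
  | first k =>
    have hmem : (c.get k, rootAt c k) ∈ rootList 1 c := by
      rw [← rootList_one_getElem]; exact List.getElem_mem _
    rw [(h.fits.walk h.one_le (sliceSeq_add l σ) h.walk_first).1] at hmem
    obtain ⟨s, hs, hs'⟩ := List.mem_map.1 hmem
    obtain ⟨e₁, e₂⟩ := Prod.mk.inj hs'
    have hle := le_of_mem_tags hs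
    rw [h.endSlice_first (hb _) (hb' _), e₁] at hle
    rw [e₁] at e₂
    refine ⟨s.2, ⟨hb _, hb' _, hle.1, by omega⟩, e₂.symm, ?_⟩
    rw [hξ _ (hb _) (hb' _)]
    omega
  | second k =>
    have hk : k.val < (c.map vee).length := by rw [List.length_map]; exact k.2
    have hget := rootList_getElem (wordMap c) (c.map vee) k.val hk
    have hmem := List.getElem_mem (l := rootList (wordMap c) (c.map vee)) (n := k.val)
      (by rw [length_rootList]; exact hk)
    rw [hget, (h.fits_second.walk h.one_le (sliceSeq_add l σ) h.walk_second).1] at hmem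
    obtain ⟨s, hs, hs'⟩ := List.mem_map.1 hmem
    obtain ⟨e₁, e₂⟩ := Prod.mk.inj hs'
    rw [List.getElem_map] at e₁ e₂
    have e₁ : s.1 = vee (c.get k) := e₁
    have hle := le_of_mem_tags hs
    rw [h.endSlice_second (hb _) (hb' _), h.endSlice_first (hb _) (hb' _), e₁] at hle
    rw [e₁] at e₂
    refine ⟨s.2, ⟨hb _, hb' _, by omega, ?_⟩, ?_, ?_⟩
    · have := h.one_le; omega
    · rw [wordMap_append, Module.End.mul_apply, List.map_take]
      exact e₂.symm
    · rw [bar_vee] at hle ⊢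
      rw [hξ _ (hb _) (hb' _)]
      omega
  | step v i p hpos hpos' _ ih =>
    obtain ⟨x, hx, rfl, rfl⟩ := ih
    rw [map_sub, h.wordMap_sliceSeq, h.wordMap_sliceSeq] at hpos' ⊢
    rw [add_right_comm] at hpos' ⊢
    refine ⟨x + 2, ⟨hb _, hb' _, by have := hx.low; omega, ?_⟩, rfl, by ring⟩
    -- Had the shifted segment left the window, moving it back by one antiperiod would give a
    -- positive root whose negative is the image.
    by_contra hge
    have hn := h.one_le
    have := h.isSlice.isPosRoot (σ := σ) h.one_le h.sign (hb i) (hb' i) (c := x + 2 - (n + 1))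
      (by omega) (by have := hx.high; omega)
    have e₁ := sliceSeq_add (n := n) l σ (x + 2 - (n + 1))
    have e₂ := sliceSeq_add (n := n) l σ (x + 2 - (n + 1) + bar i)
    rw [sub_add_cancel] at e₁
    rw [show x + 2 - ((n : ℤ) + 1) + bar i + (n + 1) = x + 2 + bar i by ring] at e₂
    rw [e₁, e₂, neg_sub_neg, ← neg_sub] at hpos'
    exact this.not_neg hpos'

end CoxeterSlice

/-- Folded data define a slice. -/
theorem IsFoldedData.exists_coxeterSlice (hn : 1 ≤ n) {w c : List (Fin (n + 1))}
    {Q : ℕ → ℕ → Prop} {ξ : ℕ → ℤ} (h : IsFoldedData w c Q ξ) :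
    ∃ l σ, CoxeterSlice c Q l σ ∧ ∀ k, 1 ≤ k → k ≤ n → ξ k = ξ 1 + 1 - 2 * l k - k := by
  have hQ := h.quiver.2
  have hstep : ∀ k, 1 ≤ k → k < n →
      (Q k (k + 1) ∧ ξ (k + 1) = ξ k + 1) ∨ (Q (k + 1) k ∧ ξ k = ξ (k + 1) + 1) := by
    intro k hk hkn
    rcases hQ k hk hkn with ⟨h', -⟩ | ⟨h', -⟩
    · exact .inl ⟨h', h.height _ _ h'⟩
    · exact .inr ⟨h', h.height _ _ h'⟩
  have hl : ∀ k : ℕ, 1 ≤ k → k ≤ n → 2 * ((ξ 1 - ξ k - k + 1) / 2) = ξ 1 - ξ k - k + 1 := by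
    intro k hk
    induction k, hk using Nat.le_induction with
    | base => intro _; push_cast; omega
    | succ k hk ih =>
      intro hkn
      have := ih (by omega)
      have := hstep k hk hkn
      push_cast
      omega
  have hnd : (c.map bar).Nodup := h.coxeter.nodup_iff.2 List.nodup_range'
  -- The solution of `ξ k = z - 2 * l k - k` normalised by `l 1 = 0`, so that `z = ξ 1 + 1`; `hl`
  -- shows that the division is exact. The sign records which vertex of the last orbit occurs in
  -- `c`.
  refine ⟨fun k => (ξ 1 - ξ k - k + 1) / 2, if Fin.last n ∈ c then -1 else 1,
    ⟨hn, h.coxeter, h.adapted, fun k hk hkn => ?_, by split_ifs <;> simp, fun i hi => ?_⟩,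
    fun k hk hkn => ?_⟩
  · have h₁ := hl k hk hkn.le
    have h₂ := hl (k + 1) (by omega) hkn
    push_cast at h₂ ⊢
    exact (hstep k hk hkn).imp (fun h => ⟨h.1, by omega⟩) fun h => ⟨h.1, by omega⟩
  · constructor
    · intro hin
      rw [if_neg]
      intro hlast
      have := List.inj_on_of_nodup_map hnd hi hlast (by
        rw [bar_of_eq (Fin.val_last n), bar_of_lt (by omega), hin])
      rw [this, Fin.val_last] at hin
      omega
    · intro hin
      rw [if_pos]
      rwa [← show i = Fin.last n from Fin.ext hin]
  · have := hl k hk hkn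
    dsimp only
    omega

end TwistedCoxeter

/-- The generalized distance in terms of folded coordinates. -/
theorem gdist_of_foldedCoord {n : ℕ} (hn : 2 ≤ n) {w c : List (Fin (n + 1))} {Q : ℕ → ℕ → Prop}
    {ξ : ℕ → ℤ} (h : IsFoldedData w c Q ξ) {α β : PosRoot n} {i j : ℕ} {p q : ℤ}
    (hα : FoldedCoord c ξ α i p) (hβ : FoldedCoord c ξ β j q) :
    gdist w α β =
      if 2 * (n : ℤ) + 2 - i - j < |p - q| ∧ |p - q| ≤ i + j then 2
      else if
        (|(i : ℤ) - j| < |p - q| ∧ |p - q| ≤ i + j ∧ |p - q| < 2 * (n : ℤ) + 2 - i - j) ∨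
        ((i : ℤ) + j < |p - q| ∧ 2 * (n : ℤ) + 2 - i - j < |p - q| ∧
          |p - q| ≤ 2 * (n : ℤ) + 2 - |(i : ℤ) - j|) then 1
      else 0 := by
  obtain ⟨l, σ, hcs, hξ⟩ := h.exists_coxeterSlice (by omega)
  obtain ⟨col, lo, hc⟩ := exists_isSegCoord (by omega) hcs.isSlice hcs.sign
  have S := hcs.readsWindow.segModel hn hc h.mem_class
  obtain ⟨i', hα, rfl⟩ := hα
  obtain ⟨j', hβ, rfl⟩ := hβ
  obtain ⟨x, hx, hx', rfl⟩ := hcs.segment_of_twistedCoord hξ hα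
  obtain ⟨y, hy, hy', rfl⟩ := hcs.segment_of_twistedCoord hξ hβ
  obtain ⟨c₁, l₁⟩ := hc.unique _ _ hx
  obtain ⟨c₂, l₂⟩ := hc.unique _ _ hy
  rw [← hx'] at c₁ l₁
  rw [← hy'] at c₂ l₂
  -- Both `p` and `q` are the same constant minus the sum of the two ends, so their difference is
  -- the negative of the difference of the sums.
  have key := S.gdist_eq α β (i := bar i') (j := bar j') (p := ξ 1 + 1 - 2 * x - bar i')
    (q := ξ 1 + 1 - 2 * y - bar j') (by rw [c₁]; ring) (by rw [c₂]; ring)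
    (by
      rw [c₁, c₂, l₁, l₂, ← abs_neg]
      congr 1
      ring)
  rwa [show 2 * ((n : ℤ) + 1) = 2 * n + 2 by ring] at key

end TwistedD

theorem theorem8p20 (n : ℕ) (hn : 2 ≤ n) :
    (∀ (w c : List (Fin (n + 1))) (Q : ℕ → ℕ → Prop) (ξ : ℕ → ℤ),
      TwistedD.TwistedAdapted w → TwistedD.IsFoldedData w c Q ξ →
      ∀ (α β : TwistedD.PosRoot n) (i j : ℕ) (p q : ℤ),
        TwistedD.FoldedCoord c ξ α i p → TwistedD.FoldedCoord c ξ β j q →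
        TwistedD.gdist w α β =
          if 2 * (n : ℤ) + 2 - i - j < |p - q| ∧ |p - q| ≤ i + j then 2
          else if
            (|(i : ℤ) - j| < |p - q| ∧ |p - q| ≤ i + j ∧ |p - q| < 2 * (n : ℤ) + 2 - i - j) ∨
            ((i : ℤ) + j < |p - q| ∧ 2 * (n : ℤ) + 2 - i - j < |p - q| ∧
              |p - q| ≤ 2 * (n : ℤ) + 2 - |(i : ℤ) - j|) then 1
          else 0) ∧
    (∀ (w c : List (Fin (n + 1))) (Q : ℕ → ℕ → Prop) (ξ : ℕ → ℤ)
      (w' c' : List (Fin (n + 1))) (Q' : ℕ → ℕ → Prop) (ξ' : ℕ → ℤ),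
      TwistedD.TwistedAdapted w → TwistedD.IsFoldedData w c Q ξ →
      TwistedD.TwistedAdapted w' → TwistedD.IsFoldedData w' c' Q' ξ' →
      ∀ (α β α' β' : TwistedD.PosRoot n) (i j : ℕ) (p q p' q' : ℤ),
        TwistedD.FoldedCoord c ξ α i p → TwistedD.FoldedCoord c ξ β j q →
        TwistedD.FoldedCoord c' ξ' α' i p' → TwistedD.FoldedCoord c' ξ' β' j q' →
        |p - q| = |p' - q'| →
        TwistedD.gdist w α β = TwistedD.gdist w' α' β') := by
  refine ⟨fun w c Q ξ _ h α β i j p q hα hβ => TwistedD.gdist_of_foldedCoord hn h hα hβ, ?_⟩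
  intro w c Q ξ w' c' Q' ξ' _ h _ h' α β α' β' i j p q p' q' hα hβ hα' hβ' hd
  rw [TwistedD.gdist_of_foldedCoord hn h hα hβ, TwistedD.gdist_of_foldedCoord hn h' hα' hβ', hd]
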